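/- Let $\mathcal L$ be the language $A ::= p \mid \neg A \mid A\to A\mid \Box A\mid \bigcirc(A/A)$ over propositional variables $p_0,p_1,\dots$. A preference model $(W,\succ,V)$ consists of a non-empty set $W$, an arbitrary relation $\succ\ \subseteq W\times W$ and $V:W\to\mathcal P(\{p_0,p_1,\dots\})$; $\neg,\to$ are classical at each world, $\Box A$ holds at a world iff $A$ holds at all worlds, and $\bigcirc(B/A)$ holds at a world iff $B$ holds at every world $y$ such that $A$ holds at $y$ and at no $z\succ y$. A formula is valid (a validity of the logic $\mathbf E$) if it holds at all worlds of all preference models. A hypersequent is a finite multiset of components $\Gamma\Rightarrow\Delta$, where $\Gamma,\Delta$ are finite multisets of formulas of $\mathcal L$ extended by a unary modality $\mathcal{B}et$; put $\Gamma^{b\downarrow}=\{A:\mathcal Bet\,A\in\Gamma\}$. An axiom is a hypersequent $\Gamma,p\Rightarrow\Delta,p\mid G$. The rules of $\mathbf{HE}^+$ are, read from conclusion to premises (";" separates premises, $G$ is an arbitrary context): * $(\neg L)$: $\Gamma,\neg A\Rightarrow\Delta\mid G$ from $\Gamma,\neg A\Rightarrow\Delta,A\mid G$; * $(\neg R)$: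 $\Gamma\Rightarrow\Delta,\neg A\mid G$ from $\Gamma,A\Rightarrow\Delta,\neg A\mid G$; * $({\to}L)$: $\Gamma,A\to B\Rightarrow\Delta\mid G$ from $\Gamma,A\to B\Rightarrow\Delta,A\mid G$; $\Gamma,A\to B,B\Rightarrow\Delta\mid G$; * $({\to}R)$: $\Gamma\Rightarrow\Delta,A\to B\mid G$ from $\Gamma,A\Rightarrow\Delta,A\to B,B\mid G$; * $(\bigcirc R+)$: $\Gamma\Rightarrow\bigcirc(B/A),\Delta\mid G$ from $\Gamma\Rightarrow\bigcirc(B/A),\Delta\mid A,\mathcal Bet\,\neg A\Rightarrow B\mid G$; * $(\bigcirc L+)$: $\Gamma,\bigcirc(B/A)\Rightarrow\Delta\mid G$ from $\Gamma,\bigcirc(B/A)\Rightarrow\Delta,A\mid G$; $\Gamma,\bigcirc(B/A)\Rightarrow\Delta,\mathcal Bet\,\neg A\mid G$; $\Gamma,\bigcirc(B/A),B\Rightarrow\Delta\mid G$; * $(\bigcirc L2)$: $\Gamma,\bigcirc(B/A)\Rightarrow\Delta\mid\Sigma\Rightarrow\Pi\mid G$ from the three hypersequents obtained from it by replacing $\Sigma\Rightarrow\Pi$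 by $\Sigma\Rightarrow\Pi,A$; by $\Sigma\Rightarrow\Pi,\mathcal Bet\,\neg A$; by $\Sigma,B\Rightarrow\Pi$; * $(\mathcal Bet+)$: $\Gamma\Rightarrow\Delta,\mathcal Bet\,A\mid G$ from $\Gamma\Rightarrow\Delta,\mathcal Bet\,A\mid\Gamma^{b\downarrow}\Rightarrow A\mid G$; * $(\Box R+)$: $\Gamma\Rightarrow\Delta,\Box A\mid G$ from $\Gamma\Rightarrow\Delta,\Box A\mid\ \Rightarrow A\mid G$; * $(\Box L+)$: $\Gamma,\Box A\Rightarrow\Delta\mid G$ from $\Gamma,\Box A,A\Rightarrow\Delta\mid G$; * $(\Box L2)$: $\Gamma,\Box A\Rightarrow\Delta\mid\Sigma\Rightarrow\Pi\mid G$ from $\Gamma,\Box A\Rightarrow\Delta\mid\Sigma,A\Rightarrow\Pi\mid G$. A derivation from $H$ is a finite tree with root $H$ built by backward application of these rules (leaves are arbitrary). With each rule goes a saturation condition on a hypersequent $H$: * $(\neg L)$: if $\Gamma,\neg A\Rightarrow\Delta\in H$ then $A\in\Delta$; $(\neg R)$: if $\Gamma\Rightarrow\Delta,\neg A\in H$ then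 $A\in\Gamma$; * $({\to}L)$: if $\Gamma,A\to B\Rightarrow\Delta\in H$ then $A\in\Delta$ or $B\in\Gamma$; $({\to}R)$: if $\Gamma\Rightarrow\Delta,A\to B\in H$ then $A\in\Gamma$ and $B\in\Delta$; * $(\bigcirc L+)$, $(\bigcirc L2)$: if $\Gamma,\bigcirc(B/A)\Rightarrow\Delta\in H$ then $A\in\Pi$ or $\mathcal Bet\,\neg A\in\Pi$ or $B\in\Sigma$, where $\Sigma\Rightarrow\Pi$ is that same component, respectively any component of $H$; * $(\bigcirc R+)$: if $\Gamma\Rightarrow\bigcirc(B/A),\Delta\in H$ then some $\Sigma\Rightarrow\Pi\in H$ has $A,\mathcal Bet\,\neg A\in\Sigma$ and $B\in\Pi$; * $(\mathcal Bet+)$: if $\Gamma\Rightarrow\Delta,\mathcal Bet\,A\in H$ then some $\Sigma\Rightarrow\Pi\in H$ has $\Gamma^{b\downarrow}\subseteq\Sigma$ and $A\in\Pi$; * $(\Box R+)$: if $\Gamma\Rightarrow\Delta,\Box A\in H$ then some $\Sigma\Rightarrow\Pi\in H$ has $A\in\Pi$; * $(\Box L+)$, $(\Box L2)$: if $\Gamma,\Box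 A\Rightarrow\Delta\in H$ then $A\in\Sigma$, where $\Sigma\Rightarrow\Pi$ is that same component, respectively any component of $H$. $H$ is saturated if it is not an axiom and satisfies all these conditions. A derivation is irredundant if no rule is applied in it to an axiom, and no rule is applied to a hypersequent that already satisfies the saturation condition associated with that application. Formulas and hypersequents are written as strings over a fixed finite alphabet (indices of variables in binary), and $|\cdot|$ denotes the length of the string. Theorem. 1. The validity problem of $\mathbf E$, i.e. the set of strings of valid formulas of $\mathcal L$, is in co-NP. 2. The set of strings of saturated hypersequents is decidable in (deterministic) polynomial time. 3. There is a constant $C$ such that for every formula $A$ of $\mathcal L$: (a) every hypersequent $H$ occurring in an irredundant $\mathbf{HE}^+$ derivation from $\Rightarrow A$ satisfies $|H|\le C|A|^4$; (b) if $A$ is not valid, then some irredundant $\mathbf{HE}^+$ derivation from $\Rightarrow A$ contains a saturated hypersequent $H$, with $|H|\le C|A|^4$; (c) if some $\mathbf{HE}^+$ derivation from $\Rightarrow A$ contains a saturated hypersequent, then $A$ is not valid. -/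

import Mathlib

namespace DeonticE

/-! ### The language and its preference semantics -/

/-- The language `L` of the logic E; `obl B A` is the conditional obligation `○(B/A)`. -/
inductive Form : Type
  | var (p : ℕ)
  | neg (A : Form)
  | imp (A B : Form)
  | box (A : Form)
  | obl (B A : Form)
  deriving DecidableEq

/-- Preference models: a non-empty set of worlds with an arbitrary betterness relation. -/
structure PrefModel where
  W : Type
  nonempty : Nonempty W
  /-- `better x y` says that `x` is better than `y`, i.e. `x ≻ y`. -/
  better : W → W → Prop
  val : W → Set ℕ

/-- `M.Sat A x` is `M, x ⊨ A`. -/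
def PrefModel.Sat (M : PrefModel) : Form → M.W → Prop
  | .var p, x => p ∈ M.val x
  | .neg A, x => ¬ M.Sat A x
  | .imp A B, x => M.Sat A x → M.Sat B x
  | .box A, _ => ∀ y, M.Sat A y
  | .obl B A, _ => ∀ y, (M.Sat A y ∧ ¬ ∃ z, M.better z y ∧ M.Sat A z) → M.Sat B y

/-- Validity in every preference model. -/
def Valid (A : Form) : Prop := ∀ (M : PrefModel) (x : M.W), M.Sat A x

/-! ### The extended language `L + Bet` and hypersequents -/

/-- Formulas of the language of E extended with the unary modality `Bet`. -/
inductive BForm : Type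
  | var (p : ℕ)
  | neg (A : BForm)
  | imp (A B : BForm)
  | box (A : BForm)
  | obl (B A : BForm)
  | bet (A : BForm)
  deriving DecidableEq

/-- The inclusion of `L` into `L + Bet`. -/
def Form.toB : Form → BForm
  | .var p => .var p
  | .neg A => .neg A.toB
  | .imp A B => .imp A.toB B.toB
  | .box A => .box A.toB
  | .obl B A => .obl B.toB A.toB

/-- A sequent `Γ ⇒ Δ` of multisets of formulas. -/
structure Sequent where
  ante : Multiset BForm
  succ : Multiset BForm

infix:45 " ⇒ₛ " => Sequent.mk

/-- A hypersequent is a multiset of sequents, its components. -/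
abbrev Hyperseq := Multiset Sequent

/-- `A` if the formula is `Bet A`. -/
def BForm.unBet : BForm → Option BForm
  | .bet A => some A
  | _ => none

/-- `Γ^{b↓}`, the multiset of all `A` with `Bet A` in `Γ`. -/
def betDown (Γ : Multiset BForm) : Multiset BForm := Γ.filterMap BForm.unBet

/-- The initial hypersequents `Γ, p ⇒ Δ, p | G`. -/
def IsAxiom (H : Hyperseq) : Prop :=
  ∃ S ∈ H, ∃ p, BForm.var p ∈ S.ante ∧ BForm.var p ∈ S.succ

/-! ### The calculus HE+ -/

/-- Instances of the rules of HE+. -/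
inductive RuleApp : Type
  | negL (Γ Δ : Multiset BForm) (A : BForm) (G : Hyperseq)
  | negR (Γ Δ : Multiset BForm) (A : BForm) (G : Hyperseq)
  | impL (Γ Δ : Multiset BForm) (A B : BForm) (G : Hyperseq)
  | impR (Γ Δ : Multiset BForm) (A B : BForm) (G : Hyperseq)
  | oblR (Γ Δ : Multiset BForm) (B A : BForm) (G : Hyperseq)
  | oblL (Γ Δ : Multiset BForm) (B A : BForm) (G : Hyperseq)
  | oblL2 (Γ Δ Sg Pi : Multiset BForm) (B A : BForm) (G : Hyperseq)
  | betR (Γ Δ : Multiset BForm) (A : BForm) (G : Hyperseq)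
  | boxR (Γ Δ : Multiset BForm) (A : BForm) (G : Hyperseq)
  | boxL (Γ Δ : Multiset BForm) (A : BForm) (G : Hyperseq)
  | boxL2 (Γ Δ Sg Pi : Multiset BForm) (A : BForm) (G : Hyperseq)

open BForm in
/-- The conclusion of a rule instance. -/
def RuleApp.concl : RuleApp → Hyperseq
  | negL Γ Δ A G => (neg A ::ₘ Γ ⇒ₛ Δ) ::ₘ G
  | negR Γ Δ A G => (Γ ⇒ₛ neg A ::ₘ Δ) ::ₘ G
  | impL Γ Δ A B G => (imp A B ::ₘ Γ ⇒ₛ Δ) ::ₘ G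
  | impR Γ Δ A B G => (Γ ⇒ₛ imp A B ::ₘ Δ) ::ₘ G
  | oblR Γ Δ B A G => (Γ ⇒ₛ obl B A ::ₘ Δ) ::ₘ G
  | oblL Γ Δ B A G => (obl B A ::ₘ Γ ⇒ₛ Δ) ::ₘ G
  | oblL2 Γ Δ Sg Pi B A G => (obl B A ::ₘ Γ ⇒ₛ Δ) ::ₘ (Sg ⇒ₛ Pi) ::ₘ G
  | betR Γ Δ A G => (Γ ⇒ₛ bet A ::ₘ Δ) ::ₘ G
  | boxR Γ Δ A G => (Γ ⇒ₛ box A ::ₘ Δ) ::ₘ G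
  | boxL Γ Δ A G => (box A ::ₘ Γ ⇒ₛ Δ) ::ₘ G
  | boxL2 Γ Δ Sg Pi A G => (box A ::ₘ Γ ⇒ₛ Δ) ::ₘ (Sg ⇒ₛ Pi) ::ₘ G

open BForm in
/-- The premises of a rule instance. -/
def RuleApp.prems : RuleApp → List Hyperseq
  | negL Γ Δ A G => [(neg A ::ₘ Γ ⇒ₛ A ::ₘ Δ) ::ₘ G]
  | negR Γ Δ A G => [(A ::ₘ Γ ⇒ₛ neg A ::ₘ Δ) ::ₘ G]
  | impL Γ Δ A B G =>
      [(imp A B ::ₘ Γ ⇒ₛ A ::ₘ Δ) ::ₘ G, (B ::ₘ imp A B ::ₘ Γ ⇒ₛ Δ) ::ₘ G]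
  | impR Γ Δ A B G => [(A ::ₘ Γ ⇒ₛ B ::ₘ imp A B ::ₘ Δ) ::ₘ G]
  | oblR Γ Δ B A G =>
      [(Γ ⇒ₛ obl B A ::ₘ Δ) ::ₘ ({A, bet (neg A)} ⇒ₛ {B}) ::ₘ G]
  | oblL Γ Δ B A G =>
      [(obl B A ::ₘ Γ ⇒ₛ A ::ₘ Δ) ::ₘ G,
       (obl B A ::ₘ Γ ⇒ₛ bet (neg A) ::ₘ Δ) ::ₘ G,
       (B ::ₘ obl B A ::ₘ Γ ⇒ₛ Δ) ::ₘ G]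
  | oblL2 Γ Δ Sg Pi B A G =>
      [(obl B A ::ₘ Γ ⇒ₛ Δ) ::ₘ (Sg ⇒ₛ A ::ₘ Pi) ::ₘ G,
       (obl B A ::ₘ Γ ⇒ₛ Δ) ::ₘ (Sg ⇒ₛ bet (neg A) ::ₘ Pi) ::ₘ G,
       (obl B A ::ₘ Γ ⇒ₛ Δ) ::ₘ (B ::ₘ Sg ⇒ₛ Pi) ::ₘ G]
  | betR Γ Δ A G => [(Γ ⇒ₛ bet A ::ₘ Δ) ::ₘ (betDown Γ ⇒ₛ {A}) ::ₘ G]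
  | boxR Γ Δ A G => [(Γ ⇒ₛ box A ::ₘ Δ) ::ₘ (0 ⇒ₛ {A}) ::ₘ G]
  | boxL Γ Δ A G => [(A ::ₘ box A ::ₘ Γ ⇒ₛ Δ) ::ₘ G]
  | boxL2 Γ Δ Sg Pi A G => [(box A ::ₘ Γ ⇒ₛ Δ) ::ₘ (A ::ₘ Sg ⇒ₛ Pi) ::ₘ G]

open BForm in
/-- A backward application of a rule is redundant if its conclusion satisfies the
saturation condition associated to that application. -/
def RuleApp.Redundant : RuleApp → Prop
  | negL _ Δ A _ => A ∈ Δ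
  | negR Γ _ A _ => A ∈ Γ
  | impL Γ Δ A B _ => A ∈ Δ ∨ B ∈ Γ
  | impR Γ Δ A B _ => A ∈ Γ ∧ B ∈ Δ
  | oblR Γ Δ B A G =>
      ∃ S ∈ (oblR Γ Δ B A G).concl, A ∈ S.ante ∧ bet (neg A) ∈ S.ante ∧ B ∈ S.succ
  | oblL Γ Δ B A _ => A ∈ Δ ∨ bet (neg A) ∈ Δ ∨ B ∈ Γ
  | oblL2 _ _ Sg Pi B A _ => A ∈ Pi ∨ bet (neg A) ∈ Pi ∨ B ∈ Sg
  | betR Γ Δ A G => ∃ S ∈ (betR Γ Δ A G).concl, betDown Γ ⊆ S.ante ∧ A ∈ S.succ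
  | boxR Γ Δ A G => ∃ S ∈ (boxR Γ Δ A G).concl, A ∈ S.succ
  | boxL Γ _ A _ => A ∈ Γ
  | boxL2 _ _ Sg _ A _ => A ∈ Sg

/-- A derivation in HE+ with root `H`: a tree built by backward application of the rules;
its leaves need not be axioms. -/
inductive Derivation : Hyperseq → Type
  | leaf {H : Hyperseq} : Derivation H
  | node {H : Hyperseq} (r : RuleApp) (hr : r.concl = H)
      (sub : (i : Fin r.prems.length) → Derivation (r.prems.get i)) : Derivation H

/-- `D.Occurs K`: the hypersequent `K` labels a node of `D`. -/
def Derivation.Occurs : {H : Hyperseq} → Derivation H → Hyperseq → Prop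
  | H, .leaf, K => K = H
  | H, .node _ _ sub, K => K = H ∨ ∃ i, (sub i).Occurs K

/-- A derivation is irredundant if no rule is applied to an axiom and no rule application
is redundant. -/
def Derivation.Irredundant : {H : Hyperseq} → Derivation H → Prop
  | _, .leaf => True
  | H, .node r _ sub => ¬ IsAxiom H ∧ ¬ r.Redundant ∧ ∀ i, (sub i).Irredundant

/-- The root hypersequent `⇒ A`. -/
def rootOf (A : Form) : Hyperseq := {0 ⇒ₛ {A.toB}}

open BForm in
/-- Saturated hypersequents. -/
structure Saturated (H : Hyperseq) : Prop where
  not_axiom : ¬ IsAxiom H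
  impL : ∀ S ∈ H, ∀ A B, imp A B ∈ S.ante → A ∈ S.succ ∨ B ∈ S.ante
  impR : ∀ S ∈ H, ∀ A B, imp A B ∈ S.succ → A ∈ S.ante ∧ B ∈ S.succ
  negL : ∀ S ∈ H, ∀ A, neg A ∈ S.ante → A ∈ S.succ
  negR : ∀ S ∈ H, ∀ A, neg A ∈ S.succ → A ∈ S.ante
  oblL : ∀ S ∈ H, ∀ B A, obl B A ∈ S.ante →
    A ∈ S.succ ∨ bet (neg A) ∈ S.succ ∨ B ∈ S.ante
  oblL2 : ∀ S ∈ H, ∀ T ∈ H, ∀ B A, obl B A ∈ S.ante →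
    A ∈ T.succ ∨ bet (neg A) ∈ T.succ ∨ B ∈ T.ante
  oblR : ∀ S ∈ H, ∀ B A, obl B A ∈ S.succ →
    ∃ T ∈ H, A ∈ T.ante ∧ bet (neg A) ∈ T.ante ∧ B ∈ T.succ
  betR : ∀ S ∈ H, ∀ A, bet A ∈ S.succ → ∃ T ∈ H, betDown S.ante ⊆ T.ante ∧ A ∈ T.succ
  boxR : ∀ S ∈ H, ∀ A, box A ∈ S.succ → ∃ T ∈ H, A ∈ T.succ
  boxL : ∀ S ∈ H, ∀ A, box A ∈ S.ante → A ∈ S.ante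
  boxL2 : ∀ S ∈ H, ∀ T ∈ H, ∀ A, box A ∈ S.ante → A ∈ T.ante

/-! ### Formulas and hypersequents as strings over a finite alphabet -/

/-- The symbols used to write formulas and hypersequents. -/
inductive Sym : Type
  | var | bit (b : Bool) | neg | imp | box | obl | bet | comma | arrow | bar
  deriving DecidableEq, Fintype

/-- Formulas in prefix notation; the variable with index `p` is the symbol `var`
followed by the binary digits of `p`, least significant first. -/
def BForm.encode : BForm → List Sym
  | .var p => Sym.var :: p.bits.map Sym.bit
  | .neg A => Sym.neg :: A.encode
  | .imp A B => Sym.imp :: (A.encode ++ B.encode)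
  | .box A => Sym.box :: A.encode
  | .obl B A => Sym.obl :: (B.encode ++ A.encode)
  | .bet A => Sym.bet :: A.encode

/-- The string of symbols of a formula of `L`. -/
def Form.encode (A : Form) : List Sym := A.toB.encode

/-- `|A|`, the size of `A` as a string of symbols. -/
def Form.size (A : Form) : ℕ := A.encode.length

/-- Total length of the formulas of a multiset, each followed by a comma. -/
def formulasSize (Γ : Multiset BForm) : ℕ := (Γ.map fun A => A.encode.length + 1).sum

/-- The size of a hypersequent as a string of symbols. -/
def hyperSize (H : Hyperseq) : ℕ :=
  (H.map fun S => formulasSize S.ante + 1 + formulasSize S.succ + 1).sum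

/-- A hypersequent written down in some order. -/
abbrev HyperList := List (List BForm × List BForm)

/-- The hypersequent that is written down by `h`. -/
def HyperList.toHyper (h : HyperList) : Hyperseq :=
  ((h.map fun S => ((S.1 : Multiset BForm) ⇒ₛ (S.2 : Multiset BForm)) : List Sequent) :
    Multiset Sequent)

/-- The formulas of a list, each followed by a comma. -/
def encodeFormulas (l : List BForm) : List Sym := l.flatMap fun A => A.encode ++ [Sym.comma]

/-- The string of symbols of a listed hypersequent. -/
def HyperList.encode (h : HyperList) : List Sym :=
  h.flatMap fun S => encodeFormulas S.1 ++ Sym.arrow :: (encodeFormulas S.2 ++ [Sym.bar])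

/-! ### Complexity classes, over Mathlib's multi-stack Turing machines -/

/-- The languages that a deterministic Turing machine decides in polynomial time. -/
def InP {Γ : Type} (L : Set (List Γ)) : Prop :=
  ∃ f : List Γ → Bool, (∀ w, f w = true ↔ w ∈ L) ∧
    Nonempty (Turing.TM2ComputableInPolyTime (id : List Γ → List Γ) Computability.encodeBool f)

/-- A pair of strings as one string, with a separator between the two. -/
def encodePair {Γ Δ : Type} (x : List Γ × List Δ) : List (Option (Γ ⊕ Δ)) :=
  x.1.map (fun a => some (Sum.inl a)) ++ none :: x.2.map (fun b => some (Sum.inr b))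

/-- The languages in NP: there are a polynomial-time verifier and a polynomial bound on the
length of certificates, which are strings over some finite alphabet. -/
def InNP {Γ : Type} (L : Set (List Γ)) : Prop :=
  ∃ (Δ : Type) (_ : Fintype Δ) (V : List Γ × List Δ → Bool) (q : Polynomial ℕ),
    Nonempty (Turing.TM2ComputableInPolyTime
      (encodePair : List Γ × List Δ → List (Option (Γ ⊕ Δ))) Computability.encodeBool V) ∧
    ∀ w, w ∈ L ↔ ∃ c : List Δ, c.length ≤ q.eval w.length ∧ V (w, c) = true

/-- The languages whose complement is in NP. -/
def InCoNP {Γ : Type} (L : Set (List Γ)) : Prop := InNP Lᶜ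

/-- The validity problem of E. -/
def validLang : Set (List Sym) := {w | ∃ A : Form, A.encode = w ∧ Valid A}

/-- The strings that write down a saturated hypersequent. -/
def saturatedLang : Set (List Sym) :=
  {w | ∃ h : HyperList, h.encode = w ∧ Saturated h.toHyper}

end DeonticE

namespace DeonticE

/-! ### Semantics of the extended language -/

/-! A saturated hypersequent is a countermodel in disguise. Its components are the worlds, and `T`
is better than `S` when everything that the antecedent of `S` prefixes with `Bet` stands in the
antecedent of `T`. Structural induction then makes antecedents true and succedents false
(`Saturated.truth`). Rules read backward never delete a formula, so `A` still stands in a succedent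
of every hypersequent reached from `⇒ A`, and a saturated one refutes `A` (`not_valid_of_occurs`).

Conversely, a countermodel steers the search. If every component of a conclusion is refuted at some
world of `M`, the same is true of some premise (`RuleApp.exists_refuted_prem`), and such a
hypersequent is never an axiom. Following these premises through non-redundant applications can stop
only at a saturated hypersequent (`saturated_of_forall_redundant`). It does stop, because the size
grows strictly and is bounded.

For the bound let `n = |A|`. Only the formulas `C`, `¬C`, `Bet ¬C` with `C` a subformula of `A`
arise, at most `3n` of them. A non-redundant application inside a component brings a formula new to
its antecedent or succedent, so a component has `O(n)` formula occurrences and length `O(n²)`. An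
application that creates a component meets a requirement that no component met before. An antecedent
never holds more than one `Bet` formula, so a requirement is described by at most two subformulas
and there are `O(n²)` of them. The product is `O(n⁴)` (`HypInv.prem`, `HypInv.size_le`).

The complexity claims rest on a small language of structured stack programs, compiled to multi-stack
Turing machines with exact step counts (`Exec.runsIn`). Polynomial-time predicates on string
variables are closed under composition, branching, loops with a decreasing potential, and search
through pieces and cuts of strings. Saturation is a nest of such searches, hence in P. A short
saturated hypersequent with `A` in a succedent certifies that `A` is not valid, which puts validity
in co-NP. -/

/-- Truth in the extended language: `Bet A` holds where `A` holds at all better worlds. -/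
def PrefModel.BSat (M : PrefModel) : BForm → M.W → Prop
  | .var p, x => p ∈ M.val x
  | .neg A, x => ¬ M.BSat A x
  | .imp A B, x => M.BSat A x → M.BSat B x
  | .box A, _ => ∀ y, M.BSat A y
  | .obl B A, _ => ∀ y, (M.BSat A y ∧ ¬ ∃ z, M.better z y ∧ M.BSat A z) → M.BSat B y
  | .bet A, x => ∀ z, M.better z x → M.BSat A z

theorem PrefModel.bsat_toB (M : PrefModel) (A : Form) :
    ∀ x, M.BSat A.toB x ↔ M.Sat A x := by
  induction A with
  | var p => intro x; rfl
  | neg A ih => intro x; simp [Form.toB, BSat, Sat, ih]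
  | imp A B ihA ihB => intro x; simp [Form.toB, BSat, Sat, ihA, ihB]
  | box A ih => intro x; simp [Form.toB, BSat, Sat, ih]
  | obl B A ihB ihA => intro x; simp [Form.toB, BSat, Sat, ihA, ihB]

theorem mem_betDown {Γ : Multiset BForm} {F : BForm} : F ∈ betDown Γ ↔ .bet F ∈ Γ := by
  unfold betDown
  rw [Multiset.mem_filterMap]
  constructor
  · rintro ⟨G, hG, h⟩
    cases G <;> simp [BForm.unBet] at h
    subst h; exact hG
  · intro h; exact ⟨_, h, rfl⟩

/-! ### The model of a saturated hypersequent -/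

/-- The preference model whose worlds are the components of a hypersequent. -/
def componentModel (H : Hyperseq) (hH : ∃ S, S ∈ H) : PrefModel where
  W := {S // S ∈ H}
  nonempty := let ⟨S, hS⟩ := hH; ⟨⟨S, hS⟩⟩
  better T S := betDown S.1.ante ⊆ T.1.ante
  val S := {p | .var p ∈ S.1.ante}

/-- Structural induction suffices although the conditions for `○(B/A)` mention `Bet ¬A`, which is
not a subformula: the saturation conditions for `Bet` and `¬` reduce it to `A`, where the induction
hypothesis applies. -/
theorem Saturated.truth {H : Hyperseq} (h : Saturated H) (hH : ∃ S, S ∈ H) (F : BForm) :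
    ∀ S : (componentModel H hH).W,
      (F ∈ S.1.ante → (componentModel H hH).BSat F S) ∧
      (F ∈ S.1.succ → ¬ (componentModel H hH).BSat F S) := by
  induction F with
  | var p =>
    rintro ⟨S, hS⟩
    exact ⟨fun hp => hp, fun hp hp' => Saturated.not_axiom h ⟨S, hS, p, hp', hp⟩⟩
  | neg A ih =>
    rintro ⟨S, hS⟩
    exact ⟨fun hA => (ih ⟨S, hS⟩).2 (h.negL S hS A hA),
      fun hA hn => hn ((ih ⟨S, hS⟩).1 (h.negR S hS A hA))⟩
  | imp A B ihA ihB =>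
    rintro ⟨S, hS⟩
    refine ⟨fun hF hA => ?_, fun hF hn => ?_⟩
    · rcases h.impL S hS A B hF with h1 | h1
      · exact absurd hA ((ihA ⟨S, hS⟩).2 h1)
      · exact (ihB ⟨S, hS⟩).1 h1
    · obtain ⟨h1, h2⟩ := h.impR S hS A B hF
      exact (ihB ⟨S, hS⟩).2 h2 (hn ((ihA ⟨S, hS⟩).1 h1))
  | box A ih =>
    rintro ⟨S, hS⟩
    refine ⟨fun hF T => (ih T).1 (h.boxL2 S hS T.1 T.2 A hF), fun hF hn => ?_⟩
    obtain ⟨T, hT, hA⟩ := h.boxR S hS A hF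
    exact (ih ⟨T, hT⟩).2 hA (hn ⟨T, hT⟩)
  | obl B A ihB ihA =>
    rintro ⟨S, hS⟩
    refine ⟨fun hF T hT => ?_, fun hF hn => ?_⟩
    · rcases h.oblL2 S hS T.1 T.2 B A hF with h1 | h1 | h1
      · exact absurd hT.1 ((ihA T).2 h1)
      -- With `Bet ¬A` in the succedent of `T` there is a better component with `¬A` in its
      -- succedent, hence `A` in its antecedent, so `T` is not a best `A`-world.
      · obtain ⟨U, hU, hsub, hA⟩ := h.betR T.1 T.2 _ h1
        exact absurd ⟨⟨U, hU⟩, hsub, (ihA ⟨U, hU⟩).1 (h.negR U hU A hA)⟩ hT.2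
      · exact (ihB T).1 h1
    · obtain ⟨T, hT, hA, hb, hB⟩ := h.oblR S hS B A hF
      refine (ihB ⟨T, hT⟩).2 hB (hn ⟨T, hT⟩ ⟨(ihA ⟨T, hT⟩).1 hA, ?_⟩)
      -- Any better `U` inherits `¬A` from the formula `Bet ¬A` in the antecedent of `T`, so `A`
      -- fails there and `T` is a best `A`-world.
      rintro ⟨U, hU, hUA⟩
      exact (ihA U).2 (h.negL U.1 U.2 A (hU (mem_betDown.2 hb))) hUA
  | bet A ih =>
    rintro ⟨S, hS⟩
    refine ⟨fun hF T hT => (ih T).1 (hT (mem_betDown.2 hF)), fun hF hn => ?_⟩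
    obtain ⟨T, hT, hsub, hA⟩ := h.betR S hS A hF
    exact (ih ⟨T, hT⟩).2 hA (hn ⟨T, hT⟩ hsub)

theorem Saturated.not_valid {H : Hyperseq} (h : Saturated H) {A : Form} {S : Sequent}
    (hS : S ∈ H) (hA : A.toB ∈ S.succ) : ¬ Valid A := by
  intro hv
  refine (h.truth ⟨S, hS⟩ A.toB ⟨S, hS⟩).2 hA ?_
  exact (PrefModel.bsat_toB _ _ _).2 (hv _ _)

/-! ### Backward rule application extends hypersequents -/

/-- Every component of `H` is contained in one of `K`. -/
def Extends (H K : Hyperseq) : Prop :=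
  ∀ S ∈ H, ∃ T ∈ K, S.ante ⊆ T.ante ∧ S.succ ⊆ T.succ

theorem Extends.refl (H : Hyperseq) : Extends H H :=
  fun S hS => ⟨S, hS, fun _ h => h, fun _ h => h⟩

theorem Extends.of_cons {S T : Sequent} {H K : Hyperseq} (h1 : S.ante ⊆ T.ante)
    (h2 : S.succ ⊆ T.succ) (h : Extends H K) : Extends (S ::ₘ H) (T ::ₘ K) := by
  intro U hU
  rcases Multiset.mem_cons.1 hU with rfl | hU
  · exact ⟨T, Multiset.mem_cons_self _ _, h1, h2⟩
  · obtain ⟨V, hV, h3⟩ := h U hU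
    exact ⟨V, Multiset.mem_cons_of_mem hV, h3⟩

theorem Extends.add (S : Sequent) (H : Hyperseq) : Extends H (S ::ₘ H) :=
  fun T hT => ⟨T, Multiset.mem_cons_of_mem hT, fun _ h => h, fun _ h => h⟩

/-- All rules are cumulative: principal formulas are kept and components only grow or are added.
This carries both the persistence of the root formula and that of requirements already met. -/
theorem RuleApp.extends_prem (r : RuleApp) {K : Hyperseq} (hK : K ∈ r.prems) :
    Extends r.concl K := by
  cases r <;> simp only [prems, List.mem_cons, List.not_mem_nil, or_false] at hK <;>
    rcases hK with rfl | rfl | rfl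
  all_goals first
    | (refine Extends.of_cons ?_ ?_ (Extends.refl _) <;> intro x hx <;>
        simp only [Multiset.mem_cons] at hx ⊢ <;> tauto)
    | (refine Extends.of_cons (fun _ h => h) (fun _ h => h) (Extends.add _ _))
    | (refine Extends.of_cons (fun _ h => h) (fun _ h => h) ?_
       refine Extends.of_cons ?_ ?_ (Extends.refl _) <;> intro x hx <;>
        simp only [Multiset.mem_cons] at hx ⊢ <;> tauto)

theorem Derivation.Occurs.exists_mem_succ {F : BForm} {K : Hyperseq} : ∀ {H : Hyperseq}
    (D : Derivation H), D.Occurs K → (∃ S ∈ H, F ∈ S.succ) → ∃ S ∈ K, F ∈ S.succ := by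
  intro H D
  induction D with
  | leaf => intro h hF; rw [Derivation.Occurs] at h; exact h ▸ hF
  | node r hr sub ih =>
    intro h hF
    rw [Derivation.Occurs] at h
    rcases h with rfl | ⟨i, hi⟩
    · exact hF
    · refine ih i hi ?_
      obtain ⟨S, hS, hFS⟩ := hF
      subst hr
      obtain ⟨T, hT, _, h2⟩ := r.extends_prem (List.get_mem r.prems i) S hS
      exact ⟨T, hT, h2 hFS⟩

theorem not_valid_of_occurs {A : Form} (D : Derivation (rootOf A)) {H : Hyperseq}
    (hD : D.Occurs H) (hH : Saturated H) : ¬ Valid A := by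
  obtain ⟨S, hS, hA⟩ := hD.exists_mem_succ (F := A.toB) D
      ⟨_, Multiset.mem_singleton_self _,
    Multiset.mem_singleton_self _⟩
  exact hH.not_valid hS hA

/-! ### Countermodels guide the proof search -/

/-- Every component of `H` is refuted at some world of `M`. -/
def Refuted (M : PrefModel) (H : Hyperseq) : Prop :=
  ∀ S ∈ H, ∃ x, (∀ F ∈ S.ante, M.BSat F x) ∧ ∀ F ∈ S.succ, ¬ M.BSat F x

theorem refuted_cons {M : PrefModel} {S : Sequent} {H : Hyperseq} :
    Refuted M (S ::ₘ H) ↔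
      (∃ x, (∀ F ∈ S.ante, M.BSat F x) ∧ ∀ F ∈ S.succ, ¬ M.BSat F x) ∧ Refuted M H := by
  simp [Refuted]

/-- Branching rules are decided by truth in `M` at the world refuting the active component. Rules
that create a component obtain a world for it from the falsity of the principal formula. No property
of the betterness relation is needed, since best `A`-worlds are exactly the worlds satisfying `A`
and `Bet ¬A`. -/
theorem RuleApp.exists_refuted_prem {M : PrefModel} (r : RuleApp) (h : Refuted M r.concl) :
    ∃ K ∈ r.prems, Refuted M K := by
  cases r with
  | negL Γ Δ A G =>
    obtain ⟨⟨x, h1, h2⟩, hG⟩ := refuted_cons.1 h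
    refine ⟨_, List.mem_cons_self, refuted_cons.2 ⟨⟨x, h1, ?_⟩, hG⟩⟩
    simp only [Multiset.forall_mem_cons] at h1 ⊢
    exact ⟨h1.1, h2⟩
  | negR Γ Δ A G =>
    obtain ⟨⟨x, h1, h2⟩, hG⟩ := refuted_cons.1 h
    refine ⟨_, List.mem_cons_self, refuted_cons.2 ⟨⟨x, ?_, h2⟩, hG⟩⟩
    simp only [Multiset.forall_mem_cons] at h2 ⊢
    exact ⟨not_not.1 h2.1, h1⟩
  | impL Γ Δ A B G =>
    obtain ⟨⟨x, h1, h2⟩, hG⟩ := refuted_cons.1 h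
    have h3 := (Multiset.forall_mem_cons.1 h1).1
    by_cases hA : M.BSat A x
    · refine ⟨_, List.mem_cons_of_mem _ List.mem_cons_self, refuted_cons.2 ⟨⟨x, ?_, h2⟩, hG⟩⟩
      exact Multiset.forall_mem_cons.2 ⟨h3 hA, h1⟩
    · refine ⟨_, List.mem_cons_self, refuted_cons.2 ⟨⟨x, h1, ?_⟩, hG⟩⟩
      exact Multiset.forall_mem_cons.2 ⟨hA, h2⟩
  | impR Γ Δ A B G =>
    obtain ⟨⟨x, h1, h2⟩, hG⟩ := refuted_cons.1 h
    have h3 := (Multiset.forall_mem_cons.1 h2).1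
    simp only [PrefModel.BSat, Classical.not_imp] at h3
    exact ⟨_, List.mem_cons_self, refuted_cons.2 ⟨⟨x, Multiset.forall_mem_cons.2 ⟨h3.1, h1⟩,
      Multiset.forall_mem_cons.2 ⟨h3.2, h2⟩⟩, hG⟩⟩
  | oblR Γ Δ B A G =>
    obtain ⟨⟨x, h1, h2⟩, hG⟩ := refuted_cons.1 h
    have h3 := (Multiset.forall_mem_cons.1 h2).1
    simp only [PrefModel.BSat, not_forall] at h3
    -- `y` is a best `A`-world where `B` fails; it refutes the component created by the rule.
    obtain ⟨y, ⟨hA, hb⟩, hB⟩ := h3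
    refine ⟨_, List.mem_cons_self, refuted_cons.2 ⟨⟨x, h1, h2⟩, refuted_cons.2 ⟨⟨y, ?_, ?_⟩, hG⟩⟩⟩
    · simpa [PrefModel.BSat, hA] using hb
    · simpa using hB
  | oblL Γ Δ B A G =>
    obtain ⟨⟨x, h1, h2⟩, hG⟩ := refuted_cons.1 h
    have h3 := (Multiset.forall_mem_cons.1 h1).1
    by_cases hA : M.BSat A x
    · by_cases hb : M.BSat (.bet (.neg A)) x
      · refine ⟨_, List.mem_cons_of_mem _ (List.mem_cons_of_mem _ List.mem_cons_self),
          refuted_cons.2 ⟨⟨x, ?_, h2⟩, hG⟩⟩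
        refine Multiset.forall_mem_cons.2 ⟨h3 x ⟨hA, ?_⟩, h1⟩
        simpa [PrefModel.BSat] using hb
      · refine ⟨_, List.mem_cons_of_mem _ List.mem_cons_self, refuted_cons.2 ⟨⟨x, h1, ?_⟩, hG⟩⟩
        exact Multiset.forall_mem_cons.2 ⟨hb, h2⟩
    · refine ⟨_, List.mem_cons_self, refuted_cons.2 ⟨⟨x, h1, ?_⟩, hG⟩⟩
      exact Multiset.forall_mem_cons.2 ⟨hA, h2⟩
  | oblL2 Γ Δ Sg Pi B A G =>
    obtain ⟨hS, hG⟩ := refuted_cons.1 h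
    obtain ⟨⟨x, h1, h2⟩, hG⟩ := refuted_cons.1 hG
    have h3 : M.BSat (.obl B A) x := by
      obtain ⟨y, hy, -⟩ := hS
      exact (Multiset.forall_mem_cons.1 hy).1
    by_cases hA : M.BSat A x
    · by_cases hb : M.BSat (.bet (.neg A)) x
      · refine ⟨_, List.mem_cons_of_mem _ (List.mem_cons_of_mem _ List.mem_cons_self),
          refuted_cons.2 ⟨hS, refuted_cons.2 ⟨⟨x, ?_, h2⟩, hG⟩⟩⟩
        refine Multiset.forall_mem_cons.2 ⟨h3 x ⟨hA, ?_⟩, h1⟩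
        simpa [PrefModel.BSat] using hb
      · refine ⟨_, List.mem_cons_of_mem _ List.mem_cons_self,
          refuted_cons.2 ⟨hS, refuted_cons.2 ⟨⟨x, h1, ?_⟩, hG⟩⟩⟩
        exact Multiset.forall_mem_cons.2 ⟨hb, h2⟩
    · refine ⟨_, List.mem_cons_self, refuted_cons.2 ⟨hS, refuted_cons.2 ⟨⟨x, h1, ?_⟩, hG⟩⟩⟩
      exact Multiset.forall_mem_cons.2 ⟨hA, h2⟩
  | betR Γ Δ A G =>
    obtain ⟨⟨x, h1, h2⟩, hG⟩ := refuted_cons.1 h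
    have h3 := (Multiset.forall_mem_cons.1 h2).1
    simp only [PrefModel.BSat, not_forall] at h3
    obtain ⟨y, hy, hB⟩ := h3
    refine ⟨_, List.mem_cons_self, refuted_cons.2 ⟨⟨x, h1, h2⟩, refuted_cons.2 ⟨⟨y, ?_, ?_⟩, hG⟩⟩⟩
    · exact fun F hF => h1 _ (mem_betDown.1 hF) y hy
    · simpa using hB
  | boxR Γ Δ A G =>
    obtain ⟨⟨x, h1, h2⟩, hG⟩ := refuted_cons.1 h
    have h3 := (Multiset.forall_mem_cons.1 h2).1
    simp only [PrefModel.BSat, not_forall] at h3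
    obtain ⟨y, hB⟩ := h3
    refine ⟨_, List.mem_cons_self, refuted_cons.2 ⟨⟨x, h1, h2⟩, refuted_cons.2 ⟨⟨y, ?_, ?_⟩, hG⟩⟩⟩
    · simp
    · simpa using hB
  | boxL Γ Δ A G =>
    obtain ⟨⟨x, h1, h2⟩, hG⟩ := refuted_cons.1 h
    have h3 := (Multiset.forall_mem_cons.1 h1).1
    exact ⟨_, List.mem_cons_self,
      refuted_cons.2 ⟨⟨x, Multiset.forall_mem_cons.2 ⟨h3 x, h1⟩, h2⟩, hG⟩⟩
  | boxL2 Γ Δ Sg Pi A G =>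
    obtain ⟨hS, hG⟩ := refuted_cons.1 h
    obtain ⟨⟨x, h1, h2⟩, hG⟩ := refuted_cons.1 hG
    have h3 : M.BSat (.box A) x := by
      obtain ⟨y, hy, -⟩ := hS
      exact (Multiset.forall_mem_cons.1 hy).1
    exact ⟨_, List.mem_cons_self, refuted_cons.2 ⟨hS,
      refuted_cons.2 ⟨⟨x, Multiset.forall_mem_cons.2 ⟨h3 x, h1⟩, h2⟩, hG⟩⟩⟩

theorem Refuted.not_isAxiom {M : PrefModel} {H : Hyperseq} (h : Refuted M H) : ¬ IsAxiom H := by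
  rintro ⟨S, hS, p, h1, h2⟩
  obtain ⟨x, h3, h4⟩ := h S hS
  exact h4 _ h2 (h3 _ h1)

/-! ### Subformulas -/

/-- The set of subformulas of a formula of `L`. -/
def Form.sub : Form → Finset Form
  | .var p => {.var p}
  | .neg A => insert (.neg A) A.sub
  | .imp A B => insert (.imp A B) (A.sub ∪ B.sub)
  | .box A => insert (.box A) A.sub
  | .obl B A => insert (.obl B A) (B.sub ∪ A.sub)

theorem Form.self_mem_sub (A : Form) : A ∈ A.sub := by
  cases A <;> simp [sub]

theorem Form.sub_trans {A B : Form} (h : B ∈ A.sub) : B.sub ⊆ A.sub := by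
  induction A with
  | var p => simp only [sub, Finset.mem_singleton] at h; rw [h]
  | neg A ih =>
    rcases Finset.mem_insert.1 h with rfl | h
    · rfl
    · exact (ih h).trans (Finset.subset_insert _ _)
  | box A ih =>
    rcases Finset.mem_insert.1 h with rfl | h
    · rfl
    · exact (ih h).trans (Finset.subset_insert _ _)
  | imp A C ih ih' =>
    rcases Finset.mem_insert.1 h with rfl | h
    · rfl
    · rcases Finset.mem_union.1 h with h | h
      · exact ((ih h).trans Finset.subset_union_left).trans (Finset.subset_insert _ _)
      · exact ((ih' h).trans Finset.subset_union_right).trans (Finset.subset_insert _ _)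
  | obl A C ih ih' =>
    rcases Finset.mem_insert.1 h with rfl | h
    · rfl
    · rcases Finset.mem_union.1 h with h | h
      · exact ((ih h).trans Finset.subset_union_left).trans (Finset.subset_insert _ _)
      · exact ((ih' h).trans Finset.subset_union_right).trans (Finset.subset_insert _ _)

theorem Form.size_neg (A : Form) : (Form.neg A).size = A.size + 1 := by
  simp [size, encode, toB, BForm.encode]

theorem Form.size_box (A : Form) : (Form.box A).size = A.size + 1 := by
  simp [size, encode, toB, BForm.encode]

theorem Form.size_imp (A B : Form) : (Form.imp A B).size = A.size + B.size + 1 := by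
  simp [size, encode, toB, BForm.encode]

theorem Form.size_obl (B A : Form) : (Form.obl B A).size = B.size + A.size + 1 := by
  simp [size, encode, toB, BForm.encode]

theorem Form.size_pos (A : Form) : 1 ≤ A.size := by
  cases A <;> simp [size, encode, toB, BForm.encode]

theorem Form.card_sub_le (A : Form) : A.sub.card ≤ A.size := by
  induction A with
  | var p => exact Form.size_pos _
  | neg A ih => rw [size_neg]; exact (Finset.card_insert_le _ _).trans (by omega)
  | box A ih => rw [size_box]; exact (Finset.card_insert_le _ _).trans (by omega)
  | imp A B ihA ihB =>
    rw [size_imp]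
    have := Finset.card_union_le A.sub B.sub
    exact (Finset.card_insert_le _ _).trans (by omega)
  | obl B A ihB ihA =>
    rw [size_obl]
    have := Finset.card_union_le B.sub A.sub
    exact (Finset.card_insert_le _ _).trans (by omega)

theorem Form.size_le_of_mem_sub {A B : Form} (h : B ∈ A.sub) : B.size ≤ A.size := by
  induction A with
  | var p => simp only [sub, Finset.mem_singleton] at h; rw [h]
  | neg A ih =>
    rw [size_neg]
    rcases Finset.mem_insert.1 h with rfl | h
    · rw [size_neg]
    · have := ih h; omega
  | box A ih =>
    rw [size_box]
    rcases Finset.mem_insert.1 h with rfl | h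
    · rw [size_box]
    · have := ih h; omega
  | imp A C ih ih' =>
    rw [size_imp]
    rcases Finset.mem_insert.1 h with rfl | h
    · rw [size_imp]
    · rcases Finset.mem_union.1 h with h | h
      · have := ih h; omega
      · have := ih' h; omega
  | obl A C ih ih' =>
    rw [size_obl]
    rcases Finset.mem_insert.1 h with rfl | h
    · rw [size_obl]
    · rcases Finset.mem_union.1 h with h | h
      · have := ih h; omega
      · have := ih' h; omega

/-! ### The closure of a formula -/

/-- The formulas that may occur in an irredundant derivation from `⇒ A`. -/
def Form.closure (A : Form) : Finset BForm :=
  A.sub.image Form.toB ∪ A.sub.image (fun C => .neg C.toB) ∪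
    A.sub.image (fun C => .bet (.neg C.toB))

theorem Form.mem_closure {A : Form} {F : BForm} : F ∈ A.closure ↔
    ∃ C ∈ A.sub, F = C.toB ∨ F = .neg C.toB ∨ F = .bet (.neg C.toB) := by
  simp only [closure, Finset.mem_union, Finset.mem_image]
  constructor
  · rintro ((⟨C, hC, rfl⟩ | ⟨C, hC, rfl⟩) | ⟨C, hC, rfl⟩)
    · exact ⟨C, hC, .inl rfl⟩
    · exact ⟨C, hC, .inr (.inl rfl)⟩
    · exact ⟨C, hC, .inr (.inr rfl)⟩
  · rintro ⟨C, hC, rfl | rfl | rfl⟩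
    · exact .inl (.inl ⟨C, hC, rfl⟩)
    · exact .inl (.inr ⟨C, hC, rfl⟩)
    · exact .inr ⟨C, hC, rfl⟩

theorem Form.toB_mem_closure {A C : Form} (h : C ∈ A.sub) : C.toB ∈ A.closure :=
  mem_closure.2 ⟨C, h, .inl rfl⟩

theorem Form.card_closure_le (A : Form) : A.closure.card ≤ 3 * A.size := by
  have h := A.card_sub_le
  have h1 := (Finset.card_image_le (s := A.sub) (f := Form.toB))
  have h2 := (Finset.card_image_le (s := A.sub) (f := fun C => BForm.neg C.toB))
  have h3 := (Finset.card_image_le (s := A.sub) (f := fun C => BForm.bet (.neg C.toB)))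
  have h4 := Finset.card_union_le (A.sub.image Form.toB) (A.sub.image fun C => .neg C.toB)
  have h5 := Finset.card_union_le (A.sub.image Form.toB ∪ A.sub.image (fun C => .neg C.toB))
    (A.sub.image (fun C => .bet (.neg C.toB)))
  unfold closure
  omega

theorem Form.length_encode_le {A : Form} {F : BForm} (h : F ∈ A.closure) :
    F.encode.length ≤ A.size + 2 := by
  obtain ⟨C, hC, rfl | rfl | rfl⟩ := mem_closure.1 h <;>
  · have : C.toB.encode.length ≤ A.size := size_le_of_mem_sub hC
    simp only [BForm.encode, List.length_cons, this, Nat.le_add_right_of_le,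
      Nat.add_le_add_iff_right]

/-- Translations of formulas of `L` contain no `Bet`, so only the third family of the closure
contributes. This and the following inversions keep decomposition inside the subformulas of `A`. -/
theorem Form.of_bet_mem_closure {A : Form} {F : BForm} (h : .bet F ∈ A.closure) :
    ∃ C ∈ A.sub, F = .neg C.toB := by
  obtain ⟨C, hC, h | h | h⟩ := mem_closure.1 h
  · cases C <;> cases h
  · cases h
  · cases h; exact ⟨C, hC, rfl⟩

theorem Form.of_neg_mem_closure {A : Form} {F : BForm} (h : .neg F ∈ A.closure) :
    ∃ C ∈ A.sub, F = C.toB := by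
  obtain ⟨C, hC, h | h | h⟩ := mem_closure.1 h
  · cases C <;> cases h
    exact ⟨_, sub_trans hC (by simp [sub, self_mem_sub]), rfl⟩
  · cases h; exact ⟨C, hC, rfl⟩
  · cases h

theorem Form.of_box_mem_closure {A : Form} {F : BForm} (h : .box F ∈ A.closure) :
    ∃ C ∈ A.sub, F = C.toB := by
  obtain ⟨C, hC, h | h | h⟩ := mem_closure.1 h
  · cases C <;> cases h
    exact ⟨_, sub_trans hC (by simp [sub, self_mem_sub]), rfl⟩
  · cases h
  · cases h

theorem Form.of_imp_mem_closure {A : Form} {F G : BForm} (h : .imp F G ∈ A.closure) :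
    ∃ C ∈ A.sub, ∃ D ∈ A.sub, F = C.toB ∧ G = D.toB := by
  obtain ⟨C, hC, h | h | h⟩ := mem_closure.1 h
  · cases C <;> cases h
    exact ⟨_, sub_trans hC (by simp [sub, self_mem_sub]), _,
      sub_trans hC (by simp [sub, self_mem_sub]), rfl, rfl⟩
  · cases h
  · cases h

theorem Form.of_obl_mem_closure {A : Form} {F G : BForm} (h : .obl F G ∈ A.closure) :
    ∃ C ∈ A.sub, ∃ D ∈ A.sub, F = C.toB ∧ G = D.toB := by
  obtain ⟨C, hC, h | h | h⟩ := mem_closure.1 h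
  · cases C <;> cases h
    exact ⟨_, sub_trans hC (by simp [sub, self_mem_sub]), _,
      sub_trans hC (by simp [sub, self_mem_sub]), rfl, rfl⟩
  · cases h
  · cases h

theorem Form.unBet_toB (C : Form) : C.toB.unBet = none := by
  cases C <;> rfl

/-! ### Invariants of irredundant derivations -/

/-- The invariant of the components of hypersequents in irredundant derivations from `⇒ A`. -/
structure CompInv (A : Form) (S : Sequent) : Prop where
  ante : ∀ F ∈ S.ante, F ∈ A.closure
  succ : ∀ F ∈ S.succ, F ∈ A.closure
  bets : (betDown S.ante).card ≤ 1
  card : S.ante.card + S.succ.card ≤ 2 * (S.ante.toFinset.card + S.succ.toFinset.card)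

theorem betDown_toB_cons (C : Form) (Γ : Multiset BForm) :
    betDown (C.toB ::ₘ Γ) = betDown Γ := by
  rw [betDown, Multiset.filterMap_cons_none _ _ C.unBet_toB]; rfl

theorem CompInv.add_succ {A : Form} {Γ Δ : Multiset BForm} {F : BForm} (h : CompInv A (Γ ⇒ₛ Δ))
    (hF : F ∈ A.closure) (hn : F ∉ Δ) : CompInv A (Γ ⇒ₛ F ::ₘ Δ) where
  ante := h.ante
  succ := Multiset.forall_mem_cons.2 ⟨hF, h.succ⟩
  bets := h.bets
  card := by
    have := h.card
    simp only [Multiset.card_cons, Multiset.toFinset_cons] at this ⊢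
    rw [Finset.card_insert_of_notMem (by simpa using hn)]
    omega

theorem CompInv.add_ante {A C : Form} {Γ Δ : Multiset BForm} (h : CompInv A (Γ ⇒ₛ Δ))
    (hC : C ∈ A.sub) (hn : C.toB ∉ Γ) : CompInv A (C.toB ::ₘ Γ ⇒ₛ Δ) where
  ante := Multiset.forall_mem_cons.2 ⟨Form.toB_mem_closure hC, h.ante⟩
  succ := h.succ
  bets := by simpa only [betDown_toB_cons] using h.bets
  card := by
    have := h.card
    simp only [Multiset.card_cons, Multiset.toFinset_cons] at this ⊢
    rw [Finset.card_insert_of_notMem (by simpa using hn)]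
    omega

/-- This is the case that forces the factor 2 in `CompInv.card`: the rule for implication on the
right adds two occurrences, but non-redundancy guarantees only that one of them is new. -/
theorem CompInv.add_both {A C D : Form} {Γ Δ : Multiset BForm} (h : CompInv A (Γ ⇒ₛ Δ))
    (hC : C ∈ A.sub) (hD : D ∈ A.sub) (hn : ¬ (C.toB ∈ Γ ∧ D.toB ∈ Δ)) :
    CompInv A (C.toB ::ₘ Γ ⇒ₛ D.toB ::ₘ Δ) where
  ante := Multiset.forall_mem_cons.2 ⟨Form.toB_mem_closure hC, h.ante⟩
  succ := Multiset.forall_mem_cons.2 ⟨Form.toB_mem_closure hD, h.succ⟩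
  bets := by simpa only [betDown_toB_cons] using h.bets
  card := by
    have := h.card
    simp only [Multiset.card_cons, Multiset.toFinset_cons] at this ⊢
    have h1 : Γ.toFinset.card ≤ (insert C.toB Γ.toFinset).card :=
      Finset.card_le_card (Finset.subset_insert _ _)
    have h2 : Δ.toFinset.card ≤ (insert D.toB Δ.toFinset).card :=
      Finset.card_le_card (Finset.subset_insert _ _)
    by_cases hC' : C.toB ∈ Γ
    · rw [Finset.card_insert_of_notMem (s := Δ.toFinset) (by simpa using fun h => hn ⟨hC', h⟩)]
      omega
    · rw [Finset.card_insert_of_notMem (s := Γ.toFinset) (by simpa using hC')]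
      omega

/-- The requirement on a component that its antecedent contains `k.1` and its succedent `k.2`;
each rule that creates a component does so to meet such a requirement. -/
def Met (H : Hyperseq) (k : Finset BForm × BForm) : Prop :=
  ∃ S ∈ H, (∀ F ∈ k.1, F ∈ S.ante) ∧ k.2 ∈ S.succ

/-- The requirements that may arise in a derivation from `⇒ A`. -/
def Form.requirements (A : Form) : Finset (Finset BForm × BForm) :=
  ((A.sub ×ˢ A.sub).image fun x => ({x.2.toB, .bet (.neg x.2.toB)}, x.1.toB)) ∪
  (A.sub.image fun C => (∅, C.toB)) ∪
  ((A.sub ×ˢ A.sub).image fun x => ({.neg x.1.toB}, .neg x.2.toB)) ∪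
  (A.sub.image fun C => (∅, .neg C.toB))

/-- Two of the four families are indexed by pairs of subformulas and two by single ones, so each has
at most `n²` members. -/
theorem Form.card_requirements_le (A : Form) : A.requirements.card ≤ 4 * A.size ^ 2 := by
  have h0 := A.card_sub_le
  have h : A.sub.card * A.sub.card ≤ A.size ^ 2 := by
    rw [sq]; exact Nat.mul_le_mul h0 h0
  have h' : A.sub.card ≤ A.size ^ 2 := h0.trans (Nat.le_self_pow two_ne_zero _)
  unfold requirements
  refine (Finset.card_union_le _ _).trans ?_
  refine (Nat.add_le_add_right (Finset.card_union_le _ _) _).trans ?_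
  refine (Nat.add_le_add_right (Nat.add_le_add_right (Finset.card_union_le _ _) _) _).trans ?_
  have h1 : ∀ {f : Form × Form → Finset BForm × BForm},
      ((A.sub ×ˢ A.sub).image f).card ≤ A.size ^ 2 := fun {f} =>
    Finset.card_image_le.trans ((Finset.card_product _ _).le.trans h)
  have h2 : ∀ {f : Form → Finset BForm × BForm}, (A.sub.image f).card ≤ A.size ^ 2 := fun {f} =>
    Finset.card_image_le.trans h'
  refine (Nat.add_le_add (Nat.add_le_add (Nat.add_le_add h1 h2) h1) h2).trans ?_
  omega

open Classical in
/-- The invariant of hypersequents in irredundant derivations from `⇒ A`. -/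
structure HypInv (A : Form) (H : Hyperseq) : Prop where
  comp : ∀ S ∈ H, CompInv A S
  card : H.card ≤ 1 + (A.requirements.filter (Met H)).card

theorem Met.extend {H K : Hyperseq} (h : Extends H K) {k : Finset BForm × BForm} (hk : Met H k) :
    Met K k := by
  obtain ⟨S, hS, h1, h2⟩ := hk
  obtain ⟨T, hT, h3, h4⟩ := h S hS
  exact ⟨T, hT, fun F hF => h3 (h1 F hF), h4 h2⟩

theorem HypInv.replace {A : Form} {S T : Sequent} {G : Hyperseq} (h : HypInv A (S ::ₘ G))
    (hT : CompInv A T) (h1 : S.ante ⊆ T.ante) (h2 : S.succ ⊆ T.succ) : HypInv A (T ::ₘ G) where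
  comp := Multiset.forall_mem_cons.2 ⟨hT, (Multiset.forall_mem_cons.1 h.comp).2⟩
  card := by
    classical
    have := h.card
    rw [Multiset.card_cons] at this ⊢
    refine this.trans (Nat.add_le_add_left (Finset.card_le_card ?_) _)
    intro k hk
    rw [Finset.mem_filter] at hk ⊢
    exact ⟨hk.1, hk.2.extend (Extends.of_cons h1 h2 (Extends.refl _))⟩

/-- A new component pays for itself: it turns `k` from unmet to met, and no requirement is lost by
adding a component. The initial 1 in `HypInv.card` accounts for the root component. -/
theorem HypInv.add {A : Form} {T : Sequent} {H : Hyperseq} (h : HypInv A H)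
    (hT : CompInv A T) {k : Finset BForm × BForm} (hk : k ∈ A.requirements) (hn : ¬ Met H k)
    (hk' : Met (T ::ₘ H) k) : HypInv A (T ::ₘ H) where
  comp := Multiset.forall_mem_cons.2 ⟨hT, h.comp⟩
  card := by
    classical
    have := h.card
    rw [Multiset.card_cons]
    have hlt : (A.requirements.filter (Met H)).card <
        (A.requirements.filter (Met (T ::ₘ H))).card := by
      refine Finset.card_lt_card ((Finset.ssubset_iff_of_subset ?_).2 ⟨k, ?_, ?_⟩)
      · intro k hk
        rw [Finset.mem_filter] at hk ⊢
        exact ⟨hk.1, hk.2.extend (Extends.add _ _)⟩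
      · exact Finset.mem_filter.2 ⟨hk, hk'⟩
      · exact fun h => hn (Finset.mem_filter.1 h).2
    have := this.trans_lt (Nat.add_lt_add_left (by convert hlt) 1)
    exact this

/-- Redundancy looks at the context without the principal formula, while counting distinct formulas
includes it. A formula differs from any compound containing it, so an added formula absent from the
context is new to the whole side. -/
theorem BForm.ne_imp_right (A B : BForm) : B ≠ .imp A B := by
  intro h; have := congrArg sizeOf h; simp at this

theorem BForm.ne_obl_left (A B : BForm) : B ≠ .obl B A := by
  intro h; have := congrArg sizeOf h; simp at this; omega

theorem BForm.ne_box (A : BForm) : A ≠ .box A := by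
  intro h; have := congrArg sizeOf h; simp at this

/-- Non-redundancy enters in two ways. For a rule that enlarges a component it says that a formula
is new there, so the multiplicity bound survives (`HypInv.replace`). For a rule that creates a
component it says that a requirement was unmet (`HypInv.add`). -/
theorem HypInv.prem {A : Form} {r : RuleApp} (h : HypInv A r.concl) (hr : ¬ r.Redundant)
    {K : Hyperseq} (hK : K ∈ r.prems) : HypInv A K := by
  cases r with
  | negL Γ Δ F G =>
    simp only [RuleApp.prems, List.mem_singleton] at hK
    subst hK
    have hS := (Multiset.forall_mem_cons.1 h.comp).1
    obtain ⟨C, hC, rfl⟩ := Form.of_neg_mem_closure (hS.ante _ (Multiset.mem_cons_self _ _))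
    exact h.replace (hS.add_succ (Form.toB_mem_closure hC) hr) (fun _ h => h)
      (Multiset.subset_cons _ _)
  | negR Γ Δ F G =>
    simp only [RuleApp.prems, List.mem_singleton] at hK
    subst hK
    have hS := (Multiset.forall_mem_cons.1 h.comp).1
    obtain ⟨C, hC, rfl⟩ := Form.of_neg_mem_closure (hS.succ _ (Multiset.mem_cons_self _ _))
    exact h.replace (hS.add_ante hC hr) (Multiset.subset_cons _ _) (fun _ h => h)
  | impL Γ Δ F F' G =>
    have hS := (Multiset.forall_mem_cons.1 h.comp).1
    obtain ⟨C, hC, D, hD, rfl, rfl⟩ :=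
      Form.of_imp_mem_closure (hS.ante _ (Multiset.mem_cons_self _ _))
    simp only [RuleApp.Redundant, not_or] at hr
    simp only [RuleApp.prems, List.mem_cons, List.not_mem_nil, or_false] at hK
    rcases hK with rfl | rfl
    · exact h.replace (hS.add_succ (Form.toB_mem_closure hC) hr.1) (fun _ h => h)
        (Multiset.subset_cons _ _)
    · refine h.replace (hS.add_ante hD ?_) (Multiset.subset_cons _ _) (fun _ h => h)
      simp [hr.2, BForm.ne_imp_right]
  | impR Γ Δ F F' G =>
    simp only [RuleApp.prems, List.mem_singleton] at hK
    subst hK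
    have hS := (Multiset.forall_mem_cons.1 h.comp).1
    obtain ⟨C, hC, D, hD, rfl, rfl⟩ :=
      Form.of_imp_mem_closure (hS.succ _ (Multiset.mem_cons_self _ _))
    refine h.replace (hS.add_both hC hD ?_) (Multiset.subset_cons _ _) (Multiset.subset_cons _ _)
    simpa [BForm.ne_imp_right, RuleApp.Redundant] using hr
  | oblR Γ Δ B F G =>
    simp only [RuleApp.prems, List.mem_singleton] at hK
    subst hK
    have hS := (Multiset.forall_mem_cons.1 h.comp).1
    obtain ⟨C, hC, D, hD, rfl, rfl⟩ :=
      Form.of_obl_mem_closure (hS.succ _ (Multiset.mem_cons_self _ _))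
    rw [Multiset.cons_swap]
    refine h.add ⟨?_, ?_, ?_, ?_⟩ (k := ({D.toB, .bet (.neg D.toB)}, C.toB)) ?_ ?_ ?_
    · simp only [Multiset.insert_eq_cons, Multiset.forall_mem_cons, Multiset.mem_singleton,
        forall_eq]
      exact ⟨Form.toB_mem_closure hD, Form.mem_closure.2 ⟨D, hD, .inr (.inr rfl)⟩⟩
    · simpa using Form.toB_mem_closure hC
    -- `Bet ¬D` is the only `Bet` formula of the new antecedent, as `D` is a translation; the bound
    -- one is attained here.
    · simp only [Multiset.insert_eq_cons, betDown_toB_cons]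
      exact le_rfl
    · have : (BForm.bet (.neg D.toB)) ∉ ({D.toB} : Finset BForm) := by
        rw [Finset.mem_singleton]; cases D <;> simp [Form.toB]
      simp only [Multiset.insert_eq_cons, Multiset.card_cons, Multiset.card_singleton,
        Multiset.toFinset_cons, Multiset.toFinset_singleton]
      -- Counting one distinct formula on each side is enough: `3 ≤ 2 * (1 + 1)`.
      have h2 : 1 ≤ (insert D.toB ({BForm.bet (.neg D.toB)} : Finset BForm)).card :=
        Finset.card_pos.2 ⟨_, Finset.mem_insert_self _ _⟩
      rw [Finset.card_singleton]
      omega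
    · simp only [Form.requirements, Finset.mem_union, Finset.mem_image, Finset.mem_product]
      exact .inl (.inl (.inl ⟨(C, D), ⟨hC, hD⟩, rfl⟩))
    · rintro ⟨S, hS, h1, h2⟩
      exact hr ⟨S, hS, h1 _ (by simp), h1 _ (by simp), h2⟩
    · exact ⟨_, Multiset.mem_cons_self _ _, by simp, by simp⟩
  | oblL Γ Δ B F G =>
    have hS := (Multiset.forall_mem_cons.1 h.comp).1
    obtain ⟨C, hC, D, hD, rfl, rfl⟩ :=
      Form.of_obl_mem_closure (hS.ante _ (Multiset.mem_cons_self _ _))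
    simp only [RuleApp.Redundant, not_or] at hr
    simp only [RuleApp.prems, List.mem_cons, List.not_mem_nil, or_false] at hK
    rcases hK with rfl | rfl | rfl
    · exact h.replace (hS.add_succ (Form.toB_mem_closure hD) hr.1) (fun _ h => h)
        (Multiset.subset_cons _ _)
    · exact h.replace (hS.add_succ (Form.mem_closure.2 ⟨D, hD, .inr (.inr rfl)⟩) hr.2.1)
        (fun _ h => h) (Multiset.subset_cons _ _)
    · refine h.replace (hS.add_ante hC ?_) (Multiset.subset_cons _ _) (fun _ h => h)
      simp [hr.2.2, BForm.ne_obl_left]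
  | oblL2 Γ Δ Sg Pi B F G =>
    have hS := (Multiset.forall_mem_cons.1 h.comp).1
    have hT := (Multiset.forall_mem_cons.1 (Multiset.forall_mem_cons.1 h.comp).2).1
    obtain ⟨C, hC, D, hD, rfl, rfl⟩ :=
      Form.of_obl_mem_closure (hS.ante _ (Multiset.mem_cons_self _ _))
    simp only [RuleApp.Redundant, not_or] at hr
    simp only [RuleApp.prems, List.mem_cons, List.not_mem_nil, or_false] at hK
    -- The component that changes is the second one; it is moved to the head, where `HypInv.replace`
    -- acts.
    rw [RuleApp.concl, Multiset.cons_swap] at h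
    rcases hK with rfl | rfl | rfl <;> rw [Multiset.cons_swap]
    · exact h.replace (hT.add_succ (Form.toB_mem_closure hD) hr.1) (fun _ h => h)
        (Multiset.subset_cons _ _)
    · exact h.replace (hT.add_succ (Form.mem_closure.2 ⟨D, hD, .inr (.inr rfl)⟩) hr.2.1)
        (fun _ h => h) (Multiset.subset_cons _ _)
    · exact h.replace (hT.add_ante hC hr.2.2) (Multiset.subset_cons _ _) (fun _ h => h)
  | betR Γ Δ F G =>
    simp only [RuleApp.prems, List.mem_singleton] at hK
    subst hK
    have hS := (Multiset.forall_mem_cons.1 h.comp).1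
    obtain ⟨C, hC, rfl⟩ := Form.of_bet_mem_closure (hS.succ _ (Multiset.mem_cons_self _ _))
    rw [Multiset.cons_swap]
    -- The bound on `Bet` formulas is needed here: without it the created component could carry an
    -- arbitrary set of formulas, and there would be exponentially many requirements.
    have hb : betDown Γ = 0 ∨ ∃ D ∈ A.sub, betDown Γ = {.neg D.toB} := by
      have := hS.bets
      rcases Nat.le_one_iff_eq_zero_or_eq_one.1 this with h0 | h1
      · exact .inl (Multiset.card_eq_zero.1 h0)
      · obtain ⟨F, hF⟩ := Multiset.card_eq_one.1 h1
        have hF' : F ∈ betDown Γ := by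
          change betDown Γ = {F} at hF
          rw [hF]; exact Multiset.mem_singleton_self _
        obtain ⟨D, hD, rfl⟩ := Form.of_bet_mem_closure (hS.ante _ (mem_betDown.1 hF'))
        exact .inr ⟨D, hD, hF⟩
    have hC' : BForm.neg C.toB ∈ A.closure := Form.mem_closure.2 ⟨C, hC, .inr (.inl rfl)⟩
    -- For `X` listing `betDown Γ`, meeting the requirement is exactly redundancy of this
    -- application.
    have hmet : ∀ X : Finset BForm, (∀ F, F ∈ X ↔ F ∈ betDown Γ) →
        ¬ Met ((Γ ⇒ₛ BForm.bet (.neg C.toB) ::ₘ Δ) ::ₘ G) (X, .neg C.toB) := by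
      rintro X hX ⟨S, hS, h1, h2⟩
      exact hr ⟨S, hS, fun F hF => h1 F ((hX F).2 hF), h2⟩
    rcases hb with hb | ⟨D, hD, hb⟩
    · rw [hb]
      refine h.add ⟨?_, ?_, ?_, ?_⟩ (k := (∅, .neg C.toB)) ?_ (hmet _ ?_) ?_
      · simp
      · simpa using hC'
      · simp [betDown]
      · simp
      · simp only [Form.requirements, Finset.mem_union, Finset.mem_image]
        exact .inr ⟨C, hC, rfl⟩
      · simp [hb]
      · exact ⟨_, Multiset.mem_cons_self _ _, by simp, by simp⟩
    · rw [hb]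
      refine h.add ⟨?_, ?_, ?_, ?_⟩ (k := ({.neg D.toB}, .neg C.toB)) ?_ (hmet _ ?_) ?_
      · simpa using Form.mem_closure.2 ⟨D, hD, .inr (.inl rfl)⟩
      · simpa using hC'
      · exact Nat.zero_le 1
      · simp
      · simp only [Form.requirements, Finset.mem_union, Finset.mem_image, Finset.mem_product]
        exact .inl (.inr ⟨(D, C), ⟨hD, hC⟩, rfl⟩)
      · simp [hb]
      · exact ⟨_, Multiset.mem_cons_self _ _, by simp, by simp⟩
  | boxR Γ Δ F G =>
    simp only [RuleApp.prems, List.mem_singleton] at hK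
    subst hK
    have hS := (Multiset.forall_mem_cons.1 h.comp).1
    obtain ⟨C, hC, rfl⟩ := Form.of_box_mem_closure (hS.succ _ (Multiset.mem_cons_self _ _))
    rw [Multiset.cons_swap]
    refine h.add ⟨?_, ?_, ?_, ?_⟩ (k := (∅, C.toB)) ?_ ?_ ?_
    · simp
    · simpa using Form.toB_mem_closure hC
    · simp [betDown]
    · simp
    · simp only [Form.requirements, Finset.mem_union, Finset.mem_image]
      exact .inl (.inl (.inr ⟨C, hC, rfl⟩))
    · rintro ⟨S, hS, -, h2⟩
      exact hr ⟨S, hS, h2⟩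
    · exact ⟨_, Multiset.mem_cons_self _ _, by simp, by simp⟩
  | boxL Γ Δ F G =>
    simp only [RuleApp.prems, List.mem_singleton] at hK
    subst hK
    have hS := (Multiset.forall_mem_cons.1 h.comp).1
    obtain ⟨C, hC, rfl⟩ := Form.of_box_mem_closure (hS.ante _ (Multiset.mem_cons_self _ _))
    refine h.replace (hS.add_ante hC ?_) (Multiset.subset_cons _ _) (fun _ h => h)
    simpa [BForm.ne_box, RuleApp.Redundant] using hr
  | boxL2 Γ Δ Sg Pi F G =>
    simp only [RuleApp.prems, List.mem_singleton] at hK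
    subst hK
    have hS := (Multiset.forall_mem_cons.1 h.comp).1
    have hT := (Multiset.forall_mem_cons.1 (Multiset.forall_mem_cons.1 h.comp).2).1
    obtain ⟨C, hC, rfl⟩ := Form.of_box_mem_closure (hS.ante _ (Multiset.mem_cons_self _ _))
    rw [RuleApp.concl, Multiset.cons_swap] at h
    rw [Multiset.cons_swap]
    exact h.replace (hT.add_ante hC hr) (Multiset.subset_cons _ _) (fun _ h => h)

theorem hypInv_rootOf (A : Form) : HypInv A (rootOf A) where
  comp := by
    simp only [rootOf, Multiset.mem_singleton, forall_eq]
    refine ⟨by simp, ?_, by simp [betDown], by simp⟩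
    simpa using Form.toB_mem_closure A.self_mem_sub
  card := by simp [rootOf]

theorem Derivation.Irredundant.hypInv {A : Form} {K : Hyperseq} : ∀ {H : Hyperseq}
    (D : Derivation H), D.Irredundant → HypInv A H → D.Occurs K → HypInv A K := by
  intro H D
  induction D with
  | leaf => intro _ h hK; rw [Derivation.Occurs] at hK; exact hK ▸ h
  | node r hr sub ih =>
    intro hD h hK
    rw [Derivation.Irredundant] at hD
    rw [Derivation.Occurs] at hK
    rcases hK with rfl | ⟨i, hi⟩
    · exact h
    · subst hr
      exact ih i (hD.2.2 i) (h.prem hD.2.1 (List.get_mem _ _)) hi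

/-! ### The size of hypersequents in irredundant derivations -/

theorem formulasSize_le {A : Form} {Γ : Multiset BForm} (h : ∀ F ∈ Γ, F ∈ A.closure) :
    formulasSize Γ ≤ Γ.card * (A.size + 3) := by
  refine (Multiset.sum_le_card_nsmul _ (A.size + 3) ?_).trans (by simp)
  intro x hx
  obtain ⟨F, hF, rfl⟩ := Multiset.mem_map.1 hx
  have := Form.length_encode_le (h F hF)
  omega

/-- Each side has at most `3n` distinct formulas, so there are at most `12n` occurrences. Each costs
at most `n + 2` symbols and a comma, hence at most `4n`. The two delimiters complete `48n² + 2 ≤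
50n²`. -/
theorem CompInv.size_le {A : Form} {S : Sequent} (h : CompInv A S) :
    formulasSize S.ante + 1 + formulasSize S.succ + 1 ≤ 50 * A.size ^ 2 := by
  have h1 := formulasSize_le h.ante
  have h2 := formulasSize_le h.succ
  have h3 : S.ante.toFinset.card ≤ 3 * A.size :=
    (Finset.card_le_card fun F hF => h.ante F (Multiset.mem_toFinset.1 hF)).trans
      A.card_closure_le
  have h4 : S.succ.toFinset.card ≤ 3 * A.size :=
    (Finset.card_le_card fun F hF => h.succ F (Multiset.mem_toFinset.1 hF)).trans
      A.card_closure_le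
  have h5 := h.card
  have h6 := A.size_pos
  have h7 : (S.ante.card + S.succ.card) * (A.size + 3) ≤ (12 * A.size) * (4 * A.size) :=
    Nat.mul_le_mul (by omega) (by omega)
  have h8 : 1 ≤ A.size ^ 2 := Nat.one_le_pow _ _ h6
  nlinarith

/-- At most `1 + 4n² ≤ 5n²` components, each of size at most `50n²`. -/
theorem HypInv.size_le {A : Form} {H : Hyperseq} (h : HypInv A H) :
    hyperSize H ≤ 250 * A.size ^ 4 := by
  classical
  have h1 : H.card ≤ 5 * A.size ^ 2 := by
    have h2 := h.card
    have h3 := (Finset.card_filter_le A.requirements (Met H)).trans A.card_requirements_le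
    have h4 : 1 ≤ A.size ^ 2 := Nat.one_le_pow _ _ A.size_pos
    have h5 : H.card ≤ 1 + (A.requirements.filter (Met H)).card := by convert h2
    omega
  refine (Multiset.sum_le_card_nsmul _ (50 * A.size ^ 2) ?_).trans ?_
  · intro x hx
    obtain ⟨S, hS, rfl⟩ := Multiset.mem_map.1 hx
    exact (h.comp S hS).size_le
  · rw [Multiset.card_map, smul_eq_mul]
    refine (Nat.mul_le_mul_right _ h1).trans (le_of_eq ?_)
    ring

/-! ### Saturated hypersequents are found -/

open RuleApp in
theorem saturated_of_forall_redundant {H : Hyperseq} (hax : ¬ IsAxiom H)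
    (h : ∀ r : RuleApp, r.concl = H → r.Redundant) : Saturated H := by
  have ante : ∀ {S : Sequent} {F : BForm}, S ∈ H → F ∈ S.ante →
      ∃ Γ G, S = (F ::ₘ Γ ⇒ₛ S.succ) ∧ H = (F ::ₘ Γ ⇒ₛ S.succ) ::ₘ G := by
    rintro ⟨Γ', Δ⟩ F hS hF
    obtain ⟨G, rfl⟩ := Multiset.exists_cons_of_mem hS
    obtain ⟨Γ, hΓ⟩ := Multiset.exists_cons_of_mem hF
    change Γ' = _ at hΓ
    subst hΓ
    exact ⟨Γ, G, rfl, rfl⟩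
  have succ : ∀ {S : Sequent} {F : BForm}, S ∈ H → F ∈ S.succ →
      ∃ Δ G, S = (S.ante ⇒ₛ F ::ₘ Δ) ∧ H = (S.ante ⇒ₛ F ::ₘ Δ) ::ₘ G := by
    rintro ⟨Γ, Δ'⟩ F hS hF
    obtain ⟨G, rfl⟩ := Multiset.exists_cons_of_mem hS
    obtain ⟨Δ, hΔ⟩ := Multiset.exists_cons_of_mem hF
    change Δ' = _ at hΔ
    subst hΔ
    exact ⟨Δ, G, rfl, rfl⟩
  -- Proved beforehand because the two-component rule `oblL2` acts only on two occurrences of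
  -- components; this covers the case in which they coincide.
  have oblL' : ∀ S ∈ H, ∀ B A, .obl B A ∈ S.ante →
      A ∈ S.succ ∨ .bet (.neg A) ∈ S.succ ∨ B ∈ S.ante := by
    intro S hS B A hF
    obtain ⟨Γ, G, h1, h2⟩ := ante hS hF
    have := h (oblL Γ S.succ B A G) h2.symm
    rw [h1]
    simp only [Redundant, Multiset.mem_cons] at this ⊢
    tauto
  have boxL' : ∀ S ∈ H, ∀ A, .box A ∈ S.ante → A ∈ S.ante := by
    intro S hS A hF
    obtain ⟨Γ, G, h1, h2⟩ := ante hS hF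
    rw [h1]
    exact Multiset.mem_cons_of_mem (h (boxL Γ S.succ A G) h2.symm)
  refine ⟨hax, ?_, ?_, ?_, ?_, oblL', ?_, ?_, ?_, ?_, boxL', ?_⟩
  · intro S hS A B hF
    obtain ⟨Γ, G, h1, h2⟩ := ante hS hF
    have := h (impL Γ S.succ A B G) h2.symm
    rw [h1]
    simp only [Redundant, Multiset.mem_cons] at this ⊢
    tauto
  · intro S hS A B hF
    obtain ⟨Γ, G, h1, h2⟩ := succ hS hF
    have := h (impR S.ante Γ A B G) h2.symm
    rw [h1]
    simp only [Redundant, Multiset.mem_cons] at this ⊢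
    tauto
  · intro S hS A hF
    obtain ⟨Γ, G, h1, h2⟩ := ante hS hF
    exact h (negL Γ S.succ A G) h2.symm
  · intro S hS A hF
    obtain ⟨Γ, G, h1, h2⟩ := succ hS hF
    exact h (negR S.ante Γ A G) h2.symm
  · intro S hS T hT B A hF
    -- Equal sequents have the same members, so the one-component condition applies; otherwise `T`
    -- lies in the context of `S` and the two-component rule can be instantiated.
    by_cases hST : S = T
    · subst hST; exact oblL' S hS B A hF
    obtain ⟨Γ, G, h1, h2⟩ := ante hS hF
    have hTG : T ∈ G := by
      rw [h2, ← h1, Multiset.mem_cons] at hT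
      exact hT.resolve_left fun h => hST h.symm
    obtain ⟨G', rfl⟩ := Multiset.exists_cons_of_mem hTG
    exact h (oblL2 Γ S.succ T.ante T.succ B A G') h2.symm
  · intro S hS B A hF
    obtain ⟨Γ, G, h1, h2⟩ := succ hS hF
    have := h (oblR S.ante Γ B A G) h2.symm
    rwa [Redundant, concl, ← h2] at this
  · intro S hS A hF
    obtain ⟨Γ, G, h1, h2⟩ := succ hS hF
    have := h (betR S.ante Γ A G) h2.symm
    rwa [Redundant, concl, ← h2] at this
  · intro S hS A hF
    obtain ⟨Γ, G, h1, h2⟩ := succ hS hF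
    have := h (boxR S.ante Γ A G) h2.symm
    rwa [Redundant, concl, ← h2] at this
  · intro S hS T hT A hF
    by_cases hST : S = T
    · subst hST; exact boxL' S hS A hF
    obtain ⟨Γ, G, h1, h2⟩ := ante hS hF
    have hTG : T ∈ G := by
      rw [h2, ← h1, Multiset.mem_cons] at hT
      exact hT.resolve_left fun h => hST h.symm
    obtain ⟨G', rfl⟩ := Multiset.exists_cons_of_mem hTG
    exact h (boxL2 Γ S.succ T.ante T.succ A G') h2.symm

/-- Every premise has gained at least one formula or component. Together with `HypInv.size_le` this
is the termination argument of the search. -/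
theorem RuleApp.hyperSize_lt (r : RuleApp) {K : Hyperseq} (hK : K ∈ r.prems) :
    hyperSize r.concl < hyperSize K := by
  cases r <;> simp only [prems, List.mem_cons, List.not_mem_nil, or_false] at hK <;>
    rcases hK with rfl | rfl | rfl <;>
    simp only [concl, hyperSize, formulasSize, Multiset.map_cons, Multiset.sum_cons,
      Multiset.insert_eq_cons] <;> omega

/-- Induction on the room left below the size bound. While the hypersequent is not saturated, some
rule applies non-redundantly and one of its premises is again refuted in `M`; only that branch is
pursued. -/
theorem exists_saturated_of_refuted {A : Form} {M : PrefModel} {H : Hyperseq}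
    (hI : HypInv A H) (hM : Refuted M H) :
    ∃ D : Derivation H, D.Irredundant ∧ ∃ K, D.Occurs K ∧ Saturated K := by
  induction hn : 250 * A.size ^ 4 - hyperSize H using Nat.strong_induction_on generalizing H with
  | _ n ih =>
    by_cases hs : Saturated H
    · exact ⟨.leaf, by simp [Derivation.Irredundant], H, by simp [Derivation.Occurs], hs⟩
    · have : ∃ r : RuleApp, r.concl = H ∧ ¬ r.Redundant := by
        by_contra hc
        push Not at hc
        exact hs (saturated_of_forall_redundant hM.not_isAxiom hc)
      obtain ⟨r, rfl, hr⟩ := this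
      obtain ⟨K, hK, hKM⟩ := r.exists_refuted_prem hM
      have hKI := hI.prem hr hK
      have h1 := r.hyperSize_lt hK
      have h2 := hKI.size_le
      obtain ⟨D, hD, L, hL, hLs⟩ := ih _ (by omega) hKI hKM rfl
      obtain ⟨i, rfl⟩ := List.get_of_mem hK
      classical
      -- The premises off the chosen branch are left as leaves, which need not be axioms.
      refine ⟨.node r rfl (Function.update (fun _ => .leaf) i D), ?_, L, ?_, hLs⟩
      · refine ⟨hM.not_isAxiom, hr, fun j => ?_⟩
        by_cases hj : j = i
        · subst hj; simpa using hD
        · simp [hj, Derivation.Irredundant]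
      · exact .inr ⟨i, by simpa using hL⟩

theorem exists_saturated_of_not_valid {A : Form} (h : ¬ Valid A) :
    ∃ D : Derivation (rootOf A), D.Irredundant ∧ ∃ K, D.Occurs K ∧ Saturated K ∧
      hyperSize K ≤ 250 * A.size ^ 4 := by
  simp only [Valid, not_forall] at h
  obtain ⟨M, x, hx⟩ := h
  obtain ⟨D, hD, K, hK, hKs⟩ := exists_saturated_of_refuted (M := M) (hypInv_rootOf A) (by
    intro S hS
    rw [rootOf, Multiset.mem_singleton] at hS
    subst hS
    exact ⟨x, by simp, by simpa [PrefModel.bsat_toB] using hx⟩)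
  exact ⟨D, hD, K, hK, hKs, (hD.hypInv D (hypInv_rootOf A) hK).size_le⟩

open Function

set_option linter.unusedSectionVars false

/-! ### Structured stack programs and their compilation to Turing machines -/

/-- Structured programs over the stacks `K`, with a finite register of type `σ`. -/
inductive Cmd {K : Type} (Γ : K → Type) (σ : Type) : Type
  | push (k : K) (f : σ → Γ k)
  | pop (k : K) (f : σ → Option (Γ k) → σ)
  | load (f : σ → σ)
  | seq (c d : Cmd Γ σ)
  | ite (b : σ → Bool) (c d : Cmd Γ σ)
  | loop (b : σ → Bool) (c : Cmd Γ σ)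

section Cmd

variable {K : Type} [DecidableEq K] {Γ : K → Type} {σ : Type}

/-- `Exec c s S s' S' t`: the program `c`, started in register `s` and stacks `S`, ends after `t`
steps in `s'` and `S'`. -/
inductive Exec : Cmd Γ σ → σ → (∀ k, List (Γ k)) → σ → (∀ k, List (Γ k)) → ℕ → Prop
  | push {k f s S} : Exec (.push k f) s S s (update S k (f s :: S k)) 1
  | pop {k f s S} : Exec (.pop k f) s S (f s (S k).head?) (update S k (S k).tail) 1
  | load {f s S} : Exec (.load f) s S (f s) S 1
  | seq {c d s S s' S' s'' S'' t t'} : Exec c s S s' S' t → Exec d s' S' s'' S'' t' →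
      Exec (.seq c d) s S s'' S'' (t + t')
  | ite_true {b c d s S s' S' t} : b s = true → Exec c s S s' S' t →
      Exec (.ite b c d) s S s' S' (t + 1)
  | ite_false {b c d s S s' S' t} : b s = false → Exec d s S s' S' t →
      Exec (.ite b c d) s S s' S' (t + 1)
  | loop_end {b c s S} : b s = false → Exec (.loop b c) s S s S 1
  | loop_step {b c s S s' S' s'' S'' t t'} : b s = true → Exec c s S s' S' t →
      Exec (.loop b c) s' S' s'' S'' t' → Exec (.loop b c) s S s'' S'' (t + t' + 1)

/-- The labels of the compiled program. -/
def Cmd.Label : Cmd Γ σ → Type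
  | .push _ _ | .pop _ _ | .load _ => Unit
  | .seq c d => c.Label ⊕ d.Label
  | .ite _ c d => Option (c.Label ⊕ d.Label)
  | .loop _ c => Option c.Label

/-- There are finitely many labels. -/
@[reducible] def Cmd.fintypeLabel : (c : Cmd Γ σ) → Fintype c.Label
  | .push _ _ | .pop _ _ | .load _ => inferInstanceAs (Fintype Unit)
  | .seq c d =>
    letI := c.fintypeLabel
    letI := d.fintypeLabel
    inferInstanceAs (Fintype (c.Label ⊕ d.Label))
  | .ite _ c d =>
    letI := c.fintypeLabel
    letI := d.fintypeLabel
    inferInstanceAs (Fintype (Option (c.Label ⊕ d.Label)))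
  | .loop _ c =>
    letI := c.fintypeLabel
    inferInstanceAs (Fintype (Option c.Label))

/-- The label at which the compiled program starts. -/
def Cmd.entry : (c : Cmd Γ σ) → c.Label
  | .push _ _ | .pop _ _ | .load _ => ()
  | .seq c _ => Sum.inl c.entry
  | .ite _ _ _ => none
  | .loop _ _ => none

/-- The compiled program, embedded into a machine with labels `Λ`, leaving it at `exit`. -/
def Cmd.code {Λ : Type} : (c : Cmd Γ σ) → (c.Label → Λ) → Λ → c.Label → Turing.TM2.Stmt Γ Λ σ
  | .push k f, _, exit, _ => .push k f (.goto fun _ => exit)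
  | .pop k f, _, exit, _ => .pop k f (.goto fun _ => exit)
  | .load f, _, exit, _ => .load f (.goto fun _ => exit)
  | .seq c d, emb, _, .inl l => c.code (fun x => emb (.inl x)) (emb (.inr d.entry)) l
  | .seq _ d, emb, exit, .inr l => d.code (fun x => emb (.inr x)) exit l
  | .ite b c d, emb, _, none =>
      .branch b (.goto fun _ => emb (some (.inl c.entry)))
        (.goto fun _ => emb (some (.inr d.entry)))
  | .ite _ c _, emb, exit, some (.inl l) => c.code (fun x => emb (some (.inl x))) exit l
  | .ite _ _ d, emb, exit, some (.inr l) => d.code (fun x => emb (some (.inr x))) exit l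
  | .loop b c, emb, exit, none =>
      .branch b (.goto fun _ => emb (some c.entry)) (.goto fun _ => exit)
  | .loop _ c, emb, _, some l => c.code (fun x => emb (some x)) (emb none) l

/-- The machine goes from one configuration to another in exactly `n` steps. -/
def RunsIn {Λ : Type} (m : Λ → Turing.TM2.Stmt Γ Λ σ) (n : ℕ) (a b : Turing.TM2.Cfg Γ Λ σ) : Prop :=
  (flip bind (Turing.TM2.step m))^[n] (some a) = some b

theorem RunsIn.trans {Λ : Type} {m : Λ → Turing.TM2.Stmt Γ Λ σ} {n n' : ℕ}
    {a b c : Turing.TM2.Cfg Γ Λ σ} (h : RunsIn m n a b) (h' : RunsIn m n' b c) :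
    RunsIn m (n + n') a c := by
  unfold RunsIn at *
  rw [Nat.add_comm, Function.iterate_add_apply, h, h']

theorem runsIn_one {Λ : Type} {m : Λ → Turing.TM2.Stmt Γ Λ σ} {l : Λ} {s : σ}
    {S : ∀ k, List (Γ k)} : RunsIn m 1 ⟨some l, s, S⟩ (Turing.TM2.stepAux (m l) s S) := rfl

/-- The ambient machine, the embedding of labels and the exit are all arbitrary, so the induction
hypothesis can be applied to a subprogram sitting inside its parent. In a loop the body exits to
`none`, the label of the test. -/
theorem Exec.runsIn {c : Cmd Γ σ} {s s' : σ} {S S' : ∀ k, List (Γ k)} {t : ℕ}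
    (h : Exec c s S s' S' t) : ∀ {Λ : Type} (m : Λ → Turing.TM2.Stmt Γ Λ σ) (emb : c.Label → Λ)
      (exit : Λ), (∀ l, m (emb l) = c.code emb exit l) →
      RunsIn m t ⟨some (emb c.entry), s, S⟩ ⟨some exit, s', S'⟩ := by
  induction h with
  | push | pop | load =>
    intro Λ m emb exit hm
    have := runsIn_one (m := m) (l := emb (Cmd.entry _)) (s := ‹σ›) (S := ‹∀ k, List (Γ k)›)
    rw [hm] at this
    exact this
  | @seq c d _ _ _ _ _ _ _ _ _ _ ih1 ih2 =>
    intro Λ m emb exit hm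
    exact (ih1 m (fun x => emb (.inl x)) (emb (.inr d.entry)) fun l => hm (.inl l)).trans
      (ih2 m (fun x => emb (.inr x)) exit fun l => hm (.inr l))
  | @ite_true b c d s S s' S' t hb _ ih =>
    intro Λ m emb exit hm
    have h1 := runsIn_one (m := m) (l := emb none) (s := s) (S := S)
    rw [hm none, Cmd.code, Turing.TM2.stepAux, hb] at h1
    rw [Nat.add_comm]
    exact h1.trans (ih m (fun x => emb (some (.inl x))) exit fun l => hm (some (.inl l)))
  | @ite_false b c d s S s' S' t hb _ ih =>
    intro Λ m emb exit hm
    have h1 := runsIn_one (m := m) (l := emb none) (s := s) (S := S)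
    rw [hm none, Cmd.code, Turing.TM2.stepAux, hb] at h1
    rw [Nat.add_comm]
    exact h1.trans (ih m (fun x => emb (some (.inr x))) exit fun l => hm (some (.inr l)))
  | @loop_end b c s S hb =>
    intro Λ m emb exit hm
    have h1 := runsIn_one (m := m) (l := emb none) (s := s) (S := S)
    rw [hm none, Cmd.code, Turing.TM2.stepAux, hb] at h1
    exact h1
  | @loop_step b c s S s' S' s'' S'' t t' hb _ _ ih1 ih2 =>
    intro Λ m emb exit hm
    have h1 := runsIn_one (m := m) (l := emb none) (s := s) (S := S)
    rw [hm none, Cmd.code, Turing.TM2.stepAux, hb] at h1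
    rw [Nat.add_comm]
    exact h1.trans ((ih1 m (fun x => emb (some x)) (emb none) fun l => hm (some l)).trans
      (ih2 m emb exit hm))

end Cmd

/-! ### Polynomially bounded functions -/

/-- `f` is bounded by a power of `n + 2`. -/
def PolyBdd (f : ℕ → ℕ) : Prop := ∃ d, ∀ n, f n ≤ (n + 2) ^ d

theorem PolyBdd.const (c : ℕ) : PolyBdd fun _ => c :=
  ⟨c, fun n => (Nat.lt_two_pow_self (n := c)).le.trans (Nat.pow_le_pow_left (by omega) c)⟩

theorem PolyBdd.id : PolyBdd fun n => n := ⟨1, fun n => by simp⟩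

theorem PolyBdd.mul {f g : ℕ → ℕ} : PolyBdd f → PolyBdd g → PolyBdd fun n => f n * g n := by
  rintro ⟨d, hd⟩ ⟨e, he⟩
  exact ⟨d + e, fun n => (Nat.mul_le_mul (hd n) (he n)).trans (pow_add _ _ _).ge⟩

/-- Both summands are at most `(n + 2) ^ (d + e)`, and one further factor `n + 2 ≥ 2` absorbs the
doubling. -/
theorem PolyBdd.add {f g : ℕ → ℕ} : PolyBdd f → PolyBdd g → PolyBdd fun n => f n + g n := by
  rintro ⟨d, hd⟩ ⟨e, he⟩
  refine ⟨d + e + 1, fun n => ?_⟩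
  have h1 : (n + 2) ^ d ≤ (n + 2) ^ (d + e) := Nat.pow_le_pow_right (by omega) (by omega)
  have h2 : (n + 2) ^ e ≤ (n + 2) ^ (d + e) := Nat.pow_le_pow_right (by omega) (by omega)
  have h3 := hd n
  have h4 := he n
  rw [pow_succ]
  nlinarith

theorem PolyBdd.pow {f : ℕ → ℕ} (hf : PolyBdd f) (k : ℕ) : PolyBdd fun n => f n ^ k := by
  obtain ⟨d, hd⟩ := hf
  exact ⟨d * k, fun n => (Nat.pow_le_pow_left (hd n) k).trans (pow_mul _ _ _).ge⟩

/-! ### Environments of string variables -/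

/-- The stacks of the machine: input, output, a call stack, a scratch stack, and variables. -/
inductive Stk (V : Type) : Type
  | inp | out | save | tmp
  | var (v : V)
  deriving DecidableEq, Fintype

/-- The alphabets of the stacks. -/
abbrev Stk.Alph {V : Type} (I α : Type) : Stk V → Type
  | .inp => I
  | .out => Bool
  | .save => Option α
  | .tmp => α
  | .var _ => α

section Programs

variable {V I α : Type} [DecidableEq V]

/-- The contents of all stacks. -/
def store (i : List I) (o : List Bool) (x : List (Option α)) (y : List α) (S : V → List α) :
    (k : Stk V) → List (Stk.Alph I α k)
  | .inp => i
  | .out => o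
  | .save => x
  | .tmp => y
  | .var v => S v

section store
variable (i i' : List I) (o o' : List Bool) (x x' : List (Option α)) (y y' : List α)
  (S : V → List α)

@[simp] theorem store_inp : store i o x y S .inp = i := rfl
@[simp] theorem store_out : store i o x y S .out = o := rfl
@[simp] theorem store_save : store i o x y S .save = x := rfl
@[simp] theorem store_tmp : store i o x y S .tmp = y := rfl
@[simp] theorem store_var (v : V) : store i o x y S (.var v) = S v := rfl

@[simp] theorem update_store_inp : update (store i o x y S) .inp i' = store i' o x y S := by
  funext k; cases k <;> simp [update]

@[simp] theorem update_store_out : update (store i o x y S) .out o' = store i o' x y S := by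
  funext k; cases k <;> simp [update]

@[simp] theorem update_store_save : update (store i o x y S) .save x' = store i o x' y S := by
  funext k; cases k <;> simp [update]

@[simp] theorem update_store_tmp : update (store i o x y S) .tmp y' = store i o x y' S := by
  funext k; cases k <;> simp [update]

@[simp] theorem update_store_var (v : V) (l : List α) :
    update (store i o x y S) (.var v) l = store i o x y (update S v l) := by
  funext k
  cases k with
  | var u =>
    by_cases h : u = v
    · subst h; simp
    · simp [h]
  | _ => simp [update]

end store

variable (V I α) in
/-- Programs with a flag and a one-symbol buffer as register. -/
abbrev Prog := Cmd (Stk.Alph (V := V) I α) (Bool × Option α)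

/-! ### Elementary stack programs -/

/-- Pop symbols from `k` into the buffer, executing `body` after each, until `conv` yields none. -/
def drain (k : Stk V) (conv : Option (Stk.Alph I α k) → Option α) (body : Prog V I α) :
    Prog V I α :=
  .seq (.pop k fun s a => (s.1, conv a))
    (.loop (fun s => s.2.isSome) (.seq body (.pop k fun s a => (s.1, conv a))))

/-- `P l d` describes all stacks when `l` remains to be read and `d` has been processed, latest
first. The closing `tail` accounts for the last pop, which removes an end marker if there is one and
does nothing on an empty stack. -/
theorem exec_drain {k : Stk V} {conv : Option (Stk.Alph I α k) → Option α} {body : Prog V I α}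
    {β : Type} (g : β → α)
    (P : List β → List β → (k : Stk V) → List (Stk.Alph I α k)) {T : ℕ}
    (h1 : ∀ a l d, conv ((P (a :: l) d) k).head? = some (g a))
    (h0 : ∀ d, conv ((P [] d) k).head? = none)
    (hb : ∀ b a l d, Exec body (b, some (g a)) (update (P (a :: l) d) k ((P (a :: l) d) k).tail)
      (b, some (g a)) (P l (a :: d)) T) (b : Bool) (a₀ : Option α) (l d : List β) :
    Exec (drain k conv body) (b, a₀) (P l d) (b, none)
      (update (P [] (l.reverse ++ d)) k ((P [] (l.reverse ++ d)) k).tail)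
      ((T + 2) * l.length + 2) := by
  -- The first pop is split off because each iteration ends with the pop that serves the next test.
  have key : ∀ l d a₀, ∃ a S, Exec (.pop k fun s a => (s.1, conv a)) (b, a₀) (P l d) (b, a) S 1 ∧
      Exec (.loop (fun s => s.2.isSome) (.seq body (.pop k fun s a => (s.1, conv a)))) (b, a) S
      (b, none) (update (P [] (l.reverse ++ d)) k ((P [] (l.reverse ++ d)) k).tail)
      ((T + 2) * l.length + 1) := by
    intro l
    induction l with
    | nil =>
      intro d a₀
      refine ⟨_, _, .pop, ?_⟩
      simp only [h0]
      exact .loop_end rfl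
    | cons a l ih =>
      intro d a₀
      refine ⟨_, _, .pop, ?_⟩
      obtain ⟨a', S', h3, h4⟩ := ih (a :: d) (some (g a))
      simp only [h1]
      have := Exec.loop_step (b := fun s : Bool × Option α => s.2.isSome) rfl
        (.seq (hb b a l d) h3) h4
      convert this using 1
      · simp
      · simp only [List.length_cons]; ring
  obtain ⟨a, S, h3, h4⟩ := key l d a₀
  have := Exec.seq h3 h4
  rwa [Nat.add_comm 1] at this

variable [Inhabited α]

/-- Push the buffer on a variable. -/
def pushVar (v : V) : Prog V I α := .push (.var v) fun s => s.2.getD default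

/-- Push the buffer on the scratch stack. -/
def pushTmp : Prog V I α := .push .tmp fun s => s.2.getD default

theorem exec_pushVar (i o) (x : List (Option α)) (y) (S : V → List α) (v : V) (b : Bool) (a : α) :
    Exec (pushVar (I := I) v) (b, some a) (store i o x y S) (b, some a)
      (store i o x y (update S v (a :: S v))) 1 := by
  have := Exec.push (k := .var v) (f := fun s => s.2.getD default) (s := (b, some a))
    (S := store (I := I) i o x y S)
  rwa [update_store_var] at this

theorem exec_pushTmp (i o) (x : List (Option α)) (y) (S : V → List α) (b : Bool) (a : α) :
    Exec (pushTmp (I := I)) (b, some a) (store i o x y S) (b, some a)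
      (store i o x (a :: y) S) 1 := by
  have := Exec.push (k := .tmp) (f := fun s => s.2.getD default) (s := (b, some a))
    (S := store (I := I) i o x y S)
  rwa [update_store_tmp] at this

/-- Empty a variable. -/
def clear (v : V) : Prog V I α := drain (.var v) id (.load id)

theorem exec_clear (i o) (x : List (Option α)) (y) (S : V → List α) (v : V) (s : Bool × Option α) :
    Exec (clear (I := I) v) s (store i o x y S) (s.1, none) (store i o x y (update S v []))
      (3 * (S v).length + 2) := by
  have := exec_drain (g := fun a => a) (k := .var v) (conv := id) (body := .load id)
    (P := fun l _ => store (I := I) i o x y (update S v l)) (T := 1) (by simp) (by simp)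
    (fun b a l d => by simpa using Exec.load (f := id)) s.1 s.2 (S v) []
  unfold clear
  simpa using this

/-- Move a variable to the scratch stack, in reverse. -/
def varToTmp (v : V) : Prog V I α := drain (.var v) id pushTmp

theorem exec_varToTmp (i o) (x : List (Option α)) (S : V → List α) (v : V) (s : Bool × Option α) :
    Exec (varToTmp (I := I) v) s (store i o x [] S) (s.1, none)
      (store i o x (S v).reverse (update S v [])) (3 * (S v).length + 2) := by
  have := exec_drain (g := fun a => a) (k := .var v) (conv := id) (body := pushTmp)
    (P := fun l d => store (I := I) i o x d (update S v l)) (T := 1) (by simp) (by simp)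
    (fun b a l d => by simpa using exec_pushTmp (I := I) i o x d (update S v l) b a)
    s.1 s.2 (S v) []
  unfold varToTmp
  simpa using this

/-- Move the scratch stack to a variable, in reverse. -/
def tmpToVar (v : V) : Prog V I α := drain .tmp id (pushVar v)

theorem exec_tmpToVar (i o) (x : List (Option α)) (y) (S : V → List α) (v : V)
    (s : Bool × Option α) :
    Exec (tmpToVar (I := I) v) s (store i o x y S) (s.1, none)
      (store i o x [] (update S v (y.reverse ++ S v))) (3 * y.length + 2) := by
  have := exec_drain (g := fun a => a) (k := .tmp) (conv := id) (body := pushVar v)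
    (P := fun l d => store (I := I) i o x l (update S v d)) (T := 1) (by simp) (by simp)
    (fun b a l d => by simpa using exec_pushVar (I := I) i o x l (update S v d) v b a)
    s.1 s.2 y (S v)
  unfold tmpToVar
  simpa using this

/-- Put a copy of a variable on the call stack. -/
def saveVar (v : V) : Prog V I α :=
  .seq (varToTmp v) (.seq (.push .save fun _ => none)
    (drain .tmp id (.seq (pushVar v) (.push .save fun s => s.2))))

/-- The `none` pushed first marks the bottom of a frame whose symbols are wrapped in `some`; frames
can thus be stacked on any call stack `x`. -/
theorem exec_saveVar (i o) (x : List (Option α)) (S : V → List α) (v : V) (s : Bool × Option α) :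
    Exec (saveVar (I := I) v) s (store i o x [] S) (s.1, none)
      (store i o ((S v).map some ++ none :: x) [] S) (7 * (S v).length + 5) := by
  have h1 := exec_varToTmp (I := I) i o x S v s
  have h2 := Exec.push (k := .save) (f := fun _ => none) (s := (s.1, (none : Option α)))
    (S := store (I := I) i o x (S v).reverse (update S v []))
  simp only [store_save, update_store_save] at h2
  have h3 := exec_drain (g := fun a => a) (k := .tmp) (conv := id)
    (body := .seq (pushVar v) (.push .save fun s => s.2))
    (P := fun l d => store (I := I) i o (d.map some ++ none :: x) l (update S v d)) (T := 2)
    (by simp) (by simp)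
    (fun b a l d => by
      have h4 := exec_pushVar (I := I) i o (d.map some ++ none :: x) l (update S v d) v b a
      have h5 := Exec.push (k := .save) (f := fun s => s.2)
        (s := (b, some a))
        (S := store (I := I) i o (d.map some ++ none :: x) l (update S v (a :: d)))
      simp at h4 h5
      simpa using Exec.seq h4 h5) s.1 none (S v).reverse []
  simp at h3
  have := Exec.seq h1 (Exec.seq h2 h3)
  unfold saveVar
  convert this using 1
  omega

/-- Take a copy of a variable back from the call stack. -/
def restoreVar (v : V) : Prog V I α :=
  .seq (clear v) (.seq (drain .save Option.join pushTmp) (tmpToVar v))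

/-- `Option.join` sends both the marker and an empty stack to `none`, so reading stops at the
marker, which is popped as well. The detour through the scratch stack undoes the reversal. -/
theorem exec_restoreVar (i o) (x : List (Option α)) (S : V → List α) (v : V) (l : List α)
    (s : Bool × Option α) :
    Exec (restoreVar (I := I) v) s (store i o (l.map some ++ none :: x) [] S) (s.1, none)
      (store i o x [] (update S v l)) (3 * (S v).length + 6 * l.length + 6) := by
  have h1 := exec_clear (I := I) i o (l.map some ++ none :: x) [] S v s
  have h2 := exec_drain (g := fun a => a) (k := .save) (conv := Option.join) (body := pushTmp)
    (P := fun l d => store (I := I) i o (l.map some ++ none :: x) d (update S v [])) (T := 1)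
    (by simp) (by simp)
    (fun b a l d => by
      simpa using exec_pushTmp (I := I) i o (l.map some ++ none :: x) d (update S v []) b a)
    s.1 none l []
  simp at h2
  have h3 := exec_tmpToVar (I := I) i o x l.reverse (update S v []) v (s.1, none)
  simp at h3
  have := Exec.seq h1 (Exec.seq h2 h3)
  unfold restoreVar
  convert this using 1
  omega

/-! ### Polynomial-time transformations and predicates of environments -/

variable [Fintype V]

/-- The total length of the variables. -/
def envSize (S : V → List α) : ℕ := ∑ v, (S v).length

theorem length_le_envSize (S : V → List α) (v : V) : (S v).length ≤ envSize S :=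
  Finset.single_le_sum (f := fun v => (S v).length) (fun _ _ => Nat.zero_le _) (Finset.mem_univ v)

theorem envSize_update (S : V → List α) (v : V) (l : List α) :
    envSize (update S v l) + (S v).length = envSize S + l.length := by
  unfold envSize
  rw [← Finset.add_sum_erase _ _ (Finset.mem_univ v),
    ← Finset.add_sum_erase Finset.univ (fun u => (S u).length) (Finset.mem_univ v)]
  have : ∑ u ∈ Finset.univ.erase v, (update S v l u).length =
      ∑ u ∈ Finset.univ.erase v, (S u).length :=
    Finset.sum_congr rfl fun u hu => by rw [update_of_ne (Finset.ne_of_mem_erase hu)]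
  rw [this, update_self]
  ring

variable (I) in
/-- `T` is computed by a program in polynomial time. -/
def PolyTrans (T : (V → List α) → V → List α) : Prop :=
  ∃ (c : Prog V I α) (d : ℕ), ∀ S, envSize (T S) ≤ (envSize S + 2) ^ d ∧
    ∀ x s, ∃ s' t, t ≤ (envSize S + 2) ^ d ∧
      Exec c s (store [] [] x [] S) s' (store [] [] x [] (T S)) t

variable (I) in
/-- `P` is decided by a program in polynomial time that restores all variables outside `W`. -/
def PolyDecOn (W : Finset V) (P : (V → List α) → Bool) : Prop :=
  ∃ (c : Prog V I α) (d : ℕ), ∀ S x s, ∃ a S' t, t ≤ (envSize S + 2) ^ d ∧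
    envSize S' ≤ (envSize S + 2) ^ d ∧ (∀ v ∉ W, S' v = S v) ∧
      Exec c s (store [] [] x [] S) (P S, a) (store [] [] x [] S') t

variable (I) in
/-- `P` is decided by a program in polynomial time that restores all variables. -/
def PolyDec (P : (V → List α) → Bool) : Prop :=
  ∃ (c : Prog V I α) (d : ℕ), ∀ S x s, ∃ a t, t ≤ (envSize S + 2) ^ d ∧
      Exec c s (store [] [] x [] S) (P S, a) (store [] [] x [] S) t

/-- The program works over an arbitrary call stack, so it can be run between a save and a restore of
`v`; the answer stays in the register. -/
theorem PolyDecOn.restore {W : Finset V} {P : (V → List α) → Bool} {v : V}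
    (h : PolyDecOn I (insert v W) P) : PolyDecOn I W P := by
  obtain ⟨c, d, h⟩ := h
  obtain ⟨e, he⟩ : ∃ k, ∀ n, (n + 2) ^ d + n + (7 * n + 5 + ((n + 2) ^ d +
      (3 * (n + 2) ^ d + 6 * n + 6))) ≤ (n + 2) ^ k := by
    have h1 : PolyBdd fun n => (n + 2) ^ d := (PolyBdd.id.add (.const 2)).pow d
    exact (h1.add .id).add ((((PolyBdd.const 7).mul .id).add (.const 5)).add
      (h1.add ((((PolyBdd.const 3).mul h1).add ((PolyBdd.const 6).mul .id)).add (.const 6))))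
  refine ⟨.seq (saveVar v) (.seq c (restoreVar v)), e, fun S x s => ?_⟩
  obtain ⟨a, S', t, ht, hS, hW, hE⟩ := h S ((S v).map some ++ none :: x) (s.1, none)
  have h1 := exec_saveVar (I := I) [] [] x S v s
  have h2 := exec_restoreVar (I := I) [] [] x S' v (S v) (P S, a)
  have h3 := he (envSize S)
  have h4 := length_le_envSize S v
  have h5 := length_le_envSize S' v
  have h6 := envSize_update S' v (S v)
  refine ⟨none, update S' v (S v), _, ?_, ?_, ?_, Exec.seq h1 (.seq hE h2)⟩
  · omega
  · omega
  · intro u hu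
    by_cases huv : u = v
    · subst huv; simp
    · rw [update_of_ne huv]
      exact hW u (by simp [huv, hu])

/-- Restoring the finitely many variables one at a time makes any decider non-destructive, so tests
may consume their variables. -/
theorem PolyDecOn.polyDec {W : Finset V} {P : (V → List α) → Bool} (h : PolyDecOn I W P) :
    PolyDec I P := by
  have : PolyDecOn I ∅ P := by
    induction W using Finset.induction_on with
    | empty => exact h
    | insert v W _ ih => exact ih h.restore
  obtain ⟨c, d, h⟩ := this
  refine ⟨c, d, fun S x s => ?_⟩
  obtain ⟨a, S', t, ht, -, hS, hE⟩ := h S x s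
  obtain rfl : S' = S := funext fun v => hS v (Finset.notMem_empty v)
  exact ⟨a, t, ht, hE⟩

theorem PolyTrans.comp {T U : (V → List α) → V → List α} (hU : PolyTrans I U)
    (hT : PolyTrans I T) : PolyTrans I fun S => U (T S) := by
  obtain ⟨c, d, hT⟩ := hT
  obtain ⟨c', d', hU⟩ := hU
  obtain ⟨e, he⟩ : ∃ k, ∀ n, (n + 2) ^ d + ((n + 2) ^ d + 2) ^ d' ≤ (n + 2) ^ k := by
    have h1 : PolyBdd fun n => (n + 2) ^ d := (PolyBdd.id.add (.const 2)).pow d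
    exact h1.add ((h1.add (.const 2)).pow d')
  refine ⟨.seq c c', e, fun S => ?_⟩
  have h1 := he (envSize S)
  have h2 := (hT S).1
  have h3 : (envSize (T S) + 2) ^ d' ≤ ((envSize S + 2) ^ d + 2) ^ d' :=
    Nat.pow_le_pow_left (by omega) _
  refine ⟨(hU (T S)).1.trans (by omega), fun x s => ?_⟩
  obtain ⟨s', t, ht, hE⟩ := (hT S).2 x s
  obtain ⟨s'', t', ht', hE'⟩ := (hU (T S)).2 x s'
  exact ⟨s'', _, by omega, hE.seq hE'⟩

/-- The program for `T` overwrites the environment, so the test is first built with all variables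
unprotected and they are restored afterwards. The bound on the size of `T S` keeps the second run
polynomial. -/
theorem PolyDec.comp {P : (V → List α) → Bool} {T : (V → List α) → V → List α}
    (hP : PolyDec I P) (hT : PolyTrans I T) : PolyDec I fun S => P (T S) := by
  refine PolyDecOn.polyDec (W := Finset.univ) ?_
  obtain ⟨c, d, hT⟩ := hT
  obtain ⟨c', d', hP⟩ := hP
  obtain ⟨e, he⟩ : ∃ k, ∀ n, (n + 2) ^ d + ((n + 2) ^ d + 2) ^ d' ≤ (n + 2) ^ k := by
    have h1 : PolyBdd fun n => (n + 2) ^ d := (PolyBdd.id.add (.const 2)).pow d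
    exact h1.add ((h1.add (.const 2)).pow d')
  refine ⟨.seq c c', e, fun S x s => ?_⟩
  have h1 := he (envSize S)
  have h2 := (hT S).1
  have h3 : (envSize (T S) + 2) ^ d' ≤ ((envSize S + 2) ^ d + 2) ^ d' :=
    Nat.pow_le_pow_left (by omega) _
  obtain ⟨s', t, ht, hE⟩ := (hT S).2 x s
  obtain ⟨a, t', ht', hE'⟩ := hP (T S) x s'
  exact ⟨a, T S, _, by omega, by omega, by simp, hE.seq hE'⟩

theorem PolyDec.ite {P Q R : (V → List α) → Bool} (hP : PolyDec I P) (hQ : PolyDec I Q)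
    (hR : PolyDec I R) : PolyDec I fun S => bif P S then Q S else R S := by
  obtain ⟨c, d, hP⟩ := hP
  obtain ⟨c', d', hQ⟩ := hQ
  obtain ⟨c'', d'', hR⟩ := hR
  obtain ⟨e, he⟩ : ∃ k, ∀ n, (n + 2) ^ d + ((n + 2) ^ d' + (n + 2) ^ d'' + 1) ≤ (n + 2) ^ k := by
    have h1 : ∀ d, PolyBdd fun n => (n + 2) ^ d := (PolyBdd.id.add (.const 2)).pow
    exact (h1 d).add (((h1 d').add (h1 d'')).add (.const 1))
  refine ⟨.seq c (.ite (fun s => s.1) c' c''), e, fun S x s => ?_⟩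
  have h1 := he (envSize S)
  obtain ⟨a, t, ht, hE⟩ := hP S x s
  cases hb : P S with
  | true =>
    obtain ⟨a', t', ht', hE'⟩ := hQ S x (P S, a)
    refine ⟨a', t + (t' + 1), by omega, ?_⟩
    simp only [hb, cond_true] at hE hE' ⊢
    exact hE.seq (.ite_true rfl hE')
  | false =>
    obtain ⟨a', t', ht', hE'⟩ := hR S x (P S, a)
    refine ⟨a', t + (t' + 1), by omega, ?_⟩
    simp only [hb, cond_false] at hE hE' ⊢
    exact hE.seq (.ite_false rfl hE')

theorem PolyTrans.ite {P : (V → List α) → Bool} {T U : (V → List α) → V → List α}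
    (hP : PolyDec I P) (hT : PolyTrans I T) (hU : PolyTrans I U) :
    PolyTrans I fun S => bif P S then T S else U S := by
  obtain ⟨c, d, hP⟩ := hP
  obtain ⟨c', d', hT⟩ := hT
  obtain ⟨c'', d'', hU⟩ := hU
  obtain ⟨e, he⟩ : ∃ k, ∀ n, (n + 2) ^ d + ((n + 2) ^ d' + (n + 2) ^ d'' + 1) ≤ (n + 2) ^ k := by
    have h1 : ∀ d, PolyBdd fun n => (n + 2) ^ d := (PolyBdd.id.add (.const 2)).pow
    exact (h1 d).add (((h1 d').add (h1 d'')).add (.const 1))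
  refine ⟨.seq c (.ite (fun s => s.1) c' c''), e, fun S => ?_⟩
  have h1 := he (envSize S)
  beta_reduce
  cases hb : P S with
  | true =>
    refine ⟨by have := (hT S).1; simp only [cond_true]; omega, fun x s => ?_⟩
    obtain ⟨a, t, ht, hE⟩ := hP S x s
    obtain ⟨s', t', ht', hE'⟩ := (hT S).2 x (P S, a)
    simp only [hb, cond_true] at hE hE' ⊢
    exact ⟨s', _, by omega, hE.seq (.ite_true rfl hE')⟩
  | false =>
    refine ⟨by have := (hU S).1; simp only [cond_false]; omega, fun x s => ?_⟩
    obtain ⟨a, t, ht, hE⟩ := hP S x s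
    obtain ⟨s', t', ht', hE'⟩ := (hU S).2 x (P S, a)
    simp only [hb, cond_false] at hE hE' ⊢
    exact ⟨s', _, by omega, hE.seq (.ite_false rfl hE')⟩

theorem PolyDec.const (b : Bool) : PolyDec I fun _ : V → List α => b := by
  refine ⟨.load fun s => (b, s.2), 0, fun S x s => ⟨s.2, 1, by simp, ?_⟩⟩
  exact Exec.load (f := fun s => (b, s.2))

theorem PolyDec.not {P : (V → List α) → Bool} (hP : PolyDec I P) : PolyDec I fun S => !P S := by
  convert hP.ite (.const false) (.const true) using 2 with S
  cases P S <;> rfl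

theorem PolyDec.and {P Q : (V → List α) → Bool} (hP : PolyDec I P) (hQ : PolyDec I Q) :
    PolyDec I fun S => P S && Q S := by
  convert hP.ite hQ (.const false) using 2 with S
  cases P S <;> rfl

theorem PolyDec.or {P Q : (V → List α) → Bool} (hP : PolyDec I P) (hQ : PolyDec I Q) :
    PolyDec I fun S => P S || Q S := by
  convert hP.ite (.const true) hQ using 2 with S
  cases P S <;> rfl

/-- The symbol is popped into the buffer, tested on the way, and pushed back if there was one. -/
theorem PolyDec.head (v : V) (f : Option α → Bool) :
    PolyDec I fun S : V → List α => f (S v).head? := by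
  refine ⟨.seq (.pop (.var v) fun _ a => (f a, a))
    (.ite (fun s => s.2.isSome) (pushVar v) (.load id)), 2, fun S x s => ?_⟩
  have h1 := Exec.pop (k := .var v) (f := fun _ a => (f a, a)) (s := s)
    (S := store (I := I) [] [] x [] S)
  simp only [store_var, update_store_var] at h1
  refine ⟨(S v).head?, 1 + (1 + 1), ?_, h1.seq ?_⟩
  · have := Nat.pow_le_pow_left (Nat.le_add_left 2 (envSize S)) 2
    omega
  · cases hv : S v with
    | nil =>
      refine .ite_false rfl ?_
      have := Exec.load (f := id) (s := (f none, (none : Option α)))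
        (S := store (I := I) [] [] x [] S)
      rw [List.tail_nil, ← hv, update_eq_self]
      simpa [hv] using this
    | cons a l =>
      refine .ite_true rfl ?_
      have := exec_pushVar (I := I) [] [] x [] (update S v l) v (f (some a)) a
      have h2 : update S v (a :: l) = S := by rw [← hv, update_eq_self]
      simpa [h2, hv] using this

theorem PolyTrans.id : PolyTrans I fun S : V → List α => S := by
  refine ⟨.load _root_.id, 1, fun S => ⟨by simp, fun x s => ⟨s, 1, by rw [pow_one]; omega, ?_⟩⟩⟩
  exact Exec.load (f := _root_.id)

theorem PolyTrans.tail (v : V) : PolyTrans I fun S : V → List α => update S v (S v).tail := by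
  refine ⟨.pop (.var v) fun s _ => s, 1, fun S =>
    ⟨?_, fun x s => ⟨s, 1, by rw [pow_one]; omega, ?_⟩⟩⟩
  · have := envSize_update S v (S v).tail
    rw [List.length_tail] at this
    rw [pow_one]
    beta_reduce
    omega
  · simpa using Exec.pop (k := .var v) (f := fun s _ => s) (s := s)
      (S := store (I := I) [] [] x [] S)

theorem PolyTrans.cons (v : V) (a : α) :
    PolyTrans I fun S : V → List α => update S v (a :: S v) := by
  refine ⟨.push (.var v) fun _ => a, 1, fun S =>
    ⟨?_, fun x s => ⟨s, 1, by rw [pow_one]; omega, ?_⟩⟩⟩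
  · have := envSize_update S v (a :: S v)
    rw [List.length_cons] at this
    rw [pow_one]
    beta_reduce
    omega
  · simpa using Exec.push (k := .var v) (f := fun _ => a) (s := s)
      (S := store (I := I) [] [] x [] S)

theorem PolyTrans.nil (v : V) : PolyTrans I fun S : V → List α => update S v [] := by
  obtain ⟨e, he⟩ : ∃ k, ∀ n, 3 * n + 2 ≤ (n + 2) ^ k :=
    ((PolyBdd.const 3).mul .id).add (.const 2)
  refine ⟨clear v, e, fun S => ⟨?_, fun x s => ⟨_, _, ?_, exec_clear [] [] x [] S v s⟩⟩⟩
  · have := envSize_update S v []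
    have := he (envSize S)
    rw [List.length_nil] at *
    beta_reduce
    omega
  · have := length_le_envSize S v
    have := he (envSize S)
    omega

/-- Assignment of one variable to another. -/
theorem PolyTrans.copy {u v : V} (huv : u ≠ v) :
    PolyTrans I fun S : V → List α => update S u (S v) := by
  obtain ⟨e, he⟩ : ∃ k, ∀ n, 10 * n + 6 ≤ (n + 2) ^ k :=
    ((PolyBdd.const 10).mul .id).add (.const 6)
  refine ⟨.seq (clear u) (.seq (varToTmp v) (drain .tmp _root_.id (.seq (pushVar v) (pushVar u)))),
    e, fun S => ?_⟩
  have h1 := envSize_update S u (S v)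
  have h2 := length_le_envSize S v
  have h3 := he (envSize S)
  have h4 := length_le_envSize S u
  refine ⟨by beta_reduce; omega, fun x s => ?_⟩
  have e1 := exec_clear (I := I) [] [] x [] S u s
  have e2 := exec_varToTmp (I := I) [] [] x (update S u []) v (s.1, none)
  simp only [update_of_ne huv.symm] at e2
  have e3 := exec_drain (g := fun a => a) (k := .tmp) (conv := _root_.id)
    (body := .seq (pushVar v) (pushVar u))
    (P := fun l d => store (I := I) [] [] x l (update (update S u d) v d)) (T := 2)
    (by simp) (by simp)
    (fun b a l d => by
      have h4 := exec_pushVar (I := I) [] [] x l (update (update S u d) v d) v b a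
      have h5 := exec_pushVar (I := I) [] [] x l (update (update S u d) v (a :: d)) u b a
      simp only [update_idem, update_self, update_of_ne huv] at h4 h5
      rw [update_comm huv.symm, update_idem] at h5
      simpa using Exec.seq h4 h5) s.1 none (S v).reverse []
  have h5 : update (update S u (S v)) v (S v) = update S u (S v) := by
    rw [update_comm huv]; simp
  simp [h5] at e3
  refine ⟨_, _, ?_, e1.seq (e2.seq e3)⟩
  omega

/-- Moving the first symbol of one variable to another. -/
theorem PolyTrans.move {u v : V} (huv : u ≠ v) : PolyTrans I fun S : V → List α =>
    update (update S u ((S v).head?.toList ++ S u)) v (S v).tail := by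
  refine ⟨.seq (.pop (.var v) fun s a => (s.1, a))
    (.ite (fun s => s.2.isSome) (pushVar u) (.load _root_.id)), 2, fun S => ?_⟩
  have h1 := envSize_update S u ((S v).head?.toList ++ S u)
  have h2 := envSize_update (update S u ((S v).head?.toList ++ S u)) v (S v).tail
  rw [update_of_ne huv.symm] at h2
  have h3 := Nat.pow_le_pow_left (Nat.le_add_left 2 (envSize S)) 2
  have h4 := Nat.le_self_pow two_ne_zero (envSize S + 2)
  beta_reduce
  cases hv : S v with
  | nil =>
    rw [hv] at h1 h2
    simp at h1 h2
    have h0 : update S v [] = S := by rw [← hv, update_eq_self]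
    simp only [List.head?_nil, Option.toList_none, List.nil_append, update_eq_self,
      List.tail_nil, h0]
    refine ⟨by omega, fun x s => ?_⟩
    have e1 := Exec.pop (k := .var v) (f := fun s a => (s.1, a)) (s := s)
      (S := store (I := I) [] [] x [] S)
    simp only [store_var, update_store_var, hv, List.tail_nil, h0, List.head?_nil] at e1
    exact ⟨_, 1 + (1 + 1), by omega, e1.seq (.ite_false rfl .load)⟩
  | cons a l =>
    rw [hv] at h1 h2
    simp at h1 h2
    refine ⟨by simp; omega, fun x s => ?_⟩
    have e1 := Exec.pop (k := .var v) (f := fun s a => (s.1, a)) (s := s)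
      (S := store (I := I) [] [] x [] S)
    have e2 := Exec.push (k := .var u) (f := fun s => s.2.getD default) (s := (s.1, some a))
      (S := store (I := I) [] [] x [] (update S v l))
    simp [hv, huv] at e1 e2
    rw [update_comm huv.symm] at e2
    exact ⟨_, 1 + (1 + 1), by omega, e1.seq (.ite_true rfl e2)⟩

/-- Iteration of `T` until `c` holds. -/
theorem exists_loop {c : (V → List α) → Bool} {T : (V → List α) → V → List α}
    (hc : PolyDec I c) (hT : PolyTrans I T) (Φ : (V → List α) → ℕ)
    (h1 : ∀ S, envSize S ≤ Φ S) {e : ℕ} (h2 : ∀ S, Φ S ≤ (envSize S + 2) ^ e)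
    (h3 : ∀ S, c S = false → Φ (T S) < Φ S) :
    ∃ (p : Prog V I α) (d : ℕ), ∀ S x s, ∃ S' s' t, t ≤ (envSize S + 2) ^ d ∧
      envSize S' ≤ (envSize S + 2) ^ d ∧ c S' = true ∧
      (∀ {β : Type} (R : (V → List α) → β), (∀ S, c S = false → R S = R (T S)) → R S = R S') ∧
      Exec p s (store [] [] x [] S) s' (store [] [] x [] S') t := by
  obtain ⟨pc, dc, hc⟩ := hc
  obtain ⟨pT, dT, hT⟩ := hT
  obtain ⟨d, hd⟩ : ∃ k, ∀ n, (n + 2) ^ e + ((n + 2) ^ dc + ((n + 2) ^ e *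
      ((((n + 2) ^ e + 2) ^ dT + ((n + 2) ^ e + 2) ^ dc) + 1) + 1)) ≤ (n + 2) ^ k := by
    have h1 : ∀ d, PolyBdd fun n => (n + 2) ^ d := (PolyBdd.id.add (.const 2)).pow
    have h2 : ∀ d, PolyBdd fun n => ((n + 2) ^ e + 2) ^ d := ((h1 e).add (.const 2)).pow
    exact (h1 e).add ((h1 dc).add (((h1 e).mul (((h2 dT).add (h2 dc)).add (.const 1))).add
      (.const 1)))
  refine ⟨.seq pc (.loop (fun s => !s.1) (.seq pT pc)), d, fun S x s => ?_⟩
  -- `M` and `n` both start as the initial potential. `M` stays fixed and bounds every environment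
  -- met, hence the cost of each iteration; `n` decreases and bounds their number.
  have key : ∀ M n S a, Φ S ≤ M → Φ S ≤ n → ∃ S' s' t,
      t ≤ n * (((M + 2) ^ dT + (M + 2) ^ dc) + 1) + 1 ∧
      envSize S' ≤ M ∧ c S' = true ∧
      (∀ {β : Type} (R : (V → List α) → β), (∀ S, c S = false → R S = R (T S)) → R S = R S') ∧
      Exec (.loop (fun s => !s.1) (.seq pT pc)) (c S, a) (store [] [] x [] S) s'
        (store [] [] x [] S') t := by
    intro M n
    induction n with
    | zero =>
      intro S a hM h0
      cases hcS : c S with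
      | true =>
        exact ⟨S, (true, a), 1, by simp, (h1 S).trans hM, hcS, fun R _ => rfl, .loop_end rfl⟩
      | false => have := h3 S hcS; omega
    | succ n ih =>
      intro S a hM hn
      cases hcS : c S with
      | true =>
        exact ⟨S, (true, a), 1, by simp, (h1 S).trans hM, hcS, fun R _ => rfl, .loop_end rfl⟩
      | false =>
        have h4 := h3 S hcS
        obtain ⟨s1, t1, ht1, hE1⟩ := (hT S).2 x (false, a)
        obtain ⟨a2, t2, ht2, hE2⟩ := hc (T S) x s1
        obtain ⟨S', s', t, ht, hS', hcS', hR, hE⟩ := ih (T S) a2 (by omega) (by omega)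
        refine ⟨S', s', _, ?_, hS', hcS', fun R hR' => (hR' S hcS).trans (hR R hR'),
          .loop_step rfl (hE1.seq hE2) hE⟩
        have h5 : (envSize S + 2) ^ dT ≤ (M + 2) ^ dT :=
          Nat.pow_le_pow_left (by have := h1 S; omega) _
        have h6 : (envSize (T S) + 2) ^ dc ≤ (M + 2) ^ dc :=
          Nat.pow_le_pow_left (by have := h1 (T S); omega) _
        nlinarith
  obtain ⟨a, t, ht, hE⟩ := hc S x s
  obtain ⟨S', s', t', ht', hS', hcS', hR, hE'⟩ := key _ _ S a le_rfl le_rfl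
  refine ⟨S', s', _, ?_, ?_, hcS', hR, hE.seq hE'⟩
  · have h4 := hd (envSize S)
    have h5 := h2 S
    have h6 : (Φ S + 2) ^ dT ≤ ((envSize S + 2) ^ e + 2) ^ dT := Nat.pow_le_pow_left (by omega) _
    have h7 : (Φ S + 2) ^ dc ≤ ((envSize S + 2) ^ e + 2) ^ dc := Nat.pow_le_pow_left (by omega) _
    have h8 := Nat.mul_le_mul h5 (Nat.add_le_add_right (Nat.add_le_add h6 h7) 1)
    omega
  · have h4 := hd (envSize S)
    have h5 := h2 S
    omega

/-- The loop equation makes `U` constant along the run. Taking `R := U` in `exists_loop` identifies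
the final environment with `U S`. -/
theorem PolyTrans.loop {c : (V → List α) → Bool} {T U : (V → List α) → V → List α}
    (hc : PolyDec I c) (hT : PolyTrans I T) (hU : ∀ S, U S = bif c S then S else U (T S))
    (Φ : (V → List α) → ℕ) (h1 : ∀ S, envSize S ≤ Φ S) {e : ℕ}
    (h2 : ∀ S, Φ S ≤ (envSize S + 2) ^ e) (h3 : ∀ S, c S = false → Φ (T S) < Φ S) :
    PolyTrans I U := by
  obtain ⟨p, d, h⟩ := exists_loop hc hT Φ h1 h2 h3
  have key : ∀ {S S'}, c S' = true →
      (∀ {β : Type} (R : (V → List α) → β), (∀ S, c S = false → R S = R (T S)) → R S = R S') →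
      U S = S' := by
    intro S S' hS' hR
    rw [hR U (fun S hS => by rw [hU S, hS]; rfl), hU S', hS']; rfl
  refine ⟨p, d, fun S => ⟨?_, fun x s => ?_⟩⟩
  · obtain ⟨S', s', t, _, h4, h5, h6, _⟩ := h S [] (false, none)
    rwa [key h5 h6]
  · obtain ⟨S', s', t, h4, _, h5, h6, hE⟩ := h S x s
    rw [key h5 h6]
    exact ⟨s', t, h4, hE⟩

/-- Here the invariant is the predicate `R` itself, evaluated at the end by `r`; the environment
consumed by the loop is restored afterwards. -/
theorem PolyDec.loop {c r R : (V → List α) → Bool} {T : (V → List α) → V → List α}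
    (hc : PolyDec I c) (hr : PolyDec I r) (hT : PolyTrans I T)
    (hR : ∀ S, R S = bif c S then r S else R (T S))
    (Φ : (V → List α) → ℕ) (h1 : ∀ S, envSize S ≤ Φ S) {e : ℕ}
    (h2 : ∀ S, Φ S ≤ (envSize S + 2) ^ e) (h3 : ∀ S, c S = false → Φ (T S) < Φ S) :
    PolyDec I R := by
  refine PolyDecOn.polyDec (W := Finset.univ) ?_
  obtain ⟨p, d, h⟩ := exists_loop hc hT Φ h1 h2 h3
  obtain ⟨pr, dr, hr⟩ := hr
  obtain ⟨d', hd'⟩ : ∃ k, ∀ n, (n + 2) ^ d + ((n + 2) ^ d + 2) ^ dr ≤ (n + 2) ^ k := by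
    have h1 : PolyBdd fun n => (n + 2) ^ d := (PolyBdd.id.add (.const 2)).pow d
    exact h1.add ((h1.add (.const 2)).pow dr)
  refine ⟨.seq p pr, d', fun S x s => ?_⟩
  obtain ⟨S', s', t, h4, h4', h5, h6, hE⟩ := h S x s
  obtain ⟨a, t', ht', hE'⟩ := hr S' x s'
  have h7 : R S = r S' := by
    rw [h6 R (fun S hS => by rw [hR S, hS]; rfl), hR S', h5]; rfl
  have h8 := hd' (envSize S)
  have h9 : (envSize S' + 2) ^ dr ≤ ((envSize S + 2) ^ d + 2) ^ dr :=
    Nat.pow_le_pow_left (by omega) _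
  rw [h7]
  exact ⟨a, S', _, by omega, by omega, by simp, hE.seq hE'⟩

/-! ### From programs to Turing machines -/

/-- The program that reads the input into `v`, decides and writes the answer. -/
def mainProg (ι : I → α) (v : V) (c : Prog V I α) : Prog V I α :=
  .seq (drain .inp (Option.map ι) pushTmp) (.seq (tmpToVar v) (.seq c
    (.seq (.push .out fun s => s.1) (.seq (clear v) (.load fun _ => (false, none))))))

/-- Reading through the scratch stack reverses the input twice. The final cleanup is needed because
the machine model requires halting with the initial register and with every stack but the output
empty. -/
theorem exists_exec_mainProg {P : (V → List α) → Bool} (hP : PolyDec I P) (ι : I → α) (v : V) :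
    ∃ (c : Prog V I α) (d : ℕ), ∀ w : List I, ∃ t ≤ (w.length + 2) ^ d,
      Exec c (false, none) (store w [] [] [] fun _ => []) (false, none)
        (store [] [P (update (fun _ => []) v (w.map ι))] [] [] fun _ => []) t := by
  obtain ⟨c, d, hP⟩ := hP
  obtain ⟨e, he⟩ : ∃ k, ∀ n, (3 * n + 2) + ((3 * n + 2) + ((n + 2) ^ d +
      (1 + ((3 * n + 2) + 1)))) ≤ (n + 2) ^ k := by
    have h1 : PolyBdd fun n => 3 * n + 2 := ((PolyBdd.const 3).mul .id).add (.const 2)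
    exact h1.add (h1.add (((PolyBdd.id.add (.const 2)).pow d).add ((PolyBdd.const 1).add
      (h1.add (.const 1)))))
  refine ⟨mainProg ι v c, e, fun w => ?_⟩
  have e1 := exec_drain (g := ι) (k := .inp) (conv := Option.map ι) (body := pushTmp)
    (P := fun l d => store (V := V) l [] [] (d.map ι) fun _ => [])
    (T := 1) (by simp) (by simp)
    (fun b a l d => by
      simpa using exec_pushTmp (I := I) l [] [] (d.map ι) (fun _ : V => []) b (ι a))
    false none w []
  simp at e1
  have e2 := exec_tmpToVar (I := I) [] [] [] (w.map ι).reverse (fun _ : V => []) v (false, none)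
  simp at e2
  set S : V → List α := update (fun _ => []) v (w.map ι) with hS
  have hsize : envSize S = w.length := by
    have := envSize_update (fun _ : V => ([] : List α)) v (w.map ι)
    simpa [envSize] using this
  obtain ⟨a, t, ht, e3⟩ := hP S [] (false, none)
  have e4 := Exec.push (k := .out) (f := fun s => s.1) (s := (P S, a))
    (S := store (I := I) [] [] [] [] S)
  simp at e4
  have e5 := exec_clear (I := I) [] [P S] [] [] S v (P S, a)
  have hS0 : update S v [] = fun _ => [] := by rw [hS]; simp
  rw [hS0] at e5
  have e6 := Exec.load (f := fun _ => (false, none)) (s := (P S, (none : Option α)))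
    (S := store (I := I) (α := α) [] [P S] [] [] fun _ : V => [])
  refine ⟨_, ?_, e1.seq (e2.seq (e3.seq (e4.seq (e5.seq e6))))⟩
  have h1 := he w.length
  have h2 : (S v).length = w.length := by simp [hS]
  rw [hsize] at ht
  omega

/-- The extra label `none` carries the halting statement and is the exit of the program; the step
spent there is the `+ 1` of the time bound. -/
theorem polyTime_of_exec [Fintype I] [Fintype α] {c : Prog V I α} {d : ℕ} {X : Type}
    {ea : X → List I} {f : X → Bool}
    (h : ∀ x, ∃ t ≤ ((ea x).length + 2) ^ d, Exec c (false, none)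
      (store (ea x) [] [] [] fun _ => []) (false, none) (store [] [f x] [] [] fun _ => []) t) :
    Nonempty (Turing.TM2ComputableInPolyTime ea Computability.encodeBool f) := by
  let := c.fintypeLabel
  let m : Option c.Label → Turing.TM2.Stmt (Stk.Alph (V := V) I α) (Option c.Label)
      (Bool × Option α)
    | none => .halt
    | some l => c.code some none l
  let tm : Turing.FinTM2 :=
    { K := Stk V
      k₀ := .inp
      k₁ := .out
      Γ := Stk.Alph I α
      Λ := Option c.Label
      main := some c.entry
      σ := Bool × Option α
      initialState := (false, none)
      Γk₀Fin := inferInstanceAs (Fintype I)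
      m := m }
  choose t ht hE using h
  refine ⟨{ tm := tm, inputAlphabet := Equiv.refl _, outputAlphabet := Equiv.refl _,
            time := (Polynomial.X + 2) ^ d + 1, outputsFun := fun x => ⟨⟨t x + 1, ?_⟩, ?_⟩ }⟩
  · have h1 := (hE x).runsIn m some none fun l => rfl
    have h2 := h1.trans (runsIn_one (m := m) (l := none))
    have h3 : Turing.initList tm (List.map (Equiv.refl I).invFun (ea x)) =
        ⟨some (some c.entry), (false, none), store (ea x) [] [] [] fun _ => []⟩ := by
      unfold Turing.initList
      congr 1
      funext k
      cases k <;> simp [tm, store]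
    have h4 : Turing.haltList tm (List.map (Equiv.refl Bool).invFun
        (Computability.encodeBool (f x))) =
        ⟨none, (false, none), store [] [f x] [] [] fun _ => []⟩ := by
      unfold Turing.haltList
      congr 1
      funext k
      cases k <;> simp [tm, store, Computability.encodeBool]
    rw [Option.map_some]
    erw [h3, h4]
    exact h2
  · simp only [Polynomial.eval_add, Polynomial.eval_pow, Polynomial.eval_X, Polynomial.eval_one,
      Polynomial.eval_ofNat]
    have := ht x
    omega

/-- A predicate that is decided in polynomial time on environments is decided in polynomial time
on strings. -/
theorem PolyDec.polyTime [Fintype I] [Fintype α] {P : (V → List α) → Bool} (hP : PolyDec I P)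
    (ι : I → α) (v : V) {X : Type} (ea : X → List I) :
    Nonempty (Turing.TM2ComputableInPolyTime ea Computability.encodeBool
      fun x => P (update (fun _ => []) v ((ea x).map ι))) := by
  obtain ⟨c, d, h⟩ := exists_exec_mainProg hP ι v
  exact polyTime_of_exec fun x => h (ea x)

end Programs

/-! ### String operations -/

section Strings

variable {α : Type}

/-- All ways to cut a string into two. -/
def cuts : List α → List (List α × List α)
  | [] => [([], [])]
  | a :: l => ([], a :: l) :: (cuts l).map fun x => (a :: x.1, x.2)

theorem mem_cuts {l u v : List α} : (u, v) ∈ cuts l ↔ u ++ v = l := by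
  induction l generalizing u with
  | nil => simp [cuts]
  | cons a l ih =>
    simp only [cuts, List.mem_cons, Prod.mk.injEq, List.mem_map, Prod.exists]
    constructor
    · rintro (⟨rfl, rfl⟩ | ⟨u', v', h, rfl, rfl⟩)
      · rfl
      · simp [ih.1 h]
    · intro h
      cases u with
      | nil => exact .inl ⟨rfl, h⟩
      | cons b u =>
        simp only [List.cons_append, List.cons.injEq] at h
        exact .inr ⟨u, v, ih.2 h.2, by rw [h.1], rfl⟩

variable [DecidableEq α]

/-- The part of a string before the first `c`. -/
def before (c : α) (l : List α) : List α := l.takeWhile (· ≠ c)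

/-- The part of a string after the first `c`. -/
def after (c : α) (l : List α) : List α := (l.dropWhile (· ≠ c)).tail

theorem length_after_lt (c : α) {l : List α} (hl : l ≠ []) : (after c l).length < l.length := by
  unfold after
  rw [List.length_tail]
  have := (List.dropWhile_suffix (l := l) (· ≠ c)).length_le
  have := List.length_pos_of_ne_nil hl
  omega

/-- The pieces of a string in which each piece is followed by `c`. -/
def pieces (c : α) (l : List α) : List (List α) :=
  if _h : l = [] then [] else before c l :: pieces c (after c l)
termination_by l.length
decreasing_by exact length_after_lt c (by assumption)

theorem pieces_nil (c : α) : pieces c [] = [] := by rw [pieces]; simp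

theorem pieces_of_ne_nil (c : α) {l : List α} (hl : l ≠ []) :
    pieces c l = before c l :: pieces c (after c l) := by rw [pieces]; simp [hl]

end Strings

/-! ### Polynomial-time string operations and searches -/

section StringPrograms

variable {V I α : Type} [DecidableEq V] [Fintype V] [Inhabited α]

/-- Restore a variable after a transformation. -/
theorem PolyTrans.restore {T : (V → List α) → V → List α} (hT : PolyTrans I T) (v : V) :
    PolyTrans I fun S => update (T S) v (S v) := by
  obtain ⟨c, d, hT⟩ := hT
  obtain ⟨e, he⟩ : ∃ k, ∀ n, (n + 2) ^ d + n + (7 * n + 5 + ((n + 2) ^ d +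
      (3 * (n + 2) ^ d + 6 * n + 6))) ≤ (n + 2) ^ k := by
    have h1 : PolyBdd fun n => (n + 2) ^ d := (PolyBdd.id.add (.const 2)).pow d
    exact (h1.add .id).add ((((PolyBdd.const 7).mul .id).add (.const 5)).add
      (h1.add ((((PolyBdd.const 3).mul h1).add ((PolyBdd.const 6).mul .id)).add (.const 6))))
  refine ⟨.seq (saveVar v) (.seq c (restoreVar v)), e, fun S => ?_⟩
  have h3 := he (envSize S)
  have h4 := length_le_envSize S v
  have h5 := length_le_envSize (T S) v
  have h6 := envSize_update (T S) v (S v)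
  have h7 := (hT S).1
  refine ⟨by beta_reduce; omega, fun x s => ?_⟩
  obtain ⟨s', t, ht, hE⟩ := (hT S).2 ((S v).map some ++ none :: x) (s.1, none)
  have h1 := exec_saveVar (I := I) [] [] x S v s
  have h2 := exec_restoreVar (I := I) [] [] x (T S) v (S v) s'
  exact ⟨_, _, by omega, h1.seq (hE.seq h2)⟩

variable (I) in
/-- `f` can be assigned to any variable in polynomial time. -/
def PolyFun (f : (V → List α) → List α) : Prop := ∀ u, PolyTrans I fun S => update S u (f S)

variable (I V) in
/-- `h` can be applied to any variable in polynomial time. -/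
def PolyMap (h : List α → List α) : Prop :=
  ∀ u : V, PolyTrans I fun S : V → List α => update S u (h (S u))

theorem PolyFun.var (v : V) : PolyFun I fun S : V → List α => S v := by
  intro u
  by_cases h : u = v
  · subst h
    simpa using PolyTrans.id
  · exact .copy h

theorem PolyFun.map {f : (V → List α) → List α} {h : List α → List α} (hh : PolyMap V I h)
    (hf : PolyFun I f) : PolyFun I fun S => h (f S) := by
  intro u
  simpa using (hh u).comp (hf u)

theorem PolyMap.tail : PolyMap V I (List.tail (α := α)) := fun u => .tail u

theorem PolyFun.tail (v : V) : PolyFun I fun S : V → List α => (S v).tail :=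
  PolyFun.map PolyMap.tail (.var v)

theorem PolyDec.subst {P : (V → List α) → Bool} {f : (V → List α) → List α} (hP : PolyDec I P)
    (u : V) (hf : PolyFun I f) : PolyDec I fun S => P (update S u (f S)) := hP.comp (hf u)

theorem add_le_pow_two (n : ℕ) : n + n ≤ (n + 2) ^ 2 := by
  nlinarith

/-- Move symbols satisfying `p` from the front of `v` to `u`. -/
theorem PolyTrans.moveWhile (p : α → Bool) {u v : V} (huv : u ≠ v) :
    PolyTrans I fun S : V → List α =>
      update (update S u (((S v).takeWhile p).reverse ++ S u)) v ((S v).dropWhile p) := by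
  -- Moving a symbol does not change the total length, so the potential counts the source `v` a
  -- second time.
  refine PolyTrans.loop (PolyDec.head v fun o => !(o.map p).getD false) (.move huv) ?_
    (fun S => envSize S + (S v).length) (fun S => Nat.le_add_right _ _) (e := 2) ?_ ?_
  · intro S
    cases hv : S v with
    | nil =>
      have h0 : update S v [] = S := by rw [← hv, update_eq_self]
      simp [h0]
    | cons a l =>
      cases hp : p a with
      | true =>
        simp only [List.takeWhile_cons, hp, if_true, List.reverse_cons, List.dropWhile_cons,
          List.head?_cons, Option.map_some, Option.getD_some, Bool.not_true, cond_false,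
          Option.toList_some, List.tail_cons, update_self, update_of_ne huv, List.append_assoc]
        rw [update_comm huv, update_comm huv, update_idem, update_comm huv, update_idem]
      | false =>
        have h0 : update S v (a :: l) = S := by rw [← hv, update_eq_self]
        simp [hp, h0]
  · intro S
    have := length_le_envSize S v
    exact (Nat.add_le_add_left this _).trans (add_le_pow_two _)
  · intro S hS
    cases hv : S v with
    | nil => simp [hv] at hS
    | cons a l =>
      have h1 := envSize_update S u ((S v).head?.toList ++ S u)
      have h2 := envSize_update (update S u ((S v).head?.toList ++ S u)) v (S v).tail
      simp only [update_of_ne huv.symm, hv, List.head?_cons, Option.toList_some, List.tail_cons,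
        List.length_append, List.length_cons, List.length_nil] at h1 h2
      simp only [update_self, List.head?_cons, Option.toList_some, List.tail_cons,
        List.length_cons]
      omega

variable [Nontrivial V]

/-- An auxiliary variable is emptied, receives the symbols of `u` in reverse order, is copied back
and is then restored. -/
theorem PolyMap.reverse : PolyMap V I (List.reverse (α := α)) := by
  intro u
  obtain ⟨a, ha⟩ := exists_ne u
  have h := ((((PolyTrans.copy (α := α) (I := I) ha.symm).comp
    (.moveWhile (fun _ => true) ha)).comp (.nil a)).restore a)
  convert h using 2 with S
  have h1 : ∀ l : List α, l.takeWhile (fun _ => true) = l := fun l => by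
    induction l <;> simp_all
  funext k
  by_cases hk : k = a
  · subst hk; simp [ha]
  · by_cases hk' : k = u
    · subst hk'; simp [ha, hk, h1]
    · simp [hk, hk']

theorem PolyMap.takeWhile (p : α → Bool) : PolyMap V I (List.takeWhile p) := by
  intro u
  obtain ⟨a, ha⟩ := exists_ne u
  have h := ((PolyMap.reverse (I := I) u).comp
    (((PolyTrans.copy (α := α) (I := I) ha.symm).comp
    (.moveWhile p ha)).comp (.nil a))).restore a
  convert h using 2 with S
  funext k
  by_cases hk : k = a
  · subst hk; simp [ha]
  · by_cases hk' : k = u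
    · subst hk'; simp [ha, hk]
    · simp [hk, hk']

/-- The prefix is moved to an auxiliary variable, whose restoration discards it. -/
theorem PolyMap.dropWhile (p : α → Bool) : PolyMap V I (List.dropWhile p) := by
  intro u
  obtain ⟨a, ha⟩ := exists_ne u
  have h := ((PolyTrans.moveWhile (I := I) p ha).restore a)
  convert h using 2 with S
  funext k
  by_cases hk : k = a
  · subst hk; simp [ha]
  · by_cases hk' : k = u
    · subst hk'; simp [hk]
    · simp [hk, hk']

variable [DecidableEq α]

theorem PolyMap.before (c : α) : PolyMap V I (before c) := PolyMap.takeWhile _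

theorem PolyMap.after (c : α) : PolyMap V I (after c) := by
  intro u
  simpa [DeonticE.after] using (PolyTrans.tail u).comp (PolyMap.dropWhile (I := I) (· ≠ c) u)

/-- Search through the pieces of the variable `k`. -/
theorem PolyDec.anyPieces {P : (V → List α) → Bool} (hP : PolyDec I P) (c : α) {j k : V}
    (hk : ∀ S l, P (update S k l) = P S) (hjk : j ≠ k) :
    PolyDec I fun S => (pieces c (S k)).any fun x => P (update S j x) := by
  refine PolyDec.loop
    (c := fun S => (S k).head?.isNone || P (update S j (DeonticE.before c (S k))))
    -- The loop stops at the end of the string or at a hit, so a nonempty remainder signals a hit.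
    (r := fun S => (S k).head?.isSome)
    ((PolyDec.head k _).or (hP.subst j (.map (PolyMap.before c) (.var k)))) (.head k _)
    ((PolyMap.after c) k) ?_ envSize (fun S => le_rfl) (e := 1) (fun S => by simp) ?_
  · intro S
    by_cases h : S k = []
    · simp [h, pieces_nil]
    · rw [pieces_of_ne_nil c h, List.any_cons]
      have h1 : (S k).head?.isNone = false := by simpa using h
      have h2 : (S k).head?.isSome = true := by simpa using h
      have h3 : ∀ l x, P (update (update S k l) j x) = P (update S j x) := fun l x => by
        rw [update_comm hjk.symm, hk]
      simp only [h1, h2, Bool.false_or, update_self, h3]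
      cases P (update S j (DeonticE.before c (S k))) <;> simp
  · intro S hS
    simp only [Bool.or_eq_false_iff, Option.isNone_eq_false_iff] at hS
    have h1 := envSize_update S k (DeonticE.after c (S k))
    have h2 := length_after_lt c (l := S k) (by rintro h; simp [h] at hS)
    omega

/-- Search through the cuts of the variable `k`; the variable `k'` is used as a loop variable. -/
theorem PolyDec.anyCuts {P : (V → List α) → Bool} (hP : PolyDec I P) {i j k k' : V}
    (hk : ∀ S l, P (update S k l) = P S) (hk' : ∀ S l, P (update S k' l) = P S)
    (hkk' : k' ≠ k) (hi : i ≠ k) (hi' : i ≠ k') (hj : j ≠ k) (hj' : j ≠ k') :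
    PolyDec I fun S => (cuts (S k)).any fun x => P (update (update S i x.1) j x.2) := by
  -- Generalized for the loop: `k'` holds the part of the string already passed, in reverse, so the
  -- current cut is `(S k').reverse` and `S k`. The result follows by starting with `k'` empty.
  have h0 : PolyDec I fun S => (cuts (S k)).any fun x =>
      P (update (update S i ((S k').reverse ++ x.1)) j x.2) := by
    have hQ : PolyDec I fun S => P (update (update S i (S k').reverse) j (S k)) := by
      have := (hP.subst j (.var k)).subst i (.map PolyMap.reverse (.var k'))
      simpa [hi.symm] using this
    refine PolyDec.loop (c := fun S => (S k).head?.isNone ||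
        P (update (update S i (S k').reverse) j (S k)))
      ((PolyDec.head k _).or hQ) hQ (.move hkk') ?_
      (fun S => envSize S + (S k).length) (fun S => Nat.le_add_right _ _) (e := 2) ?_ ?_
    · intro S
      have h3 : ∀ l l' x y, P (update (update (update (update S k' l) k l') i x) j y) =
          P (update (update S i x) j y) := fun l l' x y => by
        rw [update_comm hi.symm, update_comm hj.symm, hk, update_comm hi'.symm,
          update_comm hj'.symm, hk']
      cases h : S k with
      | nil => simp [cuts]
      | cons a l =>
        simp only [cuts, List.any_cons, List.any_map, List.append_nil, List.head?_cons,
          Option.isNone_some, Bool.false_or, Option.toList_some, List.tail_cons, update_self,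
          update_of_ne hkk', List.cons_append, List.reverse_cons, List.nil_append, h3,
          List.append_assoc, comp_def]
        cases P (update (update S i (S k').reverse) j (a :: l)) <;> simp
    · intro S
      have := length_le_envSize S k
      exact (Nat.add_le_add_left this _).trans (add_le_pow_two _)
    · intro S hS
      cases hv : S k with
      | nil => simp [hv] at hS
      | cons a l =>
        have h1 := envSize_update S k' ((S k).head?.toList ++ S k')
        have h2 := envSize_update (update S k' ((S k).head?.toList ++ S k')) k (S k).tail
        simp only [update_of_ne hkk'.symm, hv, List.head?_cons, Option.toList_some, List.tail_cons,
          List.length_append, List.length_cons, List.length_nil] at h1 h2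
        simp only [update_self, List.head?_cons, Option.toList_some, List.tail_cons,
          List.length_cons]
        omega
  have h1 := h0.comp (.nil k')
  convert h1 using 4 with S x
  · simp [hkk'.symm]
  · simp only [update_self, List.reverse_nil, List.nil_append]
    rw [update_comm hi'.symm, update_comm hj'.symm, hk']

theorem PolyDec.anyList {β : Type} (L : List β) {P : β → (V → List α) → Bool}
    (hP : ∀ b, PolyDec I (P b)) : PolyDec I fun S => L.any fun b => P b S := by
  induction L with
  | nil => simpa using PolyDec.const false
  | cons b L ih => simpa using (hP b).or ih

/-- Equality of two variables. -/
theorem PolyDec.eq [Fintype α] {u v : V} (huv : u ≠ v) :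
    PolyDec I fun S : V → List α => decide (S u = S v) := by
  have hc : PolyDec I fun S : V → List α =>
      !((Finset.univ : Finset α).toList.any fun a =>
        decide ((S u).head? = some a) && decide ((S v).head? = some a)) :=
    (PolyDec.anyList _ fun a => (PolyDec.head u fun o => decide (o = some a)).and
      (.head v fun o => decide (o = some a))).not
  refine PolyDec.loop (r := fun S => (S u).head?.isNone && (S v).head?.isNone) hc
    ((PolyDec.head u _).and (.head v _)) ((PolyTrans.tail u).comp (.tail v)) ?_ envSize
    (fun S => le_rfl) (e := 1) (fun S => by simp) ?_
  · intro S
    cases hu : S u with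
    | nil => cases hv : S v <;> simp
    | cons a l =>
      cases hv : S v with
      | nil => simp
      | cons b m =>
        by_cases hab : a = b
        · subst hab
          simp [huv, huv.symm, hu]
        · simp [hab, Ne.symm hab]
  · intro S hS
    have h1 := envSize_update S v (S v).tail
    have h2 := envSize_update (update S v (S v).tail) u (S u).tail
    simp only [update_of_ne huv, List.length_tail] at h1 h2 ⊢
    have h3 : S u ≠ [] := by
      rintro h
      simp [h] at hS
    have := List.length_pos_of_ne_nil h3
    omega

end StringPrograms

/-! ### Strings of formulas -/

/-- Whether a symbol is a binary digit. -/
def Sym.isBit : Sym → Bool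
  | .bit _ => true
  | _ => false

/-- Whether a string starts with a binary digit. -/
def startsBit (o : Option Sym) : Bool := (o.map Sym.isBit).getD false

/-- Whether the symbol `s` may be followed by `o` in a formula. -/
def mayPrecede (s : Sym) (o : Option Sym) : Bool :=
  match s with
  | .var | .bit true => true
  | .bit false => startsBit o
  | _ => !startsBit o

/-- Whether a string consists of `n` formulas in prefix notation, possibly preceded by digits. -/
def isForms : ℕ → List Sym → Bool
  | n, [] => n == 0
  | n, s :: a => mayPrecede s a.head? &&
    match s with
    | .bit _ => isForms n a
    | .var => n != 0 && isForms (n - 1) a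
    | .neg | .box | .bet => n != 0 && isForms n a
    | .imp | .obl => n != 0 && isForms (n + 1) a
    | _ => false

/-- Whether a string is a formula. -/
def isForm (x : List Sym) : Bool := !startsBit x.head? && isForms 1 x

theorem Nat.eq_or_bit (p : ℕ) :
    p = 0 ∨ (∃ q, q ≠ 0 ∧ q < p ∧ p = 2 * q) ∨ ∃ q, q < p ∧ p = 2 * q + 1 := by
  rcases Nat.even_or_odd' p with ⟨q, rfl | rfl⟩
  · rcases Nat.eq_zero_or_pos q with rfl | h
    · exact .inl rfl
    · exact .inr (.inl ⟨q, by omega, by omega, rfl⟩)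
  · exact .inr (.inr ⟨q, by omega, rfl⟩)

theorem Nat.bits_ne_nil {p : ℕ} (hp : p ≠ 0) : p.bits ≠ [] := by
  rcases Nat.eq_or_bit p with rfl | ⟨q, hq, _, rfl⟩ | ⟨q, _, rfl⟩
  · exact absurd rfl hp
  · simp [Nat.bit0_bits q hq]
  · simp [Nat.bit1_bits]

theorem Nat.bits_inj {p q : ℕ} (h : p.bits = q.bits) : p = q := by
  induction p using Nat.strong_induction_on generalizing q with
  | _ p ih =>
    rcases Nat.eq_or_bit p with rfl | ⟨p, hp, hlt, rfl⟩ | ⟨p, hlt, rfl⟩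
    · by_contra hq
      exact Nat.bits_ne_nil (Ne.symm hq) (by simpa using h.symm)
    · rcases Nat.eq_or_bit q with rfl | ⟨q, hq, _, rfl⟩ | ⟨q, _, rfl⟩
      · simp [Nat.bit0_bits p hp] at h
      · simp only [Nat.bit0_bits p hp, Nat.bit0_bits q hq, List.cons.injEq, true_and] at h
        rw [ih p hlt h]
      · simp [Nat.bit0_bits p hp, Nat.bit1_bits] at h
    · rcases Nat.eq_or_bit q with rfl | ⟨q, hq, _, rfl⟩ | ⟨q, _, rfl⟩
      · simp [Nat.bit1_bits] at h
      · simp [Nat.bit0_bits q hq, Nat.bit1_bits] at h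
      · simp only [Nat.bit1_bits, List.cons.injEq, true_and] at h
        rw [ih p hlt h]

theorem isForms_bits (n p : ℕ) (r : List Sym) :
    isForms n (p.bits.map Sym.bit ++ r) = isForms n r := by
  induction p using Nat.strong_induction_on with
  | _ p ih =>
    rcases Nat.eq_or_bit p with rfl | ⟨p, hp, hlt, rfl⟩ | ⟨p, hlt, rfl⟩
    · simp
    · rw [Nat.bit0_bits p hp]
      obtain ⟨b, l, hl⟩ := List.exists_cons_of_ne_nil (Nat.bits_ne_nil hp)
      have := ih p hlt
      rw [hl] at this ⊢
      simp only [List.map_cons, List.cons_append] at this ⊢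
      rw [isForms]
      simpa [mayPrecede, startsBit, Sym.isBit] using this
    · rw [Nat.bit1_bits]
      simp only [List.map_cons, List.cons_append]
      rw [isForms]
      simpa [mayPrecede] using ih p hlt

theorem BForm.startsBit_encode_append (A : BForm) (r : List Sym) :
    startsBit (A.encode ++ r).head? = false := by
  cases A <;> simp [encode, startsBit, Sym.isBit]

/-- In prefix notation, reading one formula lowers the counter of expected formulas by one. The
remainder must not start with a digit, which a variable ending the formula would absorb. -/
theorem isForms_encode_append (A : BForm) : ∀ (n : ℕ) {r : List Sym},
    startsBit r.head? = false → isForms (n + 1) (A.encode ++ r) = isForms n r := by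
  induction A with
  | var p =>
    intro n r hr
    simp [BForm.encode, isForms, mayPrecede, isForms_bits n p r]
  | neg A ih | box A ih | bet A ih =>
    intro n r hr
    simp [BForm.encode, isForms, mayPrecede, ih n hr, -List.head?_append,
      A.startsBit_encode_append]
  | imp A B ihA ihB | obl A B ihA ihB =>
    intro n r hr
    have h1 := B.startsBit_encode_append r
    simp [BForm.encode, isForms, mayPrecede, ihA (n + 1) h1, ihB n hr, -List.head?_append,
      A.startsBit_encode_append]

theorem isForm_encode (A : BForm) : isForm A.encode = true := by
  have h1 := isForms_encode_append A 0 (r := []) rfl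
  have h2 := A.startsBit_encode_append []
  rw [List.append_nil] at h1 h2
  simp [isForm, h1, h2, isForms]

/-- Digits are written least significant first, and `mayPrecede` demands another digit after a zero.
So the most significant digit is one, and an accepted run of digits is the numeral of a number, the
empty run standing for 0. -/
theorem exists_bits_of_isForms {n : ℕ} {a : List Sym} (h : isForms n a = true) :
    ∃ (p : ℕ) (r : List Sym), a = p.bits.map Sym.bit ++ r ∧ startsBit r.head? = false ∧
      isForms n r = true := by
  induction a with
  | nil => exact ⟨0, [], by simp, rfl, h⟩
  | cons s a ih =>
    by_cases hs : s.isBit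
    · cases s <;> try exact absurd hs (by decide)
      rename_i b
      simp only [isForms, Bool.and_eq_true] at h
      obtain ⟨p, r, rfl, hr, hn⟩ := ih h.2
      cases b with
      | true => exact ⟨2 * p + 1, r, by simp [Nat.bit1_bits], hr, hn⟩
      | false =>
        have hp : p ≠ 0 := by
          rintro rfl
          simp [mayPrecede, hr] at h
        exact ⟨2 * p, r, by simp [Nat.bit0_bits p hp], hr, hn⟩
    · exact ⟨0, s :: a, by simp, by simpa [startsBit] using hs, h⟩

/-- Induction on the length rather than on the string, since a variable consumes its whole numeral
at once. -/
theorem exists_forms_of_isForms {n : ℕ} {a : List Sym} (h : isForms n a = true)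
    (ha : startsBit a.head? = false) :
    ∃ As : List BForm, As.length = n ∧ a = As.flatMap BForm.encode := by
  induction hl : a.length using Nat.strong_induction_on generalizing n a with
  | _ m ih =>
    subst hl
    cases a with
    | nil => exact ⟨[], by simp only [isForms, beq_iff_eq] at h; simp [h], rfl⟩
    | cons s a =>
      have unary : ∀ {k : ℕ}, startsBit a.head? = false → isForms (k + 1) a = true →
          ∃ (A : BForm) (As : List BForm), As.length = k ∧
            a = BForm.encode A ++ As.flatMap BForm.encode := by
        intro k h1 h2
        obtain ⟨As, hAs, h3⟩ := ih a.length (by simp) h2 h1 rfl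
        cases As with
        | nil => simp at hAs
        | cons A As => exact ⟨A, As, by simpa using hAs, by simpa using h3⟩
      have binary : ∀ {k : ℕ}, startsBit a.head? = false → isForms (k + 2) a = true →
          ∃ (A B : BForm) (As : List BForm), As.length = k ∧
            a = BForm.encode A ++ (BForm.encode B ++ As.flatMap BForm.encode) := by
        intro k h1 h2
        obtain ⟨As, hAs, h3⟩ := ih a.length (by simp) h2 h1 rfl
        match As, hAs, h3 with
        | A :: B :: As, hAs, h3 => exact ⟨A, B, As, by simpa using hAs, by simpa using h3⟩
      cases s with
      | var =>
        simp only [isForms, Bool.and_eq_true, bne_iff_ne] at h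
        obtain ⟨k, rfl⟩ := Nat.exists_eq_succ_of_ne_zero h.2.1
        obtain ⟨p, r, rfl, hr, hn⟩ := exists_bits_of_isForms h.2.2
        obtain ⟨As, hAs, rfl⟩ := ih r.length (by simp) hn hr rfl
        exact ⟨.var p :: As, by simpa using hAs, by simp [BForm.encode]⟩
      | neg =>
        simp only [isForms, mayPrecede, Bool.and_eq_true, bne_iff_ne, Bool.not_eq_true'] at h
        obtain ⟨k, rfl⟩ := Nat.exists_eq_succ_of_ne_zero h.2.1
        obtain ⟨A, As, hAs, rfl⟩ := unary h.1 h.2.2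
        exact ⟨.neg A :: As, by simpa using hAs, by simp [BForm.encode]⟩
      | box =>
        simp only [isForms, mayPrecede, Bool.and_eq_true, bne_iff_ne, Bool.not_eq_true'] at h
        obtain ⟨k, rfl⟩ := Nat.exists_eq_succ_of_ne_zero h.2.1
        obtain ⟨A, As, hAs, rfl⟩ := unary h.1 h.2.2
        exact ⟨.box A :: As, by simpa using hAs, by simp [BForm.encode]⟩
      | bet =>
        simp only [isForms, mayPrecede, Bool.and_eq_true, bne_iff_ne, Bool.not_eq_true'] at h
        obtain ⟨k, rfl⟩ := Nat.exists_eq_succ_of_ne_zero h.2.1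
        obtain ⟨A, As, hAs, rfl⟩ := unary h.1 h.2.2
        exact ⟨.bet A :: As, by simpa using hAs, by simp [BForm.encode]⟩
      | imp =>
        simp only [isForms, mayPrecede, Bool.and_eq_true, bne_iff_ne, Bool.not_eq_true'] at h
        obtain ⟨k, rfl⟩ := Nat.exists_eq_succ_of_ne_zero h.2.1
        obtain ⟨A, B, As, hAs, rfl⟩ := binary h.1 h.2.2
        exact ⟨.imp A B :: As, by simpa using hAs, by simp [BForm.encode]⟩
      | obl =>
        simp only [isForms, mayPrecede, Bool.and_eq_true, bne_iff_ne, Bool.not_eq_true'] at h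
        obtain ⟨k, rfl⟩ := Nat.exists_eq_succ_of_ne_zero h.2.1
        obtain ⟨A, B, As, hAs, rfl⟩ := binary h.1 h.2.2
        exact ⟨.obl A B :: As, by simpa using hAs, by simp [BForm.encode]⟩
      | bit b => simp [startsBit, Sym.isBit] at ha
      | comma | arrow | bar => simp [isForms] at h

theorem isForm_iff {x : List Sym} : isForm x = true ↔ ∃ A : BForm, x = A.encode := by
  constructor
  · intro h
    simp only [isForm, Bool.and_eq_true, Bool.not_eq_true'] at h
    obtain ⟨As, hAs, rfl⟩ := exists_forms_of_isForms h.2 h.1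
    obtain ⟨A, rfl⟩ := List.length_eq_one_iff.1 hAs
    exact ⟨A, by simp⟩
  · rintro ⟨A, rfl⟩
    exact isForm_encode A

/-- Unique readability: the first symbol fixes the connective, and the index of a variable is the
maximal run of digits, as the remainders start with none. -/
theorem BForm.encode_append_inj {A : BForm} : ∀ {B : BForm} {r r' : List Sym},
    startsBit r.head? = false → startsBit r'.head? = false →
    A.encode ++ r = B.encode ++ r' → A = B ∧ r = r' := by
  induction A with
  | var p =>
    intro B r r' hr hr' h
    cases B <;> simp only [encode, List.cons_append, List.cons.injEq, reduceCtorEq, false_and,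
      true_and] at h
    rename_i q
    have key : ∀ (p : List Bool) {r : List Sym}, startsBit r.head? = false →
        (p.map Sym.bit ++ r).takeWhile Sym.isBit = p.map Sym.bit := by
      intro p r hr
      rw [List.takeWhile_append_of_pos (fun a ha => by
        obtain ⟨b, _, rfl⟩ := List.mem_map.1 ha; rfl)]
      cases r with
      | nil => simp
      | cons s r =>
        have : s.isBit = false := by simpa [startsBit] using hr
        simp [this]
    have h1 := congrArg (List.takeWhile Sym.isBit) h
    rw [key _ hr, key _ hr'] at h1
    rw [h1] at h
    have h2 : p.bits = q.bits :=
      List.map_injective_iff.2 (fun a b h => by simpa using h) h1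
    exact ⟨by rw [Nat.bits_inj h2], List.append_cancel_left h⟩
  | neg A ih | box A ih | bet A ih =>
    intro B r r' hr hr' h
    cases B <;> simp only [encode, List.cons_append, List.cons.injEq, reduceCtorEq, false_and,
      true_and] at h
    obtain ⟨rfl, rfl⟩ := ih hr hr' h
    exact ⟨rfl, rfl⟩
  | imp A A' ihA ihB | obl A A' ihA ihB =>
    intro B r r' hr hr' h
    cases B <;> simp only [encode, List.cons_append, List.cons.injEq, reduceCtorEq, false_and,
      true_and, List.append_assoc] at h
    obtain ⟨rfl, h2⟩ := ihA (startsBit_encode_append _ _) (startsBit_encode_append _ _) h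
    obtain ⟨rfl, rfl⟩ := ihB hr hr' h2
    exact ⟨rfl, rfl⟩

theorem BForm.encode_inj {A B : BForm} (h : A.encode = B.encode) : A = B :=
  (encode_append_inj (r := []) (r' := []) rfl rfl (by simpa using h)).1

theorem BForm.cut_encode_iff {A B C D : BForm} :
    C.encode ++ D.encode = A.encode ++ B.encode ↔ C = A ∧ D = B := by
  constructor
  · intro h
    have h1 := D.startsBit_encode_append []
    have h2 := B.startsBit_encode_append []
    rw [List.append_nil] at h1 h2
    obtain ⟨rfl, h3⟩ := encode_append_inj h1 h2 h
    exact ⟨rfl, encode_inj h3⟩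
  · rintro ⟨rfl, rfl⟩; rfl

theorem BForm.not_mem_encode (A : BForm) {s : Sym} (hs : s = .comma ∨ s = .arrow ∨ s = .bar) :
    s ∉ A.encode := by
  induction A with
  | var p => rcases hs with rfl | rfl | rfl <;> simp [encode]
  | neg A ih | box A ih | bet A ih => rcases hs with rfl | rfl | rfl <;> simp [encode, ih]
  | imp A B ih ih' | obl A B ih ih' =>
    rcases hs with rfl | rfl | rfl <;> simp [encode, ih, ih']

/-- The formulas of `L` are those without `Bet`. -/
theorem exists_form_iff {x : List Sym} :
    (∃ A : Form, A.encode = x) ↔ isForm x = true ∧ Sym.bet ∉ x := by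
  rw [isForm_iff]
  constructor
  · rintro ⟨A, rfl⟩
    refine ⟨⟨A.toB, rfl⟩, ?_⟩
    unfold Form.encode
    induction A <;> simp_all [Form.toB, BForm.encode]
  · rintro ⟨⟨A, rfl⟩, h⟩
    induction A with
    | var p => exact ⟨.var p, rfl⟩
    | neg A ih =>
      simp only [BForm.encode, List.mem_cons, not_or] at h
      obtain ⟨B, hB⟩ := ih h.2
      exact ⟨.neg B, by simp only [Form.encode, Form.toB, BForm.encode] at hB ⊢; rw [hB]⟩
    | box A ih =>
      simp only [BForm.encode, List.mem_cons, not_or] at h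
      obtain ⟨B, hB⟩ := ih h.2
      exact ⟨.box B, by simp only [Form.encode, Form.toB, BForm.encode] at hB ⊢; rw [hB]⟩
    | bet A ih => simp [BForm.encode] at h
    | imp A A' ih ih' =>
      simp only [BForm.encode, List.mem_cons, List.mem_append, not_or] at h
      obtain ⟨B, hB⟩ := ih h.2.1
      obtain ⟨C, hC⟩ := ih' h.2.2
      exact ⟨.imp B C, by simp only [Form.encode, Form.toB, BForm.encode] at hB hC ⊢; rw [hB, hC]⟩
    | obl A A' ih ih' =>
      simp only [BForm.encode, List.mem_cons, List.mem_append, not_or] at h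
      obtain ⟨B, hB⟩ := ih h.2.1
      obtain ⟨C, hC⟩ := ih' h.2.2
      exact ⟨.obl B C, by simp only [Form.encode, Form.toB, BForm.encode] at hB hC ⊢; rw [hB, hC]⟩

/-! ### Strings of hypersequents -/

section Pieces

variable {α : Type} [DecidableEq α]

theorem before_append {c : α} {x : List α} (hx : c ∉ x) (r : List α) :
    before c (x ++ c :: r) = x := by
  unfold before
  rw [List.takeWhile_append_of_pos (p := fun x => decide (x ≠ c))
    fun a ha => decide_eq_true fun h : a = c => hx (h ▸ ha)]
  simp

theorem after_append {c : α} {x : List α} (hx : c ∉ x) (r : List α) :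
    after c (x ++ c :: r) = r := by
  unfold after
  rw [List.dropWhile_append_of_pos (p := fun x => decide (x ≠ c))
    fun a ha => decide_eq_true fun h : a = c => hx (h ▸ ha)]
  simp

theorem before_append_after {c : α} {l : List α} (h : c ∈ l) :
    before c l ++ c :: after c l = l := by
  obtain ⟨x, r, rfl, hx⟩ := List.eq_append_cons_of_mem h
  rw [before_append hx, after_append hx]

theorem pieces_flatMap {c : α} {xs : List (List α)} (h : ∀ x ∈ xs, c ∉ x) :
    pieces c (xs.flatMap fun x => x ++ [c]) = xs := by
  induction xs with
  | nil => exact pieces_nil c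
  | cons x xs ih =>
    rw [List.forall_mem_cons] at h
    rw [List.flatMap_cons, List.append_assoc, List.singleton_append,
      pieces_of_ne_nil c (by simp), before_append h.1, after_append h.1, ih h.2]

/-- Whether a string is empty or ends with `c`. -/
def terminated (c : α) (l : List α) : Bool := decide (l.reverse.head?.getD c = c)

/-- An unterminated tail would also count as a piece, and reassembly would add a separator;
`terminated` excludes this. -/
theorem flatMap_pieces {c : α} {l : List α} (h : terminated c l = true) :
    (pieces c l).flatMap (fun x => x ++ [c]) = l := by
  induction hn : l.length using Nat.strong_induction_on generalizing l with
  | _ n ih =>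
    subst hn
    by_cases hl : l = []
    · subst hl; simp [pieces_nil]
    · have hlast : l.getLast hl = c := by
        simpa [terminated, List.getLast?_eq_getLast_of_ne_nil hl] using h
      have hc : c ∈ l := hlast ▸ List.getLast_mem hl
      have h1 := before_append_after hc
      rw [pieces_of_ne_nil c hl, List.flatMap_cons, ih _ (length_after_lt c hl) ?_ rfl]
      · rw [List.append_assoc]; exact h1
      · by_cases ha : after c l = []
        · simp [ha, terminated]
        · have : (after c l).getLast ha = l.getLast hl := by
            have h2 : l.getLast hl = (before c l ++ c :: after c l).getLast (by simp) := by
              congr 1; exact h1.symm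
            rw [h2, List.getLast_append_of_ne_nil _ (List.cons_ne_nil _ _), List.getLast_cons ha]
          simp [terminated, List.getLast?_eq_getLast_of_ne_nil ha, this, hlast]

theorem terminated_flatMap (c : α) (xs : List (List α)) :
    terminated c (xs.flatMap fun x => x ++ [c]) = true := by
  induction xs using List.reverseRecOn with
  | nil => simp [terminated]
  | append_singleton xs x _ => simp [terminated]

end Pieces

theorem encodeFormulas_eq (l : List BForm) :
    encodeFormulas l = (l.map BForm.encode).flatMap fun x => x ++ [Sym.comma] := by
  rw [List.flatMap_map]; rfl

theorem pieces_encodeFormulas (l : List BForm) :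
    pieces .comma (encodeFormulas l) = l.map BForm.encode := by
  rw [encodeFormulas_eq, pieces_flatMap]
  simp only [List.mem_map, forall_exists_index, and_imp, forall_apply_eq_imp_iff₂]
  exact fun A _ => A.not_mem_encode (.inl rfl)

theorem not_mem_encodeFormulas (l : List BForm) {s : Sym} (hs : s = .arrow ∨ s = .bar) :
    s ∉ encodeFormulas l := by
  simp only [encodeFormulas, List.mem_flatMap, List.mem_append, List.mem_singleton, not_exists,
    not_and, not_or]
  intro A _
  refine ⟨A.not_mem_encode (.inr hs), ?_⟩
  rcases hs with rfl | rfl <;> simp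

/-- Whether a string is a list of formulas. -/
def isFormulas (L : List Sym) : Bool := terminated .comma L && (pieces .comma L).all isForm

theorem isFormulas_iff {L : List Sym} : isFormulas L = true ↔ ∃ l, L = encodeFormulas l := by
  simp only [isFormulas, Bool.and_eq_true, List.all_eq_true]
  constructor
  · rintro ⟨h1, h2⟩
    have : ∃ l : List BForm, pieces .comma L = l.map BForm.encode := by
      generalize pieces Sym.comma L = xs at h2
      induction xs with
      | nil => exact ⟨[], rfl⟩
      | cons x xs ih =>
        rw [List.forall_mem_cons] at h2
        obtain ⟨A, rfl⟩ := isForm_iff.1 h2.1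
        obtain ⟨l, rfl⟩ := ih h2.2
        exact ⟨A :: l, rfl⟩
    obtain ⟨l, hl⟩ := this
    exact ⟨l, by rw [encodeFormulas_eq, ← hl, flatMap_pieces h1]⟩
  · rintro ⟨l, rfl⟩
    refine ⟨encodeFormulas_eq l ▸ terminated_flatMap _ _, ?_⟩
    rw [pieces_encodeFormulas]
    simp only [List.mem_map, forall_exists_index, and_imp, forall_apply_eq_imp_iff₂]
    exact fun A _ => isForm_encode A

/-- The string of a listed sequent. -/
def encodeSequent (S : List BForm × List BForm) : List Sym :=
  encodeFormulas S.1 ++ Sym.arrow :: encodeFormulas S.2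

theorem bar_not_mem_encodeSequent (S : List BForm × List BForm) :
    Sym.bar ∉ encodeSequent S := by
  simp [encodeSequent, not_mem_encodeFormulas _ (.inr rfl)]

theorem HyperList.encode_eq (h : HyperList) :
    h.encode = (h.map encodeSequent).flatMap fun x => x ++ [Sym.bar] := by
  rw [List.flatMap_map]
  simp [encode, encodeSequent]

theorem pieces_encode (h : HyperList) : pieces .bar h.encode = h.map encodeSequent := by
  rw [HyperList.encode_eq, pieces_flatMap]
  simp only [List.mem_map, forall_exists_index, and_imp, forall_apply_eq_imp_iff₂]
  exact fun S _ => bar_not_mem_encodeSequent S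

theorem before_encodeSequent (S : List BForm × List BForm) :
    before .arrow (encodeSequent S) = encodeFormulas S.1 :=
  before_append (not_mem_encodeFormulas _ (.inl rfl)) _

theorem after_encodeSequent (S : List BForm × List BForm) :
    after .arrow (encodeSequent S) = encodeFormulas S.2 :=
  after_append (not_mem_encodeFormulas _ (.inl rfl)) _

/-- Whether a string is a sequent. -/
def isSequent (C : List Sym) : Bool :=
  (C.dropWhile (· ≠ .arrow)).head?.isSome &&
    (isFormulas (before .arrow C) && isFormulas (after .arrow C))

/-- The explicit search for an arrow matters: `before` and `after` would read a string without one
as an antecedent with empty succedent. -/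
theorem isSequent_iff {C : List Sym} : isSequent C = true ↔ ∃ S, C = encodeSequent S := by
  simp only [isSequent, Bool.and_eq_true, isFormulas_iff]
  constructor
  · rintro ⟨h1, ⟨l, hl⟩, ⟨r, hr⟩⟩
    have : Sym.arrow ∈ C := by
      by_contra hc
      rw [List.dropWhile_eq_nil_iff.2] at h1
      · simp at h1
      · intro x hx
        exact decide_eq_true fun h : x = _ => hc (h ▸ hx)
    refine ⟨(l, r), ?_⟩
    rw [encodeSequent, ← hl, ← hr, before_append_after this]
  · rintro ⟨S, rfl⟩
    refine ⟨?_, ⟨S.1, before_encodeSequent S⟩, ⟨S.2, after_encodeSequent S⟩⟩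
    rw [encodeSequent, List.dropWhile_append_of_pos]
    · simp
    · intro a ha
      exact decide_eq_true fun h : a = _ => not_mem_encodeFormulas S.1 (.inl rfl) (h ▸ ha)

/-- Whether a string is a hypersequent. -/
def isHyper (w : List Sym) : Bool := terminated .bar w && (pieces .bar w).all isSequent

theorem isHyper_iff {w : List Sym} : isHyper w = true ↔ ∃ h : HyperList, h.encode = w := by
  simp only [isHyper, Bool.and_eq_true, List.all_eq_true]
  constructor
  · rintro ⟨h1, h2⟩
    have : ∃ h : HyperList, pieces .bar w = h.map encodeSequent := by
      generalize pieces Sym.bar w = xs at h2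
      induction xs with
      | nil => exact ⟨[], rfl⟩
      | cons x xs ih =>
        rw [List.forall_mem_cons] at h2
        obtain ⟨A, rfl⟩ := isSequent_iff.1 h2.1
        obtain ⟨l, rfl⟩ := ih h2.2
        exact ⟨A :: l, rfl⟩
    obtain ⟨h, hh⟩ := this
    exact ⟨h, by rw [HyperList.encode_eq, ← hh, flatMap_pieces h1]⟩
  · rintro ⟨h, rfl⟩
    refine ⟨HyperList.encode_eq h ▸ terminated_flatMap _ _, ?_⟩
    rw [pieces_encode]
    simp only [List.mem_map, forall_exists_index, and_imp, forall_apply_eq_imp_iff₂]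
    exact fun S _ => isSequent_iff.2 ⟨S, rfl⟩

/-! ### The saturation conditions on strings -/

/-- Whether the formula `x` occurs in the list `L` of formulas. -/
def hasForm (x L : List Sym) : Bool := (pieces .comma L).any fun y => decide (x = y)

/-- The sequents of a hypersequent. -/
def comps (w : List Sym) : List (List Sym × List Sym) :=
  (pieces .bar w).map fun C => (before .arrow C, after .arrow C)

/-- Whether a formula in `L` starts with `s` and satisfies `P`. -/
def anyForm (L : List Sym) (s : Sym) (P : List Sym → Bool) : Bool :=
  (pieces .comma L).any fun F => decide (F.head? = some s) && P F

/-- Whether the string splits into two formulas that satisfy `P`. -/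
def anySplit (y : List Sym) (P : List Sym → List Sym → Bool) : Bool :=
  (cuts y).any fun x => isForm x.1 && (isForm x.2 && P x.1 x.2)

/-- Whether the sequent `L ⇒ R` violates a condition that involves no other sequent. -/
def violatesLocal (L R : List Sym) : Bool :=
  (anyForm L .var fun F => hasForm F R) ||
  ((anyForm L .neg fun F => !hasForm F.tail R) ||
  ((anyForm R .neg fun F => !hasForm F.tail L) ||
  ((anyForm L .imp fun F => anySplit F.tail fun u v => !(hasForm u R || hasForm v L)) ||
  (anyForm R .imp fun F => anySplit F.tail fun u v => !(hasForm u L && hasForm v R)))))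

/-- Whether the sequent `L ⇒ R` violates a condition on `w` about obligations. -/
def violatesObl (w L R : List Sym) : Bool :=
  (anyForm L .obl fun F => anySplit F.tail fun u v => (comps w).any fun T =>
    !(hasForm v T.2 || (hasForm (.bet :: .neg :: v) T.2 || hasForm u T.1))) ||
  (anyForm R .obl fun F => anySplit F.tail fun u v => !(comps w).any fun T =>
    hasForm v T.1 && (hasForm (.bet :: .neg :: v) T.1 && hasForm u T.2))

/-- Whether the sequent `L ⇒ R` violates a condition on `w` about the modalities. -/
def violatesModal (w L R : List Sym) : Bool :=
  (anyForm R .bet fun F => !(comps w).any fun T =>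
    hasForm F.tail T.2 && !anyForm L .bet fun G => !hasForm G.tail T.1) ||
  ((anyForm R .box fun F => !(comps w).any fun T => hasForm F.tail T.2) ||
  (anyForm L .box fun F => (comps w).any fun T => !hasForm F.tail T.1))

/-- Whether a hypersequent is saturated. -/
def isSaturated (w : List Sym) : Bool :=
  !(comps w).any fun S =>
    violatesLocal S.1 S.2 || (violatesObl w S.1 S.2 || violatesModal w S.1 S.2)

theorem comps_encode (h : HyperList) :
    comps h.encode = h.map fun S => (encodeFormulas S.1, encodeFormulas S.2) := by
  rw [comps, pieces_encode, List.map_map]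
  refine List.map_congr_left fun S _ => ?_
  simp [before_encodeSequent, after_encodeSequent]

theorem hasForm_encode {A : BForm} {l : List BForm} :
    hasForm A.encode (encodeFormulas l) = true ↔ A ∈ l := by
  simp only [hasForm, pieces_encodeFormulas, List.any_map, List.any_eq_true, comp_apply,
    decide_eq_true_eq]
  constructor
  · rintro ⟨B, hB, h⟩
    rwa [BForm.encode_inj h]
  · intro h
    exact ⟨A, h, rfl⟩

theorem anyForm_encode {l : List BForm} {s : Sym} {P : List Sym → Bool} :
    anyForm (encodeFormulas l) s P = true ↔
      ∃ F ∈ l, F.encode.head? = some s ∧ P F.encode = true := by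
  simp [anyForm, pieces_encodeFormulas]

/-- By unique readability only one cut yields two formulas, so the search amounts to evaluating `P`
at the immediate subformulas. -/
theorem anySplit_encode {A B : BForm} {P : List Sym → List Sym → Bool} :
    anySplit (A.encode ++ B.encode) P = P A.encode B.encode := by
  rw [Bool.eq_iff_iff]
  simp only [anySplit, List.any_eq_true, Bool.and_eq_true, Prod.exists, mem_cuts, isForm_iff]
  constructor
  · rintro ⟨_, _, h, ⟨C, rfl⟩, ⟨D, rfl⟩, hP⟩
    obtain ⟨rfl, rfl⟩ := BForm.cut_encode_iff.1 h
    exact hP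
  · intro h
    exact ⟨_, _, rfl, ⟨A, rfl⟩, ⟨B, rfl⟩, h⟩

section anyForm

variable {l : List BForm} {P : List Sym → Bool}

theorem anyForm_var : anyForm (encodeFormulas l) .var P = true ↔
    ∃ p, .var p ∈ l ∧ P (BForm.var p).encode = true := by
  rw [anyForm_encode]
  constructor
  · rintro ⟨F, hF, h1, h2⟩
    cases F <;> simp [BForm.encode] at h1
    exact ⟨_, hF, h2⟩
  · rintro ⟨p, hp, h⟩
    exact ⟨_, hp, by simp [BForm.encode], h⟩

theorem anyForm_neg : anyForm (encodeFormulas l) .neg (fun F => P F.tail) = true ↔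
    ∃ A, .neg A ∈ l ∧ P A.encode = true := by
  rw [anyForm_encode]
  constructor
  · rintro ⟨F, hF, h1, h2⟩
    cases F <;> simp [BForm.encode] at h1
    exact ⟨_, hF, h2⟩
  · rintro ⟨p, hp, h⟩
    exact ⟨_, hp, by simp [BForm.encode], h⟩

theorem anyForm_box : anyForm (encodeFormulas l) .box (fun F => P F.tail) = true ↔
    ∃ A, .box A ∈ l ∧ P A.encode = true := by
  rw [anyForm_encode]
  constructor
  · rintro ⟨F, hF, h1, h2⟩
    cases F <;> simp [BForm.encode] at h1
    exact ⟨_, hF, h2⟩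
  · rintro ⟨p, hp, h⟩
    exact ⟨_, hp, by simp [BForm.encode], h⟩

theorem anyForm_bet : anyForm (encodeFormulas l) .bet (fun F => P F.tail) = true ↔
    ∃ A, .bet A ∈ l ∧ P A.encode = true := by
  rw [anyForm_encode]
  constructor
  · rintro ⟨F, hF, h1, h2⟩
    cases F <;> simp [BForm.encode] at h1
    exact ⟨_, hF, h2⟩
  · rintro ⟨p, hp, h⟩
    exact ⟨_, hp, by simp [BForm.encode], h⟩

variable {Q : List Sym → List Sym → Bool}

theorem anyForm_imp :
    anyForm (encodeFormulas l) .imp (fun F => anySplit F.tail Q) = true ↔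
      ∃ A B, .imp A B ∈ l ∧ Q A.encode B.encode = true := by
  rw [anyForm_encode]
  constructor
  · rintro ⟨F, hF, h1, h2⟩
    cases F <;> simp [BForm.encode] at h1
    exact ⟨_, _, hF, by simpa [BForm.encode, anySplit_encode] using h2⟩
  · rintro ⟨A, B, hp, h⟩
    exact ⟨_, hp, by simp [BForm.encode], by simpa [BForm.encode, anySplit_encode] using h⟩

theorem anyForm_obl :
    anyForm (encodeFormulas l) .obl (fun F => anySplit F.tail Q) = true ↔
      ∃ A B, .obl A B ∈ l ∧ Q A.encode B.encode = true := by
  rw [anyForm_encode]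
  constructor
  · rintro ⟨F, hF, h1, h2⟩
    cases F <;> simp [BForm.encode] at h1
    exact ⟨_, _, hF, by simpa [BForm.encode, anySplit_encode] using h2⟩
  · rintro ⟨A, B, hp, h⟩
    exact ⟨_, hp, by simp [BForm.encode], by simpa [BForm.encode, anySplit_encode] using h⟩

end anyForm

theorem HyperList.forall_mem_toHyper {h : HyperList} {P : Sequent → Prop} :
    (∀ S ∈ h.toHyper, P S) ↔ ∀ S ∈ h, P ((S.1 : Multiset BForm) ⇒ₛ (S.2 : Multiset BForm)) := by
  simp only [toHyper, Multiset.mem_coe, List.mem_map]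
  exact ⟨fun H S h => H _ ⟨S, h, rfl⟩, fun H _ ⟨S, h, e⟩ => e ▸ H S h⟩

theorem HyperList.exists_mem_toHyper {h : HyperList} {P : Sequent → Prop} :
    (∃ S ∈ h.toHyper, P S) ↔ ∃ S ∈ h, P ((S.1 : Multiset BForm) ⇒ₛ (S.2 : Multiset BForm)) := by
  simp [toHyper]

theorem hasForm_bet_neg_encode {A : BForm} {l : List BForm} :
    hasForm (.bet :: .neg :: A.encode) (encodeFormulas l) = true ↔ .bet (.neg A) ∈ l :=
  hasForm_encode (A := .bet (.neg A))

theorem violatesLocal_encode (l r : List BForm) :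
    violatesLocal (encodeFormulas l) (encodeFormulas r) = false ↔
      (∀ p, .var p ∈ l → .var p ∉ r) ∧ (∀ A, .neg A ∈ l → A ∈ r) ∧ (∀ A, .neg A ∈ r → A ∈ l) ∧
      (∀ A B, .imp A B ∈ l → A ∈ r ∨ B ∈ l) ∧ (∀ A B, .imp A B ∈ r → A ∈ l ∧ B ∈ r) := by
  unfold violatesLocal
  rw [← Bool.not_eq_true, Bool.or_eq_true, Bool.or_eq_true, Bool.or_eq_true, Bool.or_eq_true,
    anyForm_var, anyForm_neg (P := fun x => !hasForm x (encodeFormulas r)),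
    anyForm_neg (P := fun x => !hasForm x (encodeFormulas l)), anyForm_imp, anyForm_imp]
  simp only [Bool.not_eq_true', ← Bool.not_eq_true, Bool.or_eq_true, Bool.and_eq_true,
    hasForm_encode, not_or, not_exists, not_and, not_not]
  simp only [Classical.or_iff_not_imp_left, Classical.not_imp, not_not]

theorem violatesObl_encode (h : HyperList) (l r : List BForm) :
    violatesObl h.encode (encodeFormulas l) (encodeFormulas r) = false ↔
      (∀ B A, .obl B A ∈ l → ∀ T ∈ h, A ∈ T.2 ∨ .bet (.neg A) ∈ T.2 ∨ B ∈ T.1) ∧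
      (∀ B A, .obl B A ∈ r → ∃ T ∈ h, A ∈ T.1 ∧ .bet (.neg A) ∈ T.1 ∧ B ∈ T.2) := by
  unfold violatesObl
  rw [← Bool.not_eq_true, Bool.or_eq_true, anyForm_obl, anyForm_obl]
  simp only [comps_encode, List.any_map, List.any_eq_true, comp_apply, Bool.not_eq_true',
    ← Bool.not_eq_true, Bool.or_eq_true, Bool.and_eq_true, hasForm_encode,
    hasForm_bet_neg_encode, not_or, not_exists, not_and, not_not]
  simp only [Classical.or_iff_not_imp_left, Classical.not_imp, not_forall, not_not]

theorem violatesModal_encode (h : HyperList) (l r : List BForm) :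
    violatesModal h.encode (encodeFormulas l) (encodeFormulas r) = false ↔
      (∀ A, .bet A ∈ r → ∃ T ∈ h, A ∈ T.2 ∧ ∀ B, .bet B ∈ l → B ∈ T.1) ∧
      (∀ A, .box A ∈ r → ∃ T ∈ h, A ∈ T.2) ∧ (∀ A, .box A ∈ l → ∀ T ∈ h, A ∈ T.1) := by
  unfold violatesModal
  rw [← Bool.not_eq_true, Bool.or_eq_true, Bool.or_eq_true,
    anyForm_bet (P := fun x => !(comps h.encode).any fun T => hasForm x T.2 &&
      !anyForm (encodeFormulas l) .bet fun G => !hasForm G.tail T.1),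
    anyForm_box (P := fun x => !(comps h.encode).any fun T => hasForm x T.2),
    anyForm_box (P := fun x => (comps h.encode).any fun T => !hasForm x T.1)]
  simp only [comps_encode, List.any_map, List.any_eq_true, comp_apply, Bool.not_eq_true',
    ← Bool.not_eq_true, Bool.and_eq_true, hasForm_encode, not_or, not_exists, not_and, not_not]
  have key : ∀ T : List BForm × List BForm,
      anyForm (encodeFormulas l) .bet (fun G => !hasForm G.tail (encodeFormulas T.1)) = true ↔
        ∃ A, .bet A ∈ l ∧ A ∉ T.1 := fun T => by
    rw [anyForm_bet (P := fun x => !hasForm x (encodeFormulas T.1))]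
    simp only [Bool.not_eq_true', ← Bool.not_eq_true, hasForm_encode]
  simp only [key, not_exists, not_and, Classical.not_imp, not_forall, not_not]

/-- Regroups the conditions component by component, in the shape of the string tests. The
one-component conditions for `○` and `□` on the left are the instances `T = S` of the two-component
ones. -/
theorem saturated_iff (H : Hyperseq) : Saturated H ↔
    ∀ S ∈ H, ((∀ p, .var p ∈ S.ante → .var p ∉ S.succ) ∧ (∀ A, .neg A ∈ S.ante → A ∈ S.succ) ∧
      (∀ A, .neg A ∈ S.succ → A ∈ S.ante) ∧
      (∀ A B, .imp A B ∈ S.ante → A ∈ S.succ ∨ B ∈ S.ante) ∧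
      (∀ A B, .imp A B ∈ S.succ → A ∈ S.ante ∧ B ∈ S.succ)) ∧
    ((∀ B A, .obl B A ∈ S.ante →
        ∀ T ∈ H, A ∈ T.succ ∨ .bet (.neg A) ∈ T.succ ∨ B ∈ T.ante) ∧
      (∀ B A, .obl B A ∈ S.succ → ∃ T ∈ H, A ∈ T.ante ∧ .bet (.neg A) ∈ T.ante ∧ B ∈ T.succ)) ∧
    (∀ A, .bet A ∈ S.succ → ∃ T ∈ H, A ∈ T.succ ∧ ∀ B, .bet B ∈ S.ante → B ∈ T.ante) ∧
      (∀ A, .box A ∈ S.succ → ∃ T ∈ H, A ∈ T.succ) ∧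
      (∀ A, .box A ∈ S.ante → ∀ T ∈ H, A ∈ T.ante) := by
  constructor
  · intro h S hS
    refine ⟨⟨fun p h1 h2 => Saturated.not_axiom h ⟨S, hS, p, h1, h2⟩, h.negL S hS, h.negR S hS,
      h.impL S hS, h.impR S hS⟩, ⟨fun B A h1 T hT => h.oblL2 S hS T hT B A h1, h.oblR S hS⟩,
      fun A hA => ?_, h.boxR S hS, fun A h1 T hT => h.boxL2 S hS T hT A h1⟩
    obtain ⟨T, hT, h1, h2⟩ := h.betR S hS A hA
    exact ⟨T, hT, h2, fun B hB => h1 (mem_betDown.2 hB)⟩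
  · intro h
    refine ⟨fun ⟨S, hS, p, h1, h2⟩ => (h S hS).1.1 p h1 h2, fun S hS => (h S hS).1.2.2.2.1,
      fun S hS => (h S hS).1.2.2.2.2, fun S hS => (h S hS).1.2.1, fun S hS => (h S hS).1.2.2.1,
      fun S hS B A h1 => (h S hS).2.1.1 B A h1 S hS,
      fun S hS T hT B A h1 => (h S hS).2.1.1 B A h1 T hT, fun S hS => (h S hS).2.1.2,
      fun S hS A hA => ?_, fun S hS => (h S hS).2.2.2.1,
      fun S hS A h1 => (h S hS).2.2.2.2 A h1 S hS,
      fun S hS T hT A h1 => (h S hS).2.2.2.2 A h1 T hT⟩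
    obtain ⟨T, hT, h1, h2⟩ := (h S hS).2.2.1 A hA
    exact ⟨T, hT, fun B hB => h2 B (mem_betDown.1 hB), h1⟩

theorem isSaturated_encode (h : HyperList) :
    isSaturated h.encode = true ↔ Saturated h.toHyper := by
  rw [saturated_iff]
  simp only [HyperList.forall_mem_toHyper, HyperList.exists_mem_toHyper, Multiset.mem_coe]
  rw [isSaturated, Bool.not_eq_true', List.any_eq_false, comps_encode]
  simp only [List.mem_map, forall_exists_index, and_imp, forall_apply_eq_imp_iff₂,
    Bool.not_eq_true, Bool.or_eq_false_iff, violatesLocal_encode, violatesObl_encode,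
    violatesModal_encode]

/-- Whether a string is a saturated hypersequent. -/
def isSaturatedHyper (w : List Sym) : Bool := isHyper w && isSaturated w

theorem isSaturatedHyper_iff {w : List Sym} : isSaturatedHyper w = true ↔ w ∈ saturatedLang := by
  rw [isSaturatedHyper, Bool.and_eq_true, isHyper_iff]
  constructor
  · rintro ⟨⟨h, rfl⟩, h2⟩
    exact ⟨h, rfl, (isSaturated_encode h).1 h2⟩
  · rintro ⟨h, rfl, h2⟩
    exact ⟨⟨h, rfl⟩, (isSaturated_encode h).2 h2⟩

/-- Whether the formula `x` occurs in a succedent of the hypersequent `w`. -/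
def inSuccedent (x w : List Sym) : Bool := (comps w).any fun T => hasForm x T.2

theorem inSuccedent_encode {A : BForm} {h : HyperList} :
    inSuccedent A.encode h.encode = true ↔ ∃ S ∈ h.toHyper, A ∈ S.succ := by
  simp [inSuccedent, comps_encode, hasForm_encode, HyperList.exists_mem_toHyper]

/-! ### Programs for the string predicates -/

instance : Inhabited Sym := ⟨.comma⟩

section Programs

variable {I : Type}

theorem PolyFun.nil {V α : Type} [DecidableEq V] [Fintype V] [Inhabited α] :
    PolyFun I fun _ : V → List α => [] := fun u => .nil u

theorem PolyFun.cons {V α : Type} [DecidableEq V] [Fintype V] [Inhabited α] (a : α)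
    {f : (V → List α) → List α} (hf : PolyFun I f) : PolyFun I fun S => a :: f S := fun u => by
  simpa using (PolyTrans.cons u a).comp (hf u)

/-- A test of one variable applies to computed strings. -/
theorem PolyDec.app {V α : Type} [DecidableEq V] [Fintype V] [Inhabited α] {g : List α → Bool}
    {v : V} (hg : PolyDec I fun S : V → List α => g (S v)) {f : (V → List α) → List α}
    (hf : PolyFun I f) : PolyDec I fun S => g (f S) := by
  simpa using hg.subst v hf

/-- Tests of the first symbols of two variables. -/
theorem PolyDec.heads {V α : Type} [DecidableEq V] [Fintype V] [Nontrivial V] [Inhabited α]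
    [Fintype α] [DecidableEq α] (u v : V) (g : Option α → Option α → Bool) :
    PolyDec I fun S : V → List α => g (S u).head? (S v).head? := by
  have h : PolyDec I fun S : V → List α => (Finset.univ : Finset (Option α)).toList.any fun o =>
      decide ((S u).head? = o) && g o (S v).head? :=
    PolyDec.anyList _ fun o => (PolyDec.head u fun x => decide (x = o)).and (.head v (g o))
  convert h using 2 with S
  rw [Bool.eq_iff_iff]
  simp [List.any_eq_true]

/-- Whether reading a string as a list of formulas has to stop at a symbol. -/
def Sym.isPunct : Sym → Bool
  | .comma | .arrow | .bar => true
  | _ => false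

/-- Whether a symbol starts a formula with two immediate subformulas. -/
def Sym.isBinary : Sym → Bool
  | .imp | .obl => true
  | _ => false

/-- The counter is kept in unary as the length of `n`, and `b` holds the tail for the one-symbol
lookahead. A failed test stops the loop with `a` nonempty, so acceptance means that both `a` and `n`
are empty. -/
theorem PolyDec.isForms {a b n : Fin 20} (han : a ≠ n) (hba : b ≠ a) :
    PolyDec I fun S : Fin 20 → List Sym => isForms (S n).length (S a) := by
  have hc1 : PolyDec I fun S : Fin 20 → List Sym =>
      ((S a).head?.map fun s => s.isPunct || !mayPrecede s (S a).tail.head?).getD true := by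
    have := (PolyDec.heads (I := I) a b fun o o' =>
      (o.map fun s : Sym => s.isPunct || !mayPrecede s o').getD true).subst b (.tail a)
    simpa [update_of_ne hba.symm] using this
  have hc2 : PolyDec I fun S : Fin 20 → List Sym =>
      ((S a).head?.map fun s => !s.isBit && (S n).head?.isNone).getD true :=
    PolyDec.heads (I := I) a n fun o o' => (o.map fun s : Sym => !s.isBit && o'.isNone).getD true
  have hr : PolyDec I fun S : Fin 20 → List Sym => (S a).head?.isNone && (S n).head?.isNone :=
    (PolyDec.head a _).and (.head n _)
  have hT : PolyTrans I fun S : Fin 20 → List Sym =>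
      update (bif decide ((S a).head? = some .var) then update S n (S n).tail else
        bif ((S a).head?.map Sym.isBinary).getD false then update S n (.comma :: S n) else S)
        a (S a).tail := by
    have h := (PolyTrans.tail a).comp
      (PolyTrans.ite (PolyDec.head (I := I) a fun o => decide (o = some Sym.var)) (.tail n)
      (.ite (.head a fun o => (o.map Sym.isBinary).getD false) (.cons n .comma) .id))
    convert h using 3 with S
    cases decide ((S a).head? = some .var) <;>
      cases ((S a).head?.map Sym.isBinary).getD false <;> simp [update_of_ne han]
  -- A binary connective shortens `a` but lengthens the counter, leaving the total size unchanged;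
  -- counting `a` twice makes the potential decrease.
  refine PolyDec.loop (hc1.or hc2) hr hT (fun S => ?_) (fun S => envSize S + (S a).length)
    (fun S => Nat.le_add_right _ _) (e := 2) (fun S => ?_) (fun S hS => ?_)
  · cases ha : S a with
    | nil => cases S n <;> simp [DeonticE.isForms]
    | cons s l =>
      cases hn : S n <;> cases hm : mayPrecede s l.head? <;> cases s <;>
        simp [DeonticE.isForms, hm, hn, Sym.isPunct, Sym.isBit, Sym.isBinary,
          update_of_ne han.symm]
  · exact (Nat.add_le_add_left (length_le_envSize S a) _).trans (add_le_pow_two _)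
  · cases ha : S a with
    | nil => simp [ha] at hS
    | cons s l =>
      have h1 := envSize_update S n (S n).tail
      have h2 := envSize_update S n (.comma :: S n)
      have h3 := envSize_update (update S n (S n).tail) a l
      have h4 := envSize_update (update S n (.comma :: S n)) a l
      have h5 := envSize_update S a l
      rw [update_of_ne han] at h3 h4
      simp only [ha, List.length_tail, List.length_cons] at h1 h2 h3 h4 h5
      cases s <;> simp [Sym.isBinary] <;> omega

/-- The predicate `isForm` on a computed string. -/
theorem PolyDec.isForm {f : (Fin 20 → List Sym) → List Sym} (hf : PolyFun I f) :
    PolyDec I fun S => isForm (f S) := by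
  refine PolyDec.app (v := 16) (g := DeonticE.isForm) ?_ hf
  have h := (PolyDec.isForms (I := I) (a := 16) (b := 17) (n := 18) (by decide)
    (by decide)).subst 18 (PolyFun.nil.cons .comma)
  simpa [DeonticE.isForm] using (PolyDec.head 16 startsBit).not.and h

theorem PolyDec.terminated (c : Sym) {f : (Fin 20 → List Sym) → List Sym} (hf : PolyFun I f) :
    PolyDec I fun S => terminated c (f S) :=
  PolyDec.app (v := 16) (g := fun l => decide (l.head?.getD c = c))
    (PolyDec.head 16 fun o => decide (o.getD c = c)) (.map PolyMap.reverse hf)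

theorem PolyDec.allPieces {g : List Sym → Bool} (c : Sym)
    (hg : PolyDec I fun S : Fin 20 → List Sym => g (S 19)) {f : (Fin 20 → List Sym) → List Sym}
    (hf : PolyFun I f) : PolyDec I fun S => (pieces c (f S)).all g := by
  refine PolyDec.app (v := 15) (g := fun l => (pieces c l).all g) ?_ hf
  have h := (hg.not.anyPieces c (j := 19) (k := 15) (fun S l => by simp) (by decide)).not
  convert h using 2 with S
  simp [List.all_eq_not_any_not]

theorem PolyDec.isFormulas {f : (Fin 20 → List Sym) → List Sym} (hf : PolyFun I f) :
    PolyDec I fun S => isFormulas (f S) :=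
  (PolyDec.terminated .comma hf).and (.allPieces .comma (.isForm (.var 19)) hf)

theorem PolyDec.isHyper {f : (Fin 20 → List Sym) → List Sym} (hf : PolyFun I f) :
    PolyDec I fun S => isHyper (f S) := by
  refine (PolyDec.terminated .bar hf).and (.allPieces .bar ?_ hf)
  refine PolyDec.and ?_ (PolyDec.and (.isFormulas (.map (PolyMap.before _) (.var 19)))
    (.isFormulas (.map (PolyMap.after _) (.var 19))))
  exact PolyDec.app (v := 16) (g := fun l => l.head?.isSome) (.head 16 _)
    (.map (PolyMap.dropWhile _) (.var 19))

/-- Variables have fixed roles, so that nested searches do not interfere: 0 is the hypersequent, 1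
and 2 the sides of the current component, 3 its current formula, 4 and 5 the halves of a split, 6
and 7 a second component, 8 and 9 the formulas compared. The higher numbers serve mainly as loop and
scratch variables. -/
theorem PolyDec.hasForm {f : (Fin 20 → List Sym) → List Sym} (hf : PolyFun I f) {j : Fin 20}
    (hj : j ≠ 8) : PolyDec I fun S => hasForm (f S) (S j) := by
  have h := (((PolyDec.eq (I := I) (α := Sym) (u := (8 : Fin 20)) (v := 9) (by decide)).anyPieces
    .comma (j := 9) (k := 12) (fun S l => by simp) (by decide)).subst 12 (.var j)).subst 8 hf
  simpa [DeonticE.hasForm, update_of_ne hj] using h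

theorem PolyDec.anyForm {P : (Fin 20 → List Sym) → Bool} (hP : PolyDec I P) (s : Sym)
    {i j k : Fin 20} (hjk : j ≠ k) (hk : ∀ S l, P (update S k l) = P S) :
    PolyDec I fun S => anyForm (S i) s fun F => P (update S j F) := by
  have h := (((PolyDec.head (I := I) j fun o => decide (o = some s)).and hP).anyPieces .comma
    (j := j) (k := k) (fun S l => by simp [hk, update_of_ne hjk]) hjk).subst k (.var i)
  simpa [DeonticE.anyForm, update_comm hjk.symm, hk] using h

theorem PolyDec.anySplit {P : (Fin 20 → List Sym) → Bool} (hP : PolyDec I P)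
    {f : (Fin 20 → List Sym) → List Sym} (hf : PolyFun I f)
    (h13 : ∀ S l, P (update S 13 l) = P S) (h14 : ∀ S l, P (update S 14 l) = P S) :
    PolyDec I fun S => anySplit (f S) fun u v => P (update (update S 4 u) 5 v) := by
  have h := (((PolyDec.isForm (I := I) (.var 4)).and ((PolyDec.isForm (.var 5)).and hP)).anyCuts
    (i := 4) (j := 5) (k := 13) (k' := 14) (fun S l => by simp [h13]) (fun S l => by simp [h14])
    (by decide) (by decide) (by decide) (by decide) (by decide)).subst 13 hf
  have e : ∀ (S : Fin 20 → List Sym) x u v,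
      update (update (update S 13 x) 4 u) 5 v = update (update (update S 4 u) 5 v) 13 x :=
    fun S x u v => by
      rw [update_comm (by decide : (13 : Fin 20) ≠ 4), update_comm (by decide : (13 : Fin 20) ≠ 5)]
  simpa [DeonticE.anySplit, e, h13] using h

theorem PolyDec.anyComps {P : (Fin 20 → List Sym) → Bool} (hP : PolyDec I P) {i l r k : Fin 20}
    (hlr : l ≠ r) (hlk : l ≠ k) (hrk : r ≠ k) (hk : ∀ S x, P (update S k x) = P S) :
    PolyDec I fun S => (comps (S i)).any fun T => P (update (update S l T.1) r T.2) := by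
  have e : ∀ (S : Fin 20 → List Sym) x u v,
      update (update (update S k x) l u) r v = update (update (update S l u) r v) k x :=
    fun S x u v => by rw [update_comm hlk.symm, update_comm hrk.symm]
  have h1 := (hP.subst r (.map (PolyMap.after .arrow) (.var r))).subst l
    (.map (PolyMap.before .arrow) (.var r))
  have h := (h1.anyPieces .bar (j := r) (k := k)
    (fun S x => by simp [update_of_ne hlr.symm, update_of_ne hrk, e, hk]) hrk).subst k (.var i)
  have e' : ∀ (S : Fin 20 → List Sym) x u v,
      update (update (update S r x) l u) r v = update (update S l u) r v :=
    fun S x u v => by rw [update_comm hlr.symm, update_idem]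
  simpa [comps, comp_def, update_of_ne hlr.symm, update_of_ne hrk, e', update_comm hrk.symm, e,
    hk] using h

theorem PolyDec.violatesLocal :
    PolyDec I fun S : Fin 20 → List Sym => violatesLocal (S 1) (S 2) := by
  have form : ∀ j : Fin 20, j ≠ 8 →
      PolyDec I fun S : Fin 20 → List Sym => DeonticE.hasForm (S 3).tail (S j) :=
    fun j hj => .hasForm (.tail 3) hj
  have h1 := (PolyDec.hasForm (I := I) (.var 3) (j := 2) (by decide)).anyForm .var
    (i := 1) (j := 3) (k := 10) (by decide) (fun S l => by simp)
  have h2 := (form 2 (by decide)).not.anyForm .neg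
    (i := 1) (j := 3) (k := 10) (by decide) (fun S l => by simp)
  have h3 := (form 1 (by decide)).not.anyForm .neg
    (i := 2) (j := 3) (k := 10) (by decide) (fun S l => by simp)
  have h4 := ((((PolyDec.hasForm (I := I) (.var 4) (j := 2) (by decide)).or
    (.hasForm (.var 5) (j := 1) (by decide))).not.anySplit (.tail 3) (fun S l => by simp)
    (fun S l => by simp))).anyForm .imp (i := 1) (j := 3) (k := 10) (by decide)
    (fun S l => by simp)
  have h5 := ((((PolyDec.hasForm (I := I) (.var 4) (j := 1) (by decide)).and
    (.hasForm (.var 5) (j := 2) (by decide))).not.anySplit (.tail 3) (fun S l => by simp)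
    (fun S l => by simp))).anyForm .imp (i := 2) (j := 3) (k := 10) (by decide)
    (fun S l => by simp)
  have h := h1.or (h2.or (h3.or (h4.or h5)))
  simpa [DeonticE.violatesLocal] using h

theorem PolyDec.violatesObl :
    PolyDec I fun S : Fin 20 → List Sym => violatesObl (S 0) (S 1) (S 2) := by
  have hbet : PolyFun I fun S : Fin 20 → List Sym => .bet :: .neg :: S 5 :=
    ((PolyFun.var (5 : Fin 20)).cons Sym.neg).cons Sym.bet
  have hL : PolyDec I fun S : Fin 20 → List Sym =>
      !(DeonticE.hasForm (S 5) (S 7) || (DeonticE.hasForm (.bet :: .neg :: S 5) (S 7) ||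
        DeonticE.hasForm (S 4) (S 6))) :=
    ((PolyDec.hasForm (.var 5) (by decide)).or ((PolyDec.hasForm hbet (by decide)).or
      (.hasForm (.var 4) (by decide)))).not
  have hR : PolyDec I fun S : Fin 20 → List Sym =>
      DeonticE.hasForm (S 5) (S 6) && (DeonticE.hasForm (.bet :: .neg :: S 5) (S 6) &&
        DeonticE.hasForm (S 4) (S 7)) :=
    (PolyDec.hasForm (.var 5) (by decide)).and ((PolyDec.hasForm hbet (by decide)).and
      (.hasForm (.var 4) (by decide)))
  have hL' := hL.anyComps (i := 0) (l := 6) (r := 7) (k := 11) (by decide) (by decide) (by decide)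
    (fun S l => by simp)
  have hR' := (hR.anyComps (i := 0) (l := 6) (r := 7) (k := 11) (by decide) (by decide)
    (by decide) (fun S l => by simp)).not
  have h1 := (hL'.anySplit (.tail 3) (fun S l => by simp) (fun S l => by simp)).anyForm .obl
    (i := 1) (j := 3) (k := 10) (by decide) (fun S l => by simp)
  have h2 := (hR'.anySplit (.tail 3) (fun S l => by simp) (fun S l => by simp)).anyForm .obl
    (i := 2) (j := 3) (k := 10) (by decide) (fun S l => by simp)
  simpa [DeonticE.violatesObl] using h1.or h2

theorem PolyDec.violatesModal :
    PolyDec I fun S : Fin 20 → List Sym => violatesModal (S 0) (S 1) (S 2) := by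
  have h0 := (PolyDec.hasForm (I := I) (.tail 16) (j := 6) (by decide)).not.anyForm .bet (i := 1)
    (j := 16) (k := 17) (by decide) (fun S l => by simp)
  have h1 := (((PolyDec.hasForm (I := I) (.tail 3) (j := 7) (by decide)).and h0.not).anyComps
    (i := 0) (l := 6) (r := 7) (k := 11) (by decide) (by decide) (by decide)
    (fun S l => by simp)).not.anyForm .bet (i := 2) (j := 3) (k := 10) (by decide)
    (fun S l => by simp)
  have h2 := ((PolyDec.hasForm (I := I) (.tail 3) (j := 7) (by decide)).anyComps
    (i := 0) (l := 6) (r := 7) (k := 11) (by decide) (by decide) (by decide)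
    (fun S l => by simp)).not.anyForm .box (i := 2) (j := 3) (k := 10) (by decide)
    (fun S l => by simp)
  have h3 := ((PolyDec.hasForm (I := I) (.tail 3) (j := 6) (by decide)).not.anyComps
    (i := 0) (l := 6) (r := 7) (k := 11) (by decide) (by decide) (by decide)
    (fun S l => by simp)).anyForm .box (i := 1) (j := 3) (k := 10) (by decide)
    (fun S l => by simp)
  simpa [DeonticE.violatesModal] using h1.or (h2.or h3)

theorem PolyDec.isSaturatedHyper {f : (Fin 20 → List Sym) → List Sym} (hf : PolyFun I f) :
    PolyDec I fun S => isSaturatedHyper (f S) := by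
  refine PolyDec.app (v := 0) (g := DeonticE.isSaturatedHyper) ?_ hf
  have h := ((PolyDec.violatesLocal (I := I)).or (PolyDec.violatesObl.or .violatesModal)).anyComps
    (i := 0) (l := 1) (r := 2) (k := 19) (by decide) (by decide) (by decide)
    (fun S l => by simp)
  simpa [DeonticE.isSaturatedHyper, isSaturated] using (PolyDec.isHyper (.var 0)).and h.not

/-- The predicate `inSuccedent` on computed strings. -/
theorem PolyDec.inSuccedent {f g : (Fin 20 → List Sym) → List Sym} (hf : PolyFun I f)
    (hg : PolyFun I g) (hgf : ∀ S l, g (update S 1 l) = g S) :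
    PolyDec I fun S => inSuccedent (f S) (g S) := by
  have h := (((PolyDec.hasForm (I := I) (.var 1) (j := 7) (by decide)).anyComps (i := 0)
    (l := 6) (r := 7) (k := 11) (by decide) (by decide) (by decide)
    (fun S l => by simp)).subst 0 hg).subst 1 hf
  simpa [DeonticE.inSuccedent, hgf] using h

end Programs

/-! ### Complexity -/

theorem inP_saturatedLang : InP saturatedLang := by
  refine ⟨isSaturatedHyper, fun w => isSaturatedHyper_iff, ?_⟩
  have h := (PolyDec.isSaturatedHyper (I := Sym) (.var 0)).polyTime id 0 (id : List Sym → List Sym)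
  simpa using h

theorem length_encodeFormulas (l : List BForm) : (encodeFormulas l).length = formulasSize l := by
  simp [encodeFormulas, formulasSize, List.length_flatMap]

theorem HyperList.length_encode (h : HyperList) : h.encode.length = hyperSize h.toHyper := by
  simp only [encode, hyperSize, toHyper, List.length_flatMap, Multiset.map_coe, Multiset.sum_coe,
    List.map_map]
  congr 1
  refine List.map_congr_left fun S _ => ?_
  simp [length_encodeFormulas]
  omega

theorem HyperList.exists_toHyper (H : Hyperseq) : ∃ h : HyperList, h.toHyper = H := by
  induction H using Multiset.induction with
  | empty => exact ⟨[], rfl⟩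
  | cons S H ih =>
    obtain ⟨h, rfl⟩ := ih
    obtain ⟨Γ, Δ⟩ := S
    refine ⟨(Γ.toList, Δ.toList) :: h, ?_⟩
    simp [toHyper, ← Multiset.cons_coe]

theorem Form.toB_inj : ∀ {A B : Form}, A.toB = B.toB → A = B := by
  intro A
  induction A with
  | var p => intro B h; cases B <;> simp_all [toB]
  | neg A ih | box A ih =>
    intro B h
    cases B <;> simp only [toB, BForm.neg.injEq, BForm.box.injEq, reduceCtorEq] at h
    rw [ih h]
  | imp A A' ih ih' | obl A A' ih ih' =>
    intro B h
    cases B <;> simp only [toB, BForm.imp.injEq, BForm.obl.injEq, reduceCtorEq] at h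
    rw [ih h.1, ih' h.2]

/-! ### Certificates of non-validity -/

/-- The symbols of a pair of strings, written with the separator `bar`; the first string loses
its bars. -/
def pairSym : Option (Sym ⊕ Sym) → Sym
  | none => .bar
  | some (.inl .bar) => .arrow
  | some (.inl s) => s
  | some (.inr s) => s

/-- Replace every `bar` by an `arrow`. -/
def unbar (w : List Sym) : List Sym := w.map fun s => pairSym (some (.inl s))

theorem map_encodePair (w c : List Sym) :
    (encodePair (w, c)).map pairSym = unbar w ++ Sym.bar :: c := by
  simp [encodePair, unbar, comp_def, pairSym]

theorem bar_not_mem_unbar (w : List Sym) : Sym.bar ∉ unbar w := by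
  simp only [unbar, List.mem_map, not_exists, not_and]
  intro s _
  cases s <;> simp [pairSym]

/-- A bar in the first string would be confused with the separator. Its replacement, the arrow,
occurs in no formula either, so no string becomes a formula by the replacement. -/
theorem unbar_eq_encode_iff {w : List Sym} {A : BForm} : unbar w = A.encode ↔ w = A.encode := by
  have hid : ∀ {w : List Sym}, Sym.bar ∉ w → unbar w = w := by
    intro w hw
    unfold unbar
    refine (List.map_congr_left fun s hs => ?_).trans (List.map_id w)
    cases s <;> first | rfl | exact absurd hs hw
  constructor
  · intro h
    rw [← hid (w := w), h]
    intro hw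
    refine A.not_mem_encode (s := .arrow) (.inr (.inl rfl)) ?_
    rw [← h]
    exact List.mem_map.2 ⟨.bar, hw, rfl⟩
  · rintro rfl
    exact hid (A.not_mem_encode (.inr (.inr rfl)))

/-- Whether `c` certifies that `x` is not a valid formula. -/
def refutes (x c : List Sym) : Bool :=
  !(isForm x && !decide (Sym.bet ∈ x)) || (isSaturatedHyper c && inSuccedent x c)

theorem PolyDec.refutes {I : Type} : PolyDec I fun S : Fin 20 → List Sym =>
    refutes (before .bar (S 0)) (after .bar (S 0)) := by
  have hb := PolyFun.map (I := I) (PolyMap.before Sym.bar) (.var (0 : Fin 20))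
  have ha := PolyFun.map (I := I) (PolyMap.after Sym.bar) (.var (0 : Fin 20))
  have hm : PolyDec I fun S : Fin 20 → List Sym => decide (Sym.bet ∈ before .bar (S 0)) := by
    have h := PolyDec.app (g := fun l : List Sym => l.head?.isSome) (PolyDec.head (0 : Fin 20) _)
      (.map (PolyMap.dropWhile (I := I) (· ≠ Sym.bet)) hb)
    convert h using 2 with S
    rw [Bool.eq_iff_iff, decide_eq_true_iff, List.isSome_head?, ne_eq,
      List.dropWhile_eq_nil_iff]
    simp
  exact (((PolyDec.isForm hb).and hm.not).not).or
    ((PolyDec.isSaturatedHyper ha).and (.inSuccedent hb ha fun S l => by simp))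

theorem refutes_sound {A : Form} {c : List Sym} (h : refutes A.encode c = true) : ¬ Valid A := by
  obtain ⟨h1, h2⟩ := exists_form_iff.1 ⟨A, rfl⟩
  simp only [refutes, h1, h2, decide_false, Bool.not_false, Bool.and_true, Bool.not_true,
    Bool.false_or, Bool.and_eq_true, isSaturatedHyper_iff] at h
  obtain ⟨⟨k, rfl, hk⟩, h4⟩ := h
  obtain ⟨S, hS, hA⟩ := inSuccedent_encode.1 h4
  exact hk.not_valid hS hA

theorem exists_refutes {A : Form} (h : ¬ Valid A) :
    ∃ c, c.length ≤ 250 * A.encode.length ^ 4 ∧ refutes A.encode c = true := by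
  obtain ⟨D, -, K, hK, hsat, hsize⟩ := exists_saturated_of_not_valid h
  obtain ⟨k, rfl⟩ := HyperList.exists_toHyper K
  refine ⟨k.encode, k.length_encode.le.trans hsize, ?_⟩
  have h1 : isSaturatedHyper k.encode = true := isSaturatedHyper_iff.2 ⟨k, rfl, hsat⟩
  have h2 : inSuccedent A.encode k.encode = true :=
    inSuccedent_encode.2 (hK.exists_mem_succ (F := A.toB) D
      ⟨_, Multiset.mem_singleton_self _, by simp⟩)
  simp [refutes, h1, h2]

/-- The certificate is a string of a saturated hypersequent with the formula in a succedent. The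
verifier need not check derivability: soundness uses only the truth lemma, and the derivation serves
to bound the length. -/
theorem inCoNP_validLang : InCoNP validLang := by
  refine ⟨Sym, inferInstance, fun x => refutes (unbar x.1) x.2, 250 * .X ^ 4, ?_, fun w => ?_⟩
  · have h := (PolyDec.refutes (I := Option (Sym ⊕ Sym))).polyTime pairSym 0
      (encodePair : List Sym × List Sym → List (Option (Sym ⊕ Sym)))
    convert h using 4 with x
    · rw [update_self, map_encodePair x.1 x.2, before_append (bar_not_mem_unbar _)]
    · rw [update_self, map_encodePair x.1 x.2, after_append (bar_not_mem_unbar _)]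
  · by_cases hw : ∃ A : Form, A.encode = w
    · obtain ⟨A, rfl⟩ := hw
      have hA : unbar A.encode = A.encode := unbar_eq_encode_iff.2 rfl
      have hv : A.encode ∈ validLangᶜ ↔ ¬ Valid A := by
        refine not_congr ⟨?_, fun h => ⟨A, rfl, h⟩⟩
        rintro ⟨B, hB, h⟩
        rwa [← Form.toB_inj (BForm.encode_inj hB)]
      rw [hv]
      simp only [hA]
      refine ⟨fun h => ?_, fun ⟨c, _, h⟩ => refutes_sound h⟩
      simpa using exists_refutes h
    -- Strings that are no formulas of `L` also lie in the complement; they are accepted with the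
    -- empty certificate.
    · refine iff_of_true (fun ⟨A, hA, _⟩ => hw ⟨A, hA⟩) ⟨[], by simp, ?_⟩
      have : ¬ (isForm (unbar w) = true ∧ Sym.bet ∉ unbar w) := by
        rw [← exists_form_iff]
        rintro ⟨A, hA⟩
        exact hw ⟨A, (unbar_eq_encode_iff.1 hA.symm).symm⟩
      have h : (isForm (unbar w) && !decide (Sym.bet ∈ unbar w)) = false := by
        rw [← Bool.not_eq_true]
        simpa using this
      simp only [refutes, h, Bool.not_false, Bool.true_or]

end DeonticE

theorem mainTheorem2 :
    DeonticE.InCoNP DeonticE.validLang ∧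
    DeonticE.InP DeonticE.saturatedLang ∧
    ∃ C : ℕ, ∀ A : DeonticE.Form,
      (∀ D : DeonticE.Derivation (DeonticE.rootOf A), D.Irredundant →
        ∀ H, D.Occurs H → DeonticE.hyperSize H ≤ C * A.size ^ 4) ∧
      (¬ DeonticE.Valid A →
        ∃ D : DeonticE.Derivation (DeonticE.rootOf A), D.Irredundant ∧
          ∃ H, D.Occurs H ∧ DeonticE.Saturated H ∧
            DeonticE.hyperSize H ≤ C * A.size ^ 4) ∧
      (∀ D : DeonticE.Derivation (DeonticE.rootOf A),
        ∀ H, D.Occurs H → DeonticE.Saturated H → ¬ DeonticE.Valid A) :=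
  ⟨DeonticE.inCoNP_validLang, DeonticE.inP_saturatedLang, 250, fun A =>
    ⟨fun D hD _ hH => (hD.hypInv D (DeonticE.hypInv_rootOf A) hH).size_le,
      DeonticE.exists_saturated_of_not_valid,
      fun D _ hH hsat => DeonticE.not_valid_of_occurs D hH hsat⟩⟩
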